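/- Let $(\Omega,\mathbb{P})$ be a probability space and let $(a_k)_{k\in\mathbb{Z}}$ be i.i.d. real random variables on it with $\mathbb{E}[a_k]=0$ and $\mathbb{E}[a_k^2]=1$. Let $\rho$ be the uniform probability measure on the unit sphere $\mathbb{S}^2\subset\mathbb{R}^3$. For each $n\ge 1$ let $\{Y_k\}_{-n\le k\le n}=\{Y_k^{(n)}\}$ be an arbitrary real orthonormal basis, in $L^2(\mathbb{S}^2,\rho)$, of the space $\mathcal{H}_n$ of spherical harmonics of degree $n$ (restrictions to $\mathbb{S}^2$ of the homogeneous harmonic polynomials of degree $n$), and put $$f_n=(2n+1)^{-1/2}\sum_{k=-n}^n a_kY_k .$$ For every $x\in\mathbb{S}^2$ identify $\mathbb{R}^2$ isometrically with $T_x\mathbb{S}^2$, the identification being arbitrary apart from depending measurably on $x$, and let $\exp_x:\mathbb{R}^2\cong T_x\mathbb{S}^2\to\mathbb{S}^2$ be the exponential map. Fix $R>0$ and set $$F_x(y)=f_n\big(\exp_x(Ry/n)\big),\qquad y\in B(1),$$ where $B(1)\subset\mathbb{R}^2$ is the closed unit disc. Let $\mu$ be the uniform probability measure on the unit circle $\mathbb{S}^1\subset\mathbb{R}^2$,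 and let $F_\mu$ be the Gaussian plane wave, i.e. the continuous centred stationary Gaussian field on $\mathbb{R}^2$ with $$\mathbb{E}[F_\mu(y)F_\mu(z)]=\int_{\mathbb{S}^1}e^{i\langle y-z,s\rangle}\,d\mu(s).$$ Let $C^1(B(1))$ be the space of continuously differentiable functions on $B(1)$ with norm $\|g\|=\max(\sup|g|,\sup|\nabla g|)$ and its Borel $\sigma$-algebra. Then: 1. For every $n\ge1$, $F_x\in C^1(B(1))$ for all $(\omega,x)\in\Omega\times\mathbb{S}^2$, the map $(\omega,x)\mapsto F_x$ is measurable, and the push-forward $\nu_n$ of $\mathbb{P}\otimes\rho$ under it is a probability measure on $C^1(B(1))$. 2. The rescaled plane wave $y\mapsto F_\mu(Ry)$ has a law on $C^1(B(1))$: there is a Borel probability measure $\gamma_R$ on $C^1(B(1))$ under which the evaluations $g\mapsto g(y)$, $y\in B(1)$, form a centred Gaussian process with covariance $\int_{\mathbb{S}^1}e^{i\langle Ry-Rz,s\rangle}d\mu(s)$; and for every realisation of $F_\mu$, on any probability space, the restriction of $y\mapsto F_\mu(Ry)$ to $B(1)$ lies almost surely in $C^1(B(1))$, is (almost everywhere)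 measurable as a $C^1(B(1))$-valued map, and has law $\gamma_R$. 3. $d_P(\nu_n,\gamma_R)\to 0$ as $n\to\infty$, where $d_P$ is the Lévy–Prokhorov distance on $C^1(B(1))$ with respect to the $C^1$-norm. -/

import Mathlib

open MeasureTheory ProbabilityTheory Filter Topology

noncomputable section

namespace RandomWave

/-- The Euclidean plane. -/
abbrev E2 : Type := EuclideanSpace ℝ (Fin 2)

/-- Euclidean three-space. -/
abbrev E3 : Type := EuclideanSpace ℝ (Fin 3)

/-- The unit circle in the plane. -/
abbrev S1 : Type := Metric.sphere (0 : E2) 1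

/-- The unit sphere in three-space. -/
abbrev S2 : Type := Metric.sphere (0 : E3) 1

/-- The closed unit disc `B(1)` of the plane. -/
abbrev unitBall : Set E2 := Metric.closedBall (0 : E2) 1

/-! ### Uniform measures -/

/-- The uniform probability measure on the unit sphere of `E` (normalised surface measure). -/
def uniformSphere (E : Type*) [NormedAddCommGroup E] [NormedSpace ℝ E] [MeasureSpace E] :
    Measure (Metric.sphere (0 : E) 1) :=
  ((volume : Measure E).toSphere Set.univ)⁻¹ • (volume : Measure E).toSphere

lemma isProbabilityMeasure_uniformSphere (E : Type*) [NormedAddCommGroup E] [NormedSpace ℝ E]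
    [MeasureSpace E] [BorelSpace E] [FiniteDimensional ℝ E] [Nontrivial E]
    [(volume : Measure E).IsAddHaarMeasure] : IsProbabilityMeasure (uniformSphere E) := by
  refine ⟨?_⟩
  have h0 : (volume : Measure E).toSphere Set.univ ≠ 0 := by
    rw [Ne, Measure.measure_univ_eq_zero]
    exact Measure.toSphere_ne_zero _
  simp only [uniformSphere, Measure.smul_apply, smul_eq_mul]
  exact ENNReal.inv_mul_cancel h0 (measure_ne_top _ _)

/-- The uniform probability measure `ρ` on the two-dimensional sphere. -/
def sphereMeasure : Measure S2 := uniformSphere E3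

instance : IsProbabilityMeasure sphereMeasure := isProbabilityMeasure_uniformSphere E3

/-- The uniform probability measure `μ` on the unit circle, as a measure on the plane. -/
def circleMeasure : Measure E2 := (uniformSphere E2).map Subtype.val

instance : IsProbabilityMeasure circleMeasure :=
  haveI := isProbabilityMeasure_uniformSphere E2
  Measure.isProbabilityMeasure_map measurable_subtype_coe.aemeasurable

/-! ### The space of continuously differentiable functions on the closed unit disc -/

/-- Extension by zero of a function on the closed unit disc. -/
def extendZero (f : unitBall → ℝ) : E2 → ℝ :=
  open Classical in fun z => if h : z ∈ unitBall then f ⟨z, h⟩ else 0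

/-- The pairs `(f, f')` of a continuous function on the closed unit disc and its derivative, the
derivative being continuous on the closed disc. -/
def c1Pairs : Submodule ℝ (C(unitBall, ℝ) × C(unitBall, E2 →L[ℝ] ℝ)) where
  carrier := {p | ∀ y : unitBall, HasFDerivWithinAt (extendZero p.1) (p.2 y) unitBall y}
  add_mem' := by
    intro p q hp hq y
    have h : extendZero ((p + q).1 : C(unitBall, ℝ)) = extendZero p.1 + extendZero q.1 := by
      funext z
      by_cases hz : z ∈ unitBall <;> simp [extendZero, hz]
    rw [h]
    exact (hp y).add (hq y)
  zero_mem' := by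
    intro y
    have h : extendZero ((0 : C(unitBall, ℝ) × C(unitBall, E2 →L[ℝ] ℝ)).1) = fun _ => 0 := by
      funext z
      by_cases hz : z ∈ unitBall <;> simp [extendZero, hz]
    rw [h]
    exact hasFDerivWithinAt_const _ _ _
  smul_mem' := by
    intro c p hp y
    have h : extendZero ((c • p).1 : C(unitBall, ℝ)) = c • extendZero p.1 := by
      funext z
      by_cases hz : z ∈ unitBall <;> simp [extendZero, hz]
    rw [h]
    exact (hp y).const_smul c

/-- The Banach space `C¹(B(1))`. The norm is inherited from the product, so that the norm of `g` is
the larger one of `sup |g|` and `sup ‖g'‖`, the suprema being over the closed unit disc. -/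
abbrev C1Ball : Type := c1Pairs

namespace C1Ball

/-- `C¹(B(1))` carries its Borel σ-algebra. -/
instance : MeasurableSpace C1Ball := borel C1Ball

instance : BorelSpace C1Ball := ⟨rfl⟩

/-- The value of `g ∈ C¹(B(1))` at a point. -/
def val (g : C1Ball) (y : unitBall) : ℝ := (g : C(unitBall, ℝ) × C(unitBall, E2 →L[ℝ] ℝ)).1 y

/-- The derivative of `g ∈ C¹(B(1))` at a point. -/
def deriv (g : C1Ball) (y : unitBall) : E2 →L[ℝ] ℝ :=
  (g : C(unitBall, ℝ) × C(unitBall, E2 →L[ℝ] ℝ)).2 y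

lemma norm_eq (g : C1Ball) :
    ‖g‖ = max ‖(g : C(unitBall, ℝ) × C(unitBall, E2 →L[ℝ] ℝ)).1‖
      ‖(g : C(unitBall, ℝ) × C(unitBall, E2 →L[ℝ] ℝ)).2‖ := rfl

end C1Ball

lemma uniqueDiffOn_unitBall : UniqueDiffOn ℝ unitBall :=
  uniqueDiffOn_convex (convex_closedBall _ _) <| by
    rw [interior_closedBall _ one_ne_zero]
    exact Metric.nonempty_ball.2 one_pos

lemma mem_c1Pairs_of_contDiffOn {g : E2 → ℝ} (h : ContDiffOn ℝ 1 g unitBall) :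
    ((⟨unitBall.domRestrict g, h.continuousOn.domRestrict⟩,
      ⟨unitBall.domRestrict (fderivWithin ℝ g unitBall),
        (h.continuousOn_fderivWithin uniqueDiffOn_unitBall le_rfl).domRestrict⟩) :
      C(unitBall, ℝ) × C(unitBall, E2 →L[ℝ] ℝ)) ∈ c1Pairs := by
  intro y
  refine ((h.differentiableOn one_ne_zero) y y.2).hasFDerivWithinAt.congr ?_ ?_
  · intro z hz
    simp only [extendZero, dif_pos hz]
    rfl
  · simp only [extendZero, dif_pos y.2]
    rfl

/-- The element of `C¹(B(1))` given by the restriction to the closed unit disc of a function on the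
plane that is continuously differentiable there. The value for other functions is immaterial. -/
def toC1Ball (g : E2 → ℝ) : C1Ball :=
  open Classical in
  if h : ContDiffOn ℝ 1 g unitBall then ⟨_, mem_c1Pairs_of_contDiffOn h⟩ else 0

/-! ### Spherical harmonics -/

/-- The Laplacian on polynomials in three variables. -/
def polyLaplacian : MvPolynomial (Fin 3) ℝ →ₗ[ℝ] MvPolynomial (Fin 3) ℝ :=
  ∑ i : Fin 3, (MvPolynomial.pderiv i).toLinearMap ∘ₗ (MvPolynomial.pderiv i).toLinearMap

/-- Restriction of a polynomial in three variables to the unit sphere. -/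
def restrictToSphere : MvPolynomial (Fin 3) ℝ →ₗ[ℝ] (S2 → ℝ) where
  toFun p := fun x => MvPolynomial.eval (fun i => (x : E3) i) p
  map_add' p q := by funext x; simp
  map_smul' c p := by funext x; simp

/-- The space `ℋ_n` of spherical harmonics of degree `n`: the restrictions to the sphere of the
homogeneous harmonic polynomials of degree `n`. -/
def sphericalHarmonics (n : ℕ) : Submodule ℝ (S2 → ℝ) :=
  (MvPolynomial.homogeneousSubmodule (Fin 3) ℝ n ⊓ LinearMap.ker polyLaplacian).map
    restrictToSphere

/-- `Y k`, `-n ≤ k ≤ n`, is an orthonormal basis of `ℋ_n ⊂ L²(𝕊², ρ)`. The values of `Y` at other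
indices play no role. -/
structure IsHarmonicBasis (n : ℕ) (Y : ℤ → S2 → ℝ) : Prop where
  mem : ∀ k ∈ Finset.Icc (-(n : ℤ)) n, Y k ∈ sphericalHarmonics n
  orthonormal : ∀ k ∈ Finset.Icc (-(n : ℤ)) n, ∀ l ∈ Finset.Icc (-(n : ℤ)) n,
    ∫ x, Y k x * Y l x ∂sphereMeasure = if k = l then 1 else 0
  span : sphericalHarmonics n ≤
    Submodule.span ℝ (Y '' (Finset.Icc (-(n : ℤ)) n : Finset ℤ))

/-! ### The exponential map and the local random functions -/

/-- The tangent plane of the sphere at `x`, the orthogonal complement of `x`. -/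
abbrev TangentPlane (x : S2) : Type := ((ℝ ∙ (x : E3))ᗮ : Submodule ℝ E3)

/-- The exponential map of the sphere, `exp_x v = cos ‖v‖ x + (sin ‖v‖ / ‖v‖) v`. -/
def sphereExp (x : S2) (v : TangentPlane x) : S2 :=
  ⟨Real.cos ‖v‖ • (x : E3) + Real.sinc ‖v‖ • (v : E3), by
    have hx : ‖(x : E3)‖ = 1 := by simp
    have hv : inner ℝ (x : E3) (v : E3) = 0 :=
      Submodule.mem_orthogonal_singleton_iff_inner_right.1 v.2
    have hs : Real.sinc ‖v‖ * ‖v‖ = Real.sin ‖v‖ := by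
      by_cases h : ‖v‖ = 0
      · simp [h]
      · rw [Real.sinc_of_ne_zero h, div_mul_cancel₀ _ h]
    have h1 : ‖Real.cos ‖v‖ • (x : E3) + Real.sinc ‖v‖ • (v : E3)‖ ^ 2 = 1 := by
      rw [norm_add_sq_real, norm_smul, norm_smul, inner_smul_left, inner_smul_right, hv, hx,
        mul_pow, mul_pow, Real.norm_eq_abs, Real.norm_eq_abs, sq_abs, sq_abs]
      have h2 : ‖(v : E3)‖ = ‖v‖ := rfl
      rw [h2, ← mul_pow (Real.sinc ‖v‖), hs]
      simp
    rw [mem_sphere_zero_iff_norm]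
    exact (pow_eq_one_iff_of_nonneg (norm_nonneg _) two_ne_zero).1 h1⟩

/-- The random spherical harmonic `f_n = (2n+1)^{-1/2} ∑_{-n ≤ k ≤ n} a_k Y_k`. -/
def randomHarmonic {Ω : Type*} (a : ℤ → Ω → ℝ) (Y : ℤ → S2 → ℝ) (n : ℕ) (ω : Ω) (x : S2) : ℝ :=
  (√(2 * n + 1))⁻¹ * ∑ k ∈ Finset.Icc (-(n : ℤ)) n, a k ω * Y k x

/-- The rescaled function `F_x(y) = f_n(exp_x(R y / n))`, where `e x` is the isometry that identifies
the plane with the tangent plane at `x`. -/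
def localField {Ω : Type*} (a : ℤ → Ω → ℝ) (Y : ℤ → S2 → ℝ)
    (e : (x : S2) → E2 ≃ₗᵢ[ℝ] TangentPlane x) (R : ℝ) (n : ℕ) (p : Ω × S2) (y : E2) : ℝ :=
  randomHarmonic a Y n p.1 (sphereExp p.2 (e p.2 ((R / n) • y)))

/-! ### Gaussian fields -/

/-- `F` is the centred stationary Gaussian field on the plane with spectral measure `μ`: it is
continuous, has Gaussian finite-dimensional distributions and mean zero, and
`𝔼[F(x) F(y)] = ∫ exp(i ⟨x - y, s⟩) dμ(s)`. -/
structure IsGaussianField {Ω : Type*} [MeasurableSpace Ω] (F : E2 → Ω → ℝ) (P : Measure Ω)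
    (μ : Measure E2) : Prop where
  continuous : ∀ ω, Continuous fun x => F x ω
  gaussian : IsGaussianProcess F P
  centered : ∀ x, ∫ ω, F x ω ∂P = 0
  covariance : ∀ x y, ((∫ ω, F x ω * F y ω ∂P : ℝ) : ℂ) = charFun μ (x - y)

/-- `γ` is, as a measure on `C¹(B(1))`, the law of the restriction to `B(1)` of `y ↦ F_μ(R y)`, with
`F_μ` the Gaussian plane wave: under `γ`, the values `g(y)`, `y ∈ B(1)`, form a centred Gaussian
process with the covariance of `F_μ(R y)`, `y ∈ B(1)`. -/
structure IsPlaneWaveLaw (R : ℝ) (γ : Measure C1Ball) : Prop where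
  prob : IsProbabilityMeasure γ
  gaussian : IsGaussianProcess (fun (y : unitBall) (g : C1Ball) => g.val y) γ
  centered : ∀ y : unitBall, ∫ g, g.val y ∂γ = 0
  covariance : ∀ y z : unitBall, ((∫ g, g.val y * g.val z ∂γ : ℝ) : ℂ) =
    charFun circleMeasure (R • (y : E2) - R • (z : E2))

end RandomWave

end

open RandomWave

/-!
Two facts about a random spherical harmonic near a typical point have to be proved: its
finite-dimensional distributions converge to those of the plane wave, and its local laws are tight on
`C¹(B(1))`.

*Covariance.* The kernel `K(x, y) = ∑ Y_k(x) Y_k(y)` reproduces `ℋ_n`, hence does not depend on the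
basis and is invariant under rotations. As a function of the angle `θ` between `x` and `y` it solves
the Legendre equation, which has only one regular solution with a given value at `θ = 0`; Laplace's
integral is another solution, and so `K = (2n + 1) P_n(cos θ)`
(`IsHarmonicBasis.kernel_eq_legendre`). Dominated convergence in Laplace's integral gives
`P_n(cos (r / n)) → J₀(r)` (`tendsto_legendre`), and `J₀(‖w‖)` is the characteristic function of the
uniform measure on the circle (`charFun_circleMeasure`), that is, the covariance of the plane wave.

*No dominating coefficient.* For fixed `x`, a linear combination of values `F_x(y)` is a weighted sum
of the independent variables `a_k`, with total variance converging by the above. The basis is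
arbitrary, so individual weights can be large at some `x`, but this happens only on a set of small
measure. If `B` is the set of `x` where `|Y_k(ψ x)| > ε √(2n + 1)`, for a map `ψ` close to the
identity, let `s` be the sign of `Y_k ∘ ψ`. Bounding one coefficient by the sum of all gives
`(∫_B s Y_k ∘ ψ)² ≤ ∑_l (∫_B s Y_l ∘ ψ)² = ∫∫_{B × B} s s' K(ψ x, ψ x')`,
and `K = o(n)` away from the diagonal and the antidiagonal, by an energy estimate for the Legendre
equation (`IsLegendreSolution.energy_le`). With suitable scales this yields `ρ(B) = o(1 / n)`, and
the union over the `2n + 1` indices `k` still has small measure (`tendsto_measure_exists_large`).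
Outside it Lindeberg's comparison of characteristic functions applies, with two moments only
(`tendsto_integral_exp_localField`).

*Tightness.* A harmonic polynomial equals its own Gaussian averages (`integral_ev_mul_gauss`). Hence
the local function is an average of Gaussian bumps `y ↦ g(W - Z(y))`, where `n⁻¹ Z(y)` is the position
of `exp_x(R y / n)` relative to `x` in a moving frame, with the values of the extended field at
`x + W / n`, with `W` read in that frame, as weights
(`toC1Ball_localField_eq_integral`). The weights have second moment at most
`‖x + W / n‖ ^ (2n) ≤ exp (2 ‖W‖)`, while the bumps multiplied by `exp (2 ‖W‖)` range over a totally
bounded subset of `C¹(B(1))`. The closed convex hull of that set is compact, and Markov's inequality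
puts the local function into a multiple of it with high probability
(`isTightMeasureSet_localField`). No estimate of derivatives of spherical harmonics is needed.

*Conclusion.* By Prokhorov's theorem the local laws have limit points; all of these have the
finite-dimensional distributions of the plane wave, and a law on `C¹(B(1))` is determined by them,
because evaluations at a dense sequence embed `C¹(B(1))` measurably into the space of real sequences
(`C1Ball.measurableEmbedding_denseVal`). So there is a unique limit `γ`, which is in particular a law
of the plane wave on `C¹(B(1))`. A continuous realisation of the plane wave has, on the dense
sequence, the distribution of a `γ`-random `C¹` function, and is therefore almost surely `C¹` on the
disc, with law `γ` (`IsGaussianField.map_toC1Ball`).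
-/

open MeasureTheory ProbabilityTheory Filter Topology

namespace RandomWave

/-! ### The Banach space of continuously differentiable functions on the disc -/

lemma extendZero_apply (f : unitBall → ℝ) (y : unitBall) : extendZero f y = f y := by
  simp only [extendZero, dif_pos y.2]

/-- Uniform limits, together with their derivatives, of `C¹` functions on the disc are `C¹`: the
mean value inequality on the convex disc makes the first order expansions uniform. -/
lemma isClosed_c1Pairs :
    IsClosed (c1Pairs : Set (C(unitBall, ℝ) × C(unitBall, E2 →L[ℝ] ℝ))) := by
  refine isClosed_of_closure_subset fun p hp y => ?_
  rw [hasFDerivWithinAt_iff_isLittleO, Asymptotics.isLittleO_iff]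
  intro c hc
  have hcont : ContinuousAt p.2 y := p.2.continuous.continuousAt
  obtain ⟨δ, hδ, hδp⟩ := Metric.continuousAt_iff.1 hcont (c / 3) (by positivity)
  have key : ∀ z : unitBall, dist (z : E2) y < δ → ∀ η, 0 < η →
      |p.1 z - p.1 y - p.2 y ((z : E2) - y)| ≤ c * ‖(z : E2) - y‖ + η := by
    intro z hz η hη
    set ε := min (c / 3) (η / 4) with hε
    have hε0 : 0 < ε := by positivity
    obtain ⟨q, hq, hqp⟩ := (Metric.mem_closure_iff (a := p)
      (s := (c1Pairs : Set (C(unitBall, ℝ) × C(unitBall, E2 →L[ℝ] ℝ))))).1 hp ε hε0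
    have h1 : ∀ w, |p.1 w - q.1 w| ≤ ε := fun w => by
      have := (ContinuousMap.dist_apply_le_dist (f := p.1) (g := q.1) w).trans
        ((le_max_left _ _ : dist p.1 q.1 ≤ dist p q).trans hqp.le)
      rwa [Real.dist_eq] at this
    have h2 : ∀ w, ‖p.2 w - q.2 w‖ ≤ ε := fun w => by
      have := (ContinuousMap.dist_apply_le_dist (f := p.2) (g := q.2) w).trans
        ((le_max_right _ _ : dist p.2 q.2 ≤ dist p q).trans hqp.le)
      rwa [dist_eq_norm] at this
    let s : Set E2 := unitBall ∩ Metric.ball (y : E2) δ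
    have hs : Convex ℝ s := (convex_closedBall _ _).inter (convex_ball _ _)
    classical
    let q' : E2 → E2 →L[ℝ] ℝ := fun w => if h : w ∈ unitBall then q.2 ⟨w, h⟩ else 0
    have hq' : ∀ w ∈ s, HasFDerivWithinAt (extendZero q.1) (q' w) s w := by
      intro w hw
      have := (hq ⟨w, hw.1⟩).mono (Set.inter_subset_left : s ⊆ unitBall)
      simpa only [q', dif_pos hw.1] using this
    have hb : ∀ w ∈ s, ‖q' w - p.2 y‖ ≤ c / 3 + c / 3 := by
      intro w hw
      simp only [q', dif_pos hw.1]
      have ha : ‖p.2 ⟨w, hw.1⟩ - p.2 y‖ ≤ c / 3 := by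
        rw [← dist_eq_norm]
        exact (hδp (by simpa [Subtype.dist_eq] using hw.2)).le
      calc ‖q.2 ⟨w, hw.1⟩ - p.2 y‖ = ‖(p.2 ⟨w, hw.1⟩ - p.2 y) - (p.2 ⟨w, hw.1⟩ - q.2 ⟨w, hw.1⟩)‖ := by
            congr 1; abel
        _ ≤ _ := (norm_sub_le _ _).trans (add_le_add ha ((h2 _).trans (min_le_left _ _)))
    have h3 := hs.norm_image_sub_le_of_norm_hasFDerivWithin_le' hq' hb
      (x := (y : E2)) (y := (z : E2)) ⟨y.2, Metric.mem_ball_self hδ⟩ ⟨z.2, hz⟩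
    rw [extendZero_apply, extendZero_apply, Real.norm_eq_abs] at h3
    have h4 := h1 z
    have h5 := h1 y
    have hε4 : ε ≤ η / 4 := min_le_right _ _
    have h6 : (c / 3 + c / 3) * ‖(z : E2) - y‖ ≤ c * ‖(z : E2) - y‖ := by
      gcongr; linarith
    rw [abs_le] at *
    constructor <;> linarith [h3.1, h3.2, h4.1, h4.2, h5.1, h5.2]
  rw [eventually_nhdsWithin_iff]
  filter_upwards [Metric.ball_mem_nhds (y : E2) hδ] with z hz hzb
  have h := le_of_forall_pos_le_add (key ⟨z, hzb⟩ hz)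
  have e1 : extendZero p.1 z = p.1 ⟨z, hzb⟩ := extendZero_apply p.1 ⟨z, hzb⟩
  rw [e1, extendZero_apply, Real.norm_eq_abs]
  exact h

instance : CompleteSpace C1Ball := isClosed_c1Pairs.completeSpace_coe

instance : SecondCountableTopology C1Ball :=
  TopologicalSpace.Subtype.secondCountableTopology _

lemma isCompletelyMetrizableSpace_of_complete (α : Type*) [MetricSpace α] [CompleteSpace α] :
    TopologicalSpace.IsCompletelyMetrizableSpace α := inferInstance

instance : PolishSpace C1Ball where
  toIsCompletelyMetrizableSpace := isCompletelyMetrizableSpace_of_complete C1Ball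

namespace C1Ball

lemma ext_val {g g' : C1Ball} (h : ∀ y, g.val y = g'.val y) : g = g' := by
  have h1 : (g : C(unitBall, ℝ) × C(unitBall, E2 →L[ℝ] ℝ)).1 =
      (g' : C(unitBall, ℝ) × C(unitBall, E2 →L[ℝ] ℝ)).1 := ContinuousMap.ext h
  refine Subtype.ext (Prod.ext h1 (ContinuousMap.ext fun y => ?_))
  have e1 := g.2 y
  have e2 := g'.2 y
  rw [h1] at e1
  exact (uniqueDiffOn_unitBall y y.2).eq e1 e2

/-- Evaluation at a point, as a continuous linear functional. -/
noncomputable def evalCLM (y : unitBall) : C1Ball →L[ℝ] ℝ :=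
  (ContinuousMap.evalCLM ℝ y).comp ((ContinuousLinearMap.fst ℝ _ _).comp c1Pairs.subtypeL)

lemma evalCLM_apply (y : unitBall) (g : C1Ball) : evalCLM y g = g.val y := rfl

lemma continuous_val (y : unitBall) : Continuous fun g : C1Ball => g.val y :=
  (evalCLM y).continuous

lemma continuous_val_right (g : C1Ball) : Continuous g.val :=
  (g : C(unitBall, ℝ) × C(unitBall, E2 →L[ℝ] ℝ)).1.continuous

lemma contDiffOn_extendZero (g : C1Ball) : ContDiffOn ℝ 1 (extendZero g.val) unitBall := by
  have h : ∀ y : unitBall, fderivWithin ℝ (extendZero g.val) unitBall y = g.deriv y :=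
    fun y => (g.2 y).fderivWithin (uniqueDiffOn_unitBall y y.2)
  have h1 : (1 : WithTop ℕ∞) = 0 + 1 := by simp
  rw [h1, contDiffOn_succ_iff_fderivWithin uniqueDiffOn_unitBall]
  refine ⟨fun y hy => (g.2 ⟨y, hy⟩).differentiableWithinAt, by simp, ?_⟩
  rw [contDiffOn_zero, continuousOn_iff_continuous_domRestrict]
  have : unitBall.domRestrict (fderivWithin ℝ (extendZero g.val) unitBall) = g.deriv := by
    funext y; exact h y
  rw [this]
  exact (g : C(unitBall, ℝ) × C(unitBall, E2 →L[ℝ] ℝ)).2.continuous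

lemma norm_le {g : C1Ball} {c : ℝ} (hc : 0 ≤ c) (h1 : ∀ y, |g.val y| ≤ c)
    (h2 : ∀ y, ‖g.deriv y‖ ≤ c) : ‖g‖ ≤ c := by
  rw [norm_eq]
  exact max_le ((ContinuousMap.norm_le _ hc).2 h1) ((ContinuousMap.norm_le _ hc).2 h2)

/-- The values of a `C¹` function at the points of a dense sequence of the disc. -/
noncomputable def denseVal (g : C1Ball) (i : ℕ) : ℝ := g.val (TopologicalSpace.denseSeq unitBall i)

lemma eqOn_of_denseVal {f g : unitBall → ℝ} (hf : Continuous f) (hg : Continuous g)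
    (h : ∀ i, f (TopologicalSpace.denseSeq unitBall i) =
      g (TopologicalSpace.denseSeq unitBall i)) : f = g :=
  (TopologicalSpace.denseRange_denseSeq unitBall).equalizer hf hg (funext h)

/-- By the Lusin–Souslin theorem the Borel structure of `C¹(B(1))` is generated by countably many
evaluations. -/
lemma measurableEmbedding_denseVal : MeasurableEmbedding denseVal := by
  refine Measurable.measurableEmbedding
    (measurable_pi_lambda _ fun i => (continuous_val _).measurable) fun g g' h => ?_
  refine C1Ball.ext_val fun y => ?_
  exact congrFun (eqOn_of_denseVal g.continuous_val_right g'.continuous_val_right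
    fun i => congrFun h i) y

lemma measurable_of_val {α : Type*} [MeasurableSpace α] {f : α → C1Ball}
    (h : ∀ y, Measurable fun a => (f a).val y) : Measurable f :=
  measurableEmbedding_denseVal.measurable_comp_iff.1 (measurable_pi_lambda _ fun _ => h _)

end C1Ball

lemma toC1Ball_val {g : E2 → ℝ} (h : ContDiffOn ℝ 1 g unitBall) (y : unitBall) :
    (toC1Ball g).val y = g y := by
  rw [toC1Ball, dif_pos h]; rfl

lemma toC1Ball_deriv {g : E2 → ℝ} (h : ContDiffOn ℝ 1 g unitBall) (y : unitBall) :
    (toC1Ball g).deriv y = fderivWithin ℝ g unitBall y := by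
  rw [toC1Ball, dif_pos h]; rfl

lemma toC1Ball_deriv_of_contDiff {g : E2 → ℝ} (h : ContDiff ℝ 1 g) (y : unitBall) :
    (toC1Ball g).deriv y = fderiv ℝ g y := by
  rw [toC1Ball_deriv h.contDiffOn]
  exact ((h.differentiable one_ne_zero) _).fderivWithin (uniqueDiffOn_unitBall y y.2)

/-- A jointly `C¹` family of functions on the disc depends continuously, in `C¹(B(1))`, on its
parameter. -/
lemma continuous_toC1Ball {A : Type*} [NormedAddCommGroup A] [NormedSpace ℝ A] {f : A × E2 → ℝ}
    (hf : ContDiff ℝ 1 f) : Continuous fun a => toC1Ball fun y => f (a, y) := by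
  have hfa : ∀ a, ContDiff ℝ 1 fun y => f (a, y) := fun a => by fun_prop
  have hval : Continuous fun a => (⟨fun y : unitBall => f (a, y),
      by have := (hfa a).continuous; fun_prop⟩ : C(unitBall, ℝ)) := by
    refine ContinuousMap.continuous_of_continuous_uncurry _ ?_
    have := hf.continuous
    simp only [Function.uncurry_def, ContinuousMap.coe_mk]
    fun_prop
  have hd : ∀ a (y : E2), fderiv ℝ (fun y => f (a, y)) y =
      (fderiv ℝ f (a, y)).comp (ContinuousLinearMap.inr ℝ A E2) := by
    intro a y
    have h1 : HasFDerivAt f (fderiv ℝ f (a, y)) (a, y) :=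
      (hf.differentiable one_ne_zero _).hasFDerivAt
    exact (h1.comp y (hasFDerivAt_prodMk_right a y)).fderiv
  have hfd : Continuous (fderiv ℝ f) := hf.continuous_fderiv one_ne_zero
  have hder : Continuous fun a => (⟨fun y : unitBall => (fderiv ℝ f (a, y)).comp
      (ContinuousLinearMap.inr ℝ A E2), by fun_prop⟩ : C(unitBall, E2 →L[ℝ] ℝ)) := by
    refine ContinuousMap.continuous_of_continuous_uncurry _ ?_
    simp only [Function.uncurry_def, ContinuousMap.coe_mk]
    fun_prop
  refine Continuous.subtype_mk (f := fun a => ((toC1Ball fun y => f (a, y) : C1Ball) :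
    C(unitBall, ℝ) × C(unitBall, E2 →L[ℝ] ℝ))) ?_ fun a => (toC1Ball _).2
  convert hval.prodMk hder using 2 with a
  refine Prod.ext (ContinuousMap.ext fun y => ?_) (ContinuousMap.ext fun y => ?_)
  · exact toC1Ball_val (hfa a).contDiffOn y
  · exact (toC1Ball_deriv_of_contDiff (hfa a) y).trans (hd a y)

/-! ### Polynomials as functions on three-space -/

/-- The polynomial function on three-space defined by `p`. -/
noncomputable def ev (p : MvPolynomial (Fin 3) ℝ) (X : E3) : ℝ := MvPolynomial.eval (fun i => X i) p

lemma ev_add (p q : MvPolynomial (Fin 3) ℝ) (X : E3) : ev (p + q) X = ev p X + ev q X := by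
  simp [ev]

lemma ev_mul (p q : MvPolynomial (Fin 3) ℝ) (X : E3) : ev (p * q) X = ev p X * ev q X := by
  simp [ev]

lemma ev_C (a : ℝ) (X : E3) : ev (MvPolynomial.C a) X = a := by simp [ev]

lemma ev_X (i : Fin 3) (X : E3) : ev (MvPolynomial.X i) X = X i := by simp [ev]

lemma hasFDerivAt_ev (p : MvPolynomial (Fin 3) ℝ) (X : E3) :
    HasFDerivAt (ev p) (∑ i, ev (MvPolynomial.pderiv i p) X • (EuclideanSpace.proj i : E3 →L[ℝ] ℝ))
      X := by
  induction p using MvPolynomial.induction_on with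
  | C a =>
    have h : ev (MvPolynomial.C a) = fun _ => a := funext fun X => ev_C a X
    rw [h]
    exact (hasFDerivAt_const a X).congr_fderiv (by simp [ev])
  | add p q hp hq =>
    have h : ev (p + q) = ev p + ev q := funext fun X => ev_add p q X
    rw [h]
    exact (hp.add hq).congr_fderiv (by simp [ev_add, add_smul, Finset.sum_add_distrib])
  | mul_X p j hp =>
    have h : ev (p * MvPolynomial.X j) =
        ev p * fun X => (EuclideanSpace.proj j : E3 →L[ℝ] ℝ) X := by
      funext X; simp [ev_mul, ev_X]
    rw [h]
    refine (hp.mul (EuclideanSpace.proj j : E3 →L[ℝ] ℝ).hasFDerivAt).congr_fderiv ?_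
    simp only [Derivation.leibniz, smul_eq_mul, ev_add, ev_mul, ev_X, add_smul,
      Finset.sum_add_distrib, MvPolynomial.pderiv_X]
    congr 1
    · rw [Finset.sum_eq_single j]
      · simp [ev]
      · intro b _ hb
        rw [Pi.single_eq_of_ne hb.symm]
        simp [ev]
      · simp
    · simp [Finset.smul_sum, smul_smul]

lemma contDiff_ev (p : MvPolynomial (Fin 3) ℝ) {m : WithTop ℕ∞} : ContDiff ℝ m (ev p) := by
  induction p using MvPolynomial.induction_on with
  | C a =>
    have h : ev (MvPolynomial.C a) = fun _ => a := funext fun X => ev_C a X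
    rw [h]; exact contDiff_const
  | add p q hp hq =>
    have h : ev (p + q) = fun X => ev p X + ev q X := funext fun X => ev_add p q X
    rw [h]; exact hp.add hq
  | mul_X p j hp =>
    have h : ev (p * MvPolynomial.X j) =
        fun X => ev p X * (EuclideanSpace.proj j : E3 →L[ℝ] ℝ) X := by
      funext X; simp [ev_mul, ev_X]
    rw [h]; exact hp.mul (ContinuousLinearMap.contDiff _)

lemma continuous_ev (p : MvPolynomial (Fin 3) ℝ) : Continuous (ev p) :=
  (contDiff_ev (m := 0) p).continuous

lemma hasDerivAt_ev_comp (p : MvPolynomial (Fin 3) ℝ) {γ : ℝ → E3} {γ' : E3} {t : ℝ}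
    (h : HasDerivAt γ γ' t) :
    HasDerivAt (fun t => ev p (γ t)) (∑ i, ev (MvPolynomial.pderiv i p) (γ t) * γ' i) t := by
  exact ((hasFDerivAt_ev p (γ t)).comp_hasDerivAt t h).congr_deriv (by simp)

lemma ev_smul {p : MvPolynomial (Fin 3) ℝ} {n : ℕ} (hp : p.IsHomogeneous n) (c : ℝ) (X : E3) :
    ev p (c • X) = c ^ n * ev p X := by
  have h : p.IsHomogeneous n := hp
  simp only [ev]
  rw [MvPolynomial.eval_eq, MvPolynomial.eval_eq, Finset.mul_sum]
  refine Finset.sum_congr rfl fun d hd => ?_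
  have hdeg : ∑ i ∈ d.support, d i = n := by
    have := h (MvPolynomial.mem_support_iff.1 hd)
    rw [← this, Finsupp.weight_apply, Finsupp.sum]
    simp
  simp only [PiLp.smul_apply, smul_eq_mul, mul_pow, Finset.prod_mul_distrib]
  rw [Finset.prod_pow_eq_pow_sum, hdeg]
  ring

/-- Polynomials grow more slowly than any exponential. -/
lemma exists_abs_ev_le (p : MvPolynomial (Fin 3) ℝ) :
    ∀ ε > 0, ∃ C : ℝ, 0 ≤ C ∧ ∀ X : E3, |ev p X| ≤ C * Real.exp (ε * ‖X‖) := by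
  induction p using MvPolynomial.induction_on with
  | C a =>
    intro ε hε
    refine ⟨|a|, abs_nonneg a, fun X => ?_⟩
    rw [ev_C]
    exact le_mul_of_one_le_right (abs_nonneg a) (Real.one_le_exp (by positivity))
  | add p q hp hq =>
    intro ε hε
    obtain ⟨C, hC, h1⟩ := hp ε hε
    obtain ⟨D, hD, h2⟩ := hq ε hε
    refine ⟨C + D, add_nonneg hC hD, fun X => ?_⟩
    rw [ev_add, add_mul]
    exact (abs_add_le _ _).trans (add_le_add (h1 X) (h2 X))
  | mul_X p j hp =>
    intro ε hε
    obtain ⟨C, hC, h1⟩ := hp (ε / 2) (by positivity)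
    refine ⟨C * (2 / ε), by positivity, fun X => ?_⟩
    rw [ev_mul, ev_X, abs_mul]
    have h2 : |X j| ≤ 2 / ε * Real.exp (ε / 2 * ‖X‖) := by
      have h3 : |X j| ≤ ‖X‖ := PiLp.norm_apply_le X j
      have h4 := Real.add_one_le_exp (ε / 2 * ‖X‖)
      have h5 : ‖X‖ = 2 / ε * (ε / 2 * ‖X‖) := by field_simp
      refine h3.trans ?_
      rw [h5]
      have : (0 : ℝ) < 2 / ε := by positivity
      refine mul_le_mul_of_nonneg_left ?_ this.le
      rw [← h5]
      linarith
    calc |ev p X| * |X j| ≤ (C * Real.exp (ε / 2 * ‖X‖)) * (2 / ε * Real.exp (ε / 2 * ‖X‖)) :=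
          mul_le_mul (h1 X) h2 (abs_nonneg _) (by positivity)
      _ = C * (2 / ε) * Real.exp (ε * ‖X‖) := by
          rw [show ε * ‖X‖ = ε / 2 * ‖X‖ + ε / 2 * ‖X‖ by ring, Real.exp_add]; ring

/-! ### Gaussian averages of harmonic polynomials -/

lemma integrable_exp_neg_norm : Integrable fun W : E3 => Real.exp (-‖W‖) := by
  have h := (integrable_one_add_norm (E := E3) (μ := volume) (r := 4)
    (by rw [finrank_euclideanSpace]; norm_num)).const_mul 256
  refine h.mono' (by fun_prop) (.of_forall fun W => ?_)
  rw [Real.norm_eq_abs, abs_of_pos (Real.exp_pos _)]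
  have h1 : (1 + ‖W‖) / 4 ≤ Real.exp (‖W‖ / 4) := by
    linarith [Real.add_one_le_exp (‖W‖ / 4), norm_nonneg W]
  have h2 : ((1 + ‖W‖) / 4) ^ 4 ≤ Real.exp ‖W‖ := by
    calc ((1 + ‖W‖) / 4) ^ 4 ≤ Real.exp (‖W‖ / 4) ^ 4 := by gcongr
      _ = Real.exp ‖W‖ := by rw [← Real.exp_nat_mul]; congr 1; push_cast; ring
  have h3 : (1 + ‖W‖) ^ (-4 : ℝ) = ((1 + ‖W‖) ^ 4)⁻¹ := by
    rw [Real.rpow_neg (by positivity)]; norm_cast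
  rw [h3, Real.exp_neg, ← div_eq_mul_inv, inv_eq_one_div, div_le_div_iff₀ (Real.exp_pos _) (by positivity)]
  have : (1 + ‖W‖) ^ 4 = 256 * ((1 + ‖W‖) / 4) ^ 4 := by ring
  linarith

/-- The standard Gaussian density on three-space. -/
noncomputable def gauss (W : E3) : ℝ :=
  (∫ V : E3, Real.exp (-(1 / 2) * ‖V‖ ^ 2))⁻¹ * Real.exp (-(1 / 2) * ‖W‖ ^ 2)

lemma integral_exp_sq_pos : 0 < ∫ V : E3, Real.exp (-(1 / 2) * ‖V‖ ^ 2) := by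
  rw [GaussianFourier.integral_rexp_neg_mul_sq_norm (by norm_num)]
  positivity

lemma integral_gauss : ∫ W, gauss W = 1 := by
  simp only [gauss]
  rw [integral_const_mul]
  exact inv_mul_cancel₀ integral_exp_sq_pos.ne'

lemma contDiff_gauss {m : WithTop ℕ∞} : ContDiff ℝ m gauss := by
  unfold gauss
  exact contDiff_const.mul ((contDiff_const.mul (contDiff_norm_sq ℝ)).exp)

lemma gauss_nonneg (W : E3) : 0 ≤ gauss W := by
  have := integral_exp_sq_pos
  unfold gauss
  positivity

lemma hasFDerivAt_gauss (W : E3) : HasFDerivAt gauss (-gauss W • innerSL ℝ W) W := by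
  have h := (((hasStrictFDerivAt_norm_sq W).hasFDerivAt.const_mul (-(1 / 2))).exp).const_mul
    (∫ V : E3, Real.exp (-(1 / 2) * ‖V‖ ^ 2))⁻¹
  refine h.congr_fderiv ?_
  ext v
  simp [gauss]
  ring

lemma exists_gauss_le : ∃ C : ℝ, 0 ≤ C ∧ ∀ W, (1 + ‖W‖) * gauss W ≤ C * Real.exp (-3 * ‖W‖) := by
  have hpos := integral_exp_sq_pos
  refine ⟨(∫ V : E3, Real.exp (-(1 / 2) * ‖V‖ ^ 2))⁻¹ * Real.exp 8, by positivity, fun W => ?_⟩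
  have h1 : 1 + ‖W‖ ≤ Real.exp ‖W‖ := by linarith [Real.add_one_le_exp ‖W‖]
  have h2 : (1 + ‖W‖) * Real.exp (-(1 / 2) * ‖W‖ ^ 2) ≤ Real.exp 8 * Real.exp (-3 * ‖W‖) := by
    calc (1 + ‖W‖) * Real.exp (-(1 / 2) * ‖W‖ ^ 2)
        ≤ Real.exp ‖W‖ * Real.exp (-(1 / 2) * ‖W‖ ^ 2) := by gcongr
      _ ≤ _ := by
        rw [← Real.exp_add, ← Real.exp_add, Real.exp_le_exp]
        nlinarith [sq_nonneg (‖W‖ - 4)]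
  unfold gauss
  calc (1 + ‖W‖) * ((∫ V : E3, Real.exp (-(1 / 2) * ‖V‖ ^ 2))⁻¹ * Real.exp (-(1 / 2) * ‖W‖ ^ 2))
      = (∫ V : E3, Real.exp (-(1 / 2) * ‖V‖ ^ 2))⁻¹ *
        ((1 + ‖W‖) * Real.exp (-(1 / 2) * ‖W‖ ^ 2)) := by ring
    _ ≤ (∫ V : E3, Real.exp (-(1 / 2) * ‖V‖ ^ 2))⁻¹ * (Real.exp 8 * Real.exp (-3 * ‖W‖)) := by
        gcongr
    _ = _ := by ring

lemma gauss_le : ∃ C : ℝ, 0 ≤ C ∧ (∀ W, gauss W ≤ C * Real.exp (-3 * ‖W‖)) ∧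
    ∀ W, ‖W‖ * gauss W ≤ C * Real.exp (-3 * ‖W‖) := by
  obtain ⟨C, hC, h⟩ := exists_gauss_le
  refine ⟨C, hC, fun W => ?_, fun W => ?_⟩ <;>
  nlinarith [h W, gauss_nonneg W, mul_nonneg (norm_nonneg W) (gauss_nonneg W)]

/-- Polynomials with a parameter in a bounded range are dominated by an exponential. -/
lemma exists_abs_ev_line_le (p : MvPolynomial (Fin 3) ℝ) (c : E3) (T : ℝ) :
    ∃ C : ℝ, 0 ≤ C ∧ ∀ t : ℝ, |t| ≤ T → ∀ W : E3, |ev p (c + t • W)| ≤ C * Real.exp ‖W‖ := by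
  have hT1 : 0 < |T| + 1 := by positivity
  obtain ⟨C, hC, h⟩ := exists_abs_ev_le p (1 / (|T| + 1)) (by positivity)
  refine ⟨C * Real.exp (1 / (|T| + 1) * ‖c‖), by positivity, fun t ht W => (h _).trans ?_⟩
  rw [mul_assoc, ← Real.exp_add]
  gcongr
  have h1 : ‖c + t • W‖ ≤ ‖c‖ + (|T| + 1) * ‖W‖ := by
    refine (norm_add_le _ _).trans ?_
    rw [norm_smul, Real.norm_eq_abs]
    gcongr
    linarith [ht.trans (le_abs_self T)]
  calc 1 / (|T| + 1) * ‖c + t • W‖ ≤ 1 / (|T| + 1) * (‖c‖ + (|T| + 1) * ‖W‖) := by gcongr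
    _ = _ := by field_simp

lemma integrable_of_exp_bound {f : E3 → ℝ} (hf : Continuous f) {C : ℝ}
    (h : ∀ W, |f W| ≤ C * Real.exp ‖W‖) :
    Integrable (fun W => f W * gauss W) ∧
      ∀ i, Integrable fun W : E3 => f W * (W i * gauss W) := by
  obtain ⟨D, hD, h1, h2⟩ := gauss_le
  have hg : Continuous gauss := (contDiff_gauss (m := 0)).continuous
  have key : ∀ W : E3, C * Real.exp ‖W‖ * (D * Real.exp (-3 * ‖W‖)) ≤
      |C| * D * Real.exp (-‖W‖) := by
    intro W
    have : C * Real.exp ‖W‖ * (D * Real.exp (-3 * ‖W‖)) =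
        C * D * Real.exp (‖W‖ + -3 * ‖W‖) := by rw [Real.exp_add]; ring
    rw [this]
    have h4 : C * D ≤ |C| * D := by gcongr; exact le_abs_self C
    have h5 : Real.exp (‖W‖ + -3 * ‖W‖) ≤ Real.exp (-‖W‖) := by
      rw [Real.exp_le_exp]; linarith [norm_nonneg W]
    exact mul_le_mul h4 h5 (Real.exp_pos _).le (by positivity)
  refine ⟨(integrable_exp_neg_norm.const_mul (|C| * D)).mono' (by fun_prop)
    (.of_forall fun W => ?_), fun i => (integrable_exp_neg_norm.const_mul (|C| * D)).mono'
    (by fun_prop) (.of_forall fun W => ?_)⟩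
  · rw [Real.norm_eq_abs, abs_mul, abs_of_nonneg (gauss_nonneg W)]
    exact (mul_le_mul (h W) (h1 W) (gauss_nonneg W) ((abs_nonneg _).trans (h W))).trans (key W)
  · rw [Real.norm_eq_abs, abs_mul, abs_mul, abs_of_nonneg (gauss_nonneg W)]
    refine (mul_le_mul (h W) ?_ (mul_nonneg (abs_nonneg _) (gauss_nonneg W))
      ((abs_nonneg _).trans (h W))).trans (key W)
    exact (mul_le_mul_of_nonneg_right (PiLp.norm_apply_le W i) (gauss_nonneg W)).trans (h2 W)

lemma continuous_ev_line (p : MvPolynomial (Fin 3) ℝ) (c : E3) (t : ℝ) :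
    Continuous fun W : E3 => ev p (c + t • W) :=
  (continuous_ev p).comp (by fun_prop)

lemma integrable_ev_mul_gauss (p : MvPolynomial (Fin 3) ℝ) (c : E3) (t : ℝ) :
    Integrable (fun W => ev p (c + t • W) * gauss W) := by
  obtain ⟨C, -, h⟩ := exists_abs_ev_line_le p c |t|
  exact (integrable_of_exp_bound (continuous_ev_line p c t) (h t le_rfl)).1

lemma integrable_ev_mul_coord_gauss (p : MvPolynomial (Fin 3) ℝ) (c : E3) (t : ℝ) (i : Fin 3) :
    Integrable (fun W : E3 => ev p (c + t • W) * (W i * gauss W)) := by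
  obtain ⟨C, -, h⟩ := exists_abs_ev_line_le p c |t|
  exact (integrable_of_exp_bound (continuous_ev_line p c t) (h t le_rfl)).2 i

/-- Gaussian integration by parts for polynomials. -/
lemma integral_ev_mul_coord_gauss (p : MvPolynomial (Fin 3) ℝ) (c : E3) (t : ℝ) (i : Fin 3) :
    ∫ W : E3, ev p (c + t • W) * (W i * gauss W) =
      t * ∫ W, ev (MvPolynomial.pderiv i p) (c + t • W) * gauss W := by
  have hf : ∀ W : E3, HasFDerivAt (fun W : E3 => ev p (c + t • W))
      ((∑ j, ev (MvPolynomial.pderiv j p) (c + t • W) •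
        (EuclideanSpace.proj j : E3 →L[ℝ] ℝ)).comp (t • ContinuousLinearMap.id ℝ E3)) W := by
    intro W
    exact (hasFDerivAt_ev p (c + t • W)).comp W (((hasFDerivAt_id W).const_smul t).const_add c)
  have hf' : ∀ W : E3, fderiv ℝ (fun W : E3 => ev p (c + t • W)) W (EuclideanSpace.single i 1) =
      t * ev (MvPolynomial.pderiv i p) (c + t • W) := by
    intro W
    rw [(hf W).fderiv]
    simp [mul_comm]
  have hg' : ∀ W : E3, fderiv ℝ gauss W (EuclideanSpace.single i 1) = -(W i * gauss W) := by
    intro W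
    rw [(hasFDerivAt_gauss W).fderiv]
    simp [EuclideanSpace.inner_single_right, mul_comm]
  have h := integral_mul_fderiv_eq_neg_fderiv_mul_of_integrable (μ := (volume : Measure E3))
    (f := fun W : E3 => ev p (c + t • W)) (g := gauss) (v := EuclideanSpace.single i 1)
    (by
      simp_rw [hf', mul_assoc]
      exact (integrable_ev_mul_gauss _ c t).const_mul t)
    (by
      simp_rw [hg', mul_neg]
      exact (integrable_ev_mul_coord_gauss p c t i).neg)
    (integrable_ev_mul_gauss p c t) (fun W _ => (hf W).differentiableAt)
    (fun W _ => (hasFDerivAt_gauss W).differentiableAt)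
  simp_rw [hf', hg', mul_neg, integral_neg, mul_assoc, integral_const_mul] at h
  linarith

lemma polyLaplacian_apply (p : MvPolynomial (Fin 3) ℝ) :
    polyLaplacian p = ∑ i, MvPolynomial.pderiv i (MvPolynomial.pderiv i p) := by
  simp [polyLaplacian]

lemma ev_sum {ι : Type*} (s : Finset ι) (f : ι → MvPolynomial (Fin 3) ℝ) (X : E3) :
    ev (∑ i ∈ s, f i) X = ∑ i ∈ s, ev (f i) X := by
  simp [ev]

/-- The mean value property of harmonic polynomials, for Gaussian averages: by Gaussian integration
by parts, the derivative of the average with respect to the scale `t` is `t` times the average of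
the Laplacian. -/
lemma integral_ev_mul_gauss {p : MvPolynomial (Fin 3) ℝ} (hp : polyLaplacian p = 0) (c : E3)
    (s : ℝ) : ∫ W, ev p (c + s • W) * gauss W = ev p c := by
  have hderiv : ∀ t : ℝ, HasDerivAt (fun t => ∫ W, ev p (c + t • W) * gauss W) 0 t := by
    intro t
    choose C hC h using fun i => exists_abs_ev_line_le (MvPolynomial.pderiv i p) c (|t| + 1)
    obtain ⟨D, hD, h1, h2⟩ := gauss_le
    have hg : Continuous gauss := (contDiff_gauss (m := 0)).continuous
    have := hasDerivAt_integral_of_dominated_loc_of_deriv_le (μ := (volume : Measure E3))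
      (F := fun t W => ev p (c + t • W) * gauss W)
      (F' := fun t W => ∑ i, ev (MvPolynomial.pderiv i p) (c + t • W) * (W i * gauss W))
      (x₀ := t) (s := Metric.ball t 1) (bound := fun W => (∑ i, C i * D) * Real.exp (-‖W‖))
      (Metric.ball_mem_nhds t one_pos)
      (.of_forall fun t => ((continuous_ev_line p c t).mul hg).aestronglyMeasurable)
      (integrable_ev_mul_gauss p c t)
      (by
        refine Continuous.aestronglyMeasurable (continuous_finsetSum _ fun i _ => ?_)
        have := continuous_ev_line (MvPolynomial.pderiv i p) c t
        fun_prop)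
      (.of_forall fun W t' ht' => ?_) (integrable_exp_neg_norm.const_mul _)
      (.of_forall fun W t' _ => ?_)
    · refine this.2.congr_deriv ?_
      rw [integral_finsetSum _ fun i _ => integrable_ev_mul_coord_gauss _ c t i]
      simp_rw [integral_ev_mul_coord_gauss, ← Finset.mul_sum]
      rw [← integral_finsetSum _ fun i _ => integrable_ev_mul_gauss _ c t]
      simp_rw [← Finset.sum_mul, ← ev_sum, ← polyLaplacian_apply, hp]
      simp [ev]
    · have ht : |t'| ≤ |t| + 1 := by
        have := abs_lt.1 (by simpa [Real.dist_eq] using ht' : |t' - t| < 1)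
        rw [abs_le]
        constructor <;> linarith [this.1, this.2, neg_abs_le t, le_abs_self t]
      rw [Finset.sum_mul]
      refine (norm_sum_le _ _).trans (Finset.sum_le_sum fun i _ => ?_)
      rw [Real.norm_eq_abs, abs_mul, abs_mul, abs_of_nonneg (gauss_nonneg W)]
      have e1 : |W i| * gauss W ≤ D * Real.exp (-3 * ‖W‖) :=
        (mul_le_mul_of_nonneg_right (PiLp.norm_apply_le W i) (gauss_nonneg W)).trans (h2 W)
      calc |ev (MvPolynomial.pderiv i p) (c + t' • W)| * (|W i| * gauss W)
          ≤ (C i * Real.exp ‖W‖) * (D * Real.exp (-3 * ‖W‖)) :=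
            mul_le_mul (h i t' ht W) e1 (mul_nonneg (abs_nonneg _) (gauss_nonneg W))
              (mul_nonneg (hC i) (Real.exp_pos _).le)
        _ = C i * D * Real.exp (‖W‖ + -3 * ‖W‖) := by rw [Real.exp_add]; ring
        _ ≤ _ := by
          have := hC i
          gcongr
          linarith [norm_nonneg W]
    · have := (hasDerivAt_ev_comp p (((hasDerivAt_id t').smul_const W).const_add c)).mul_const
        (gauss W)
      refine this.congr_deriv ?_
      simp [Finset.sum_mul, mul_assoc]
  have hconst := is_const_of_deriv_eq_zero (fun t => (hderiv t).differentiableAt)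
    (fun t => (hderiv t).deriv) s 0
  rw [hconst]
  simp [integral_const_mul, integral_gauss]

/-! ### Rotation invariance of the spherical harmonics -/

/-- Substitution of the components of a linear isometry into a polynomial. -/
noncomputable def rotate (g : E3 ≃ₗᵢ[ℝ] E3) (p : MvPolynomial (Fin 3) ℝ) :
    MvPolynomial (Fin 3) ℝ :=
  MvPolynomial.bind₁ (fun i => ∑ j, MvPolynomial.C (g (EuclideanSpace.single j 1) i) *
    MvPolynomial.X j) p

lemma apply_eq_sum (g : E3 ≃ₗᵢ[ℝ] E3) (X : E3) (i : Fin 3) :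
    g X i = ∑ j, g (EuclideanSpace.single j 1) i * X j := by
  have h : X = ∑ j, X j • EuclideanSpace.single j (1 : ℝ) := by
    ext i; simp [Pi.single_apply]
  conv_lhs => rw [h]
  simp [mul_comm]

lemma ev_rotate (g : E3 ≃ₗᵢ[ℝ] E3) (p : MvPolynomial (Fin 3) ℝ) (X : E3) :
    ev (rotate g p) X = ev p (g X) := by
  unfold ev rotate
  rw [← MvPolynomial.coe_aeval_eq_eval, ← MvPolynomial.coe_aeval_eq_eval]
  simp only [RingHom.coe_coe]
  rw [MvPolynomial.aeval_bind₁]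
  congr 2
  funext i
  rw [apply_eq_sum]
  simp

lemma isHomogeneous_rotate (g : E3 ≃ₗᵢ[ℝ] E3) {p : MvPolynomial (Fin 3) ℝ} {n : ℕ}
    (hp : p.IsHomogeneous n) : (rotate g p).IsHomogeneous n := by
  have h := hp.aeval (R := ℝ) (fun i => ∑ j, MvPolynomial.C (g (EuclideanSpace.single j 1) i) *
    MvPolynomial.X j : Fin 3 → MvPolynomial (Fin 3) ℝ) (n := 1) fun i => ?_
  · rw [one_mul] at h
    exact h
  · refine MvPolynomial.IsHomogeneous.sum _ _ _ fun j _ => ?_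
    simpa using (MvPolynomial.isHomogeneous_C (Fin 3) _).mul (MvPolynomial.isHomogeneous_X ℝ j)

lemma pderiv_rotate (g : E3 ≃ₗᵢ[ℝ] E3) (p : MvPolynomial (Fin 3) ℝ) (j : Fin 3) :
    MvPolynomial.pderiv j (rotate g p) = ∑ i, MvPolynomial.C (g (EuclideanSpace.single j 1) i) *
      rotate g (MvPolynomial.pderiv i p) := by
  have hX : ∀ i, MvPolynomial.pderiv j (rotate g (MvPolynomial.X i)) =
      MvPolynomial.C (g (EuclideanSpace.single j 1) i) := by
    intro i
    simp only [rotate, MvPolynomial.bind₁_X_right, map_sum, MvPolynomial.pderiv_C_mul,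
      MvPolynomial.pderiv_X]
    rw [Finset.sum_eq_single j]
    · simp
    · intro b _ hb
      rw [Pi.single_eq_of_ne hb]
      simp
    · simp
  induction p using MvPolynomial.induction_on with
  | C a => simp [rotate]
  | add p q hp hq =>
    have h : rotate g (p + q) = rotate g p + rotate g q := map_add _ _ _
    rw [h, map_add, hp, hq, ← Finset.sum_add_distrib]
    refine Finset.sum_congr rfl fun i _ => ?_
    simp [rotate, mul_add]
  | mul_X p k hp =>
    have h : rotate g (p * MvPolynomial.X k) = rotate g p * rotate g (MvPolynomial.X k) :=
      map_mul _ _ _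
    rw [h, Derivation.leibniz, hX, hp]
    have h2 : ∀ i, rotate g (MvPolynomial.pderiv i (p * MvPolynomial.X k)) =
        rotate g p * MvPolynomial.C ((Pi.single k 1 : Fin 3 → ℝ) i) +
          rotate g (MvPolynomial.X k) * rotate g (MvPolynomial.pderiv i p) := by
      intro i
      rw [Derivation.leibniz, MvPolynomial.pderiv_X]
      by_cases hik : i = k
      · subst hik; simp [rotate]
      · rw [Pi.single_eq_of_ne (Ne.symm hik), Pi.single_eq_of_ne hik]; simp [rotate]
    have h3 : ∑ i, MvPolynomial.C (g (EuclideanSpace.single j 1) i) *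
          rotate g (MvPolynomial.pderiv i (p * MvPolynomial.X k)) =
        ∑ i, (rotate g p * (MvPolynomial.C (g (EuclideanSpace.single j 1) i) *
            MvPolynomial.C ((Pi.single k 1 : Fin 3 → ℝ) i)) +
          rotate g (MvPolynomial.X k) * (MvPolynomial.C (g (EuclideanSpace.single j 1) i) *
            rotate g (MvPolynomial.pderiv i p))) :=
      Finset.sum_congr rfl fun i _ => by rw [h2]; ring
    rw [h3, Finset.sum_add_distrib, ← Finset.mul_sum, ← Finset.mul_sum, smul_eq_mul, smul_eq_mul]
    congr 2
    rw [Finset.sum_eq_single k]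
    · simp
    · intro b _ hb
      rw [Pi.single_eq_of_ne hb]; simp
    · simp

lemma sum_apply_mul_apply (g : E3 ≃ₗᵢ[ℝ] E3) (i k : Fin 3) :
    ∑ j, g (EuclideanSpace.single j 1) i * g (EuclideanSpace.single j 1) k =
      if i = k then 1 else 0 := by
  have h := ((EuclideanSpace.basisFun (Fin 3) ℝ).map g).sum_inner_mul_inner
    (EuclideanSpace.single i 1) (EuclideanSpace.single k (1 : ℝ))
  simpa [EuclideanSpace.inner_single_left, EuclideanSpace.inner_single_right,
    PiLp.single_apply, eq_comm] using h

lemma polyLaplacian_rotate (g : E3 ≃ₗᵢ[ℝ] E3) (p : MvPolynomial (Fin 3) ℝ) :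
    polyLaplacian (rotate g p) = rotate g (polyLaplacian p) := by
  have h0 : ∀ s : Fin 3 → MvPolynomial (Fin 3) ℝ, rotate g (∑ i, s i) = ∑ i, rotate g (s i) :=
    fun s => map_sum _ _ _
  rw [polyLaplacian_apply, polyLaplacian_apply, h0]
  have h1 : ∀ j, MvPolynomial.pderiv j (MvPolynomial.pderiv j (rotate g p)) =
      ∑ i, ∑ k, MvPolynomial.C (g (EuclideanSpace.single j 1) i * g (EuclideanSpace.single j 1) k) *
        rotate g (MvPolynomial.pderiv k (MvPolynomial.pderiv i p)) := by
    intro j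
    rw [pderiv_rotate, map_sum]
    refine Finset.sum_congr rfl fun i _ => ?_
    rw [MvPolynomial.pderiv_C_mul, pderiv_rotate, Finset.mul_sum]
    exact Finset.sum_congr rfl fun k _ => by rw [MvPolynomial.C_mul]; ring
  simp_rw [h1]
  rw [Finset.sum_comm]
  refine Finset.sum_congr rfl fun i _ => ?_
  rw [Finset.sum_comm]
  simp_rw [← Finset.sum_mul, ← map_sum, sum_apply_mul_apply]
  simp

/-- The action of a linear isometry on the sphere. -/
def sphereMap {E : Type*} [NormedAddCommGroup E] [NormedSpace ℝ E] (g : E ≃ₗᵢ[ℝ] E)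
    (x : Metric.sphere (0 : E) 1) : Metric.sphere (0 : E) 1 :=
  ⟨g x, by simp⟩

lemma mem_sphericalHarmonics_iff {n : ℕ} {h : S2 → ℝ} :
    h ∈ sphericalHarmonics n ↔ ∃ p : MvPolynomial (Fin 3) ℝ, p.IsHomogeneous n ∧
      polyLaplacian p = 0 ∧ ∀ x : S2, h x = ev p x := by
  constructor
  · rintro ⟨p, ⟨h1, h2⟩, rfl⟩
    exact ⟨p, h1, h2, fun x => rfl⟩
  · rintro ⟨p, h1, h2, h3⟩
    exact ⟨p, ⟨h1, h2⟩, (funext h3).symm⟩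

lemma comp_sphereMap_mem {n : ℕ} {h : S2 → ℝ} (hh : h ∈ sphericalHarmonics n)
    (g : E3 ≃ₗᵢ[ℝ] E3) : (fun x => h (sphereMap g x)) ∈ sphericalHarmonics n := by
  obtain ⟨p, h1, h2, h3⟩ := mem_sphericalHarmonics_iff.1 hh
  refine mem_sphericalHarmonics_iff.2 ⟨rotate g p, isHomogeneous_rotate g h1, ?_, fun x => ?_⟩
  · rw [polyLaplacian_rotate, h2]
    exact map_zero _
  · rw [ev_rotate]; exact h3 _

lemma continuous_of_mem {n : ℕ} {h : S2 → ℝ} (hh : h ∈ sphericalHarmonics n) : Continuous h := by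
  obtain ⟨p, -, -, h3⟩ := mem_sphericalHarmonics_iff.1 hh
  rw [funext h3]
  exact (continuous_ev p).comp continuous_subtype_val

/-! ### Invariance of the uniform measures -/

lemma continuous_sphereMap {E : Type*} [NormedAddCommGroup E] [NormedSpace ℝ E]
    (g : E ≃ₗᵢ[ℝ] E) : Continuous (sphereMap g) :=
  (g.continuous.comp continuous_subtype_val).subtype_mk _

lemma sphereMap_symm_apply {E : Type*} [NormedAddCommGroup E] [NormedSpace ℝ E]
    (g : E ≃ₗᵢ[ℝ] E) (x : Metric.sphere (0 : E) 1) : sphereMap g.symm (sphereMap g x) = x :=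
  Subtype.ext (by simp [sphereMap])

lemma sphereMap_apply_symm {E : Type*} [NormedAddCommGroup E] [NormedSpace ℝ E]
    (g : E ≃ₗᵢ[ℝ] E) (x : Metric.sphere (0 : E) 1) : sphereMap g (sphereMap g.symm x) = x :=
  Subtype.ext (by simp [sphereMap])

open scoped Pointwise in
lemma measurePreserving_sphereMap {E : Type*} [NormedAddCommGroup E] [InnerProductSpace ℝ E]
    [FiniteDimensional ℝ E] [MeasurableSpace E] [BorelSpace E] (g : E ≃ₗᵢ[ℝ] E) :
    MeasurePreserving (sphereMap g) (uniformSphere E) (uniformSphere E) := by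
  have hm : Measurable (sphereMap g) := (continuous_sphereMap g).measurable
  refine ⟨hm, ?_⟩
  rw [uniformSphere, Measure.map_smul]
  congr 1
  ext s hs
  rw [Measure.map_apply hm hs, Measure.toSphere_apply' _ (hm hs), Measure.toSphere_apply' _ hs]
  congr 1
  have h : (Set.Ioo (0 : ℝ) 1 • ((↑) '' (sphereMap g ⁻¹' s) : Set E)) =
      g ⁻¹' (Set.Ioo (0 : ℝ) 1 • ((↑) '' s : Set E)) := by
    ext X
    simp only [Set.mem_smul, Set.mem_image, Set.mem_preimage]
    constructor
    · rintro ⟨t, ht, _, ⟨x, hx, rfl⟩, rfl⟩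
      exact ⟨t, ht, _, ⟨sphereMap g x, hx, rfl⟩, by simp [sphereMap]⟩
    · rintro ⟨t, ht, _, ⟨x, hx, rfl⟩, h⟩
      refine ⟨t, ht, _, ⟨sphereMap g.symm x, by rwa [sphereMap_apply_symm], rfl⟩, ?_⟩
      apply g.injective
      rw [← h]
      simp [sphereMap]
  rw [h]
  exact g.measurePreserving.measure_preimage_equiv (f := g.toMeasurableEquiv) _

lemma integral_comp_sphereMap {E F : Type*} [NormedAddCommGroup E] [InnerProductSpace ℝ E]
    [FiniteDimensional ℝ E] [MeasurableSpace E] [BorelSpace E] [NormedAddCommGroup F]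
    [NormedSpace ℝ F] (g : E ≃ₗᵢ[ℝ] E) (f : Metric.sphere (0 : E) 1 → F) :
    ∫ x, f (sphereMap g x) ∂(uniformSphere E) = ∫ x, f x ∂(uniformSphere E) := by
  have hemb : MeasurableEmbedding (sphereMap g) := by
    let e : Metric.sphere (0 : E) 1 ≃ᵐ Metric.sphere (0 : E) 1 :=
      { toFun := sphereMap g
        invFun := sphereMap g.symm
        left_inv := sphereMap_symm_apply g
        right_inv := sphereMap_apply_symm g
        measurable_toFun := (continuous_sphereMap g).measurable
        measurable_invFun := (continuous_sphereMap g.symm).measurable }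
    exact e.measurableEmbedding
  exact (measurePreserving_sphereMap g).integral_comp hemb f

/-- The reflection in the bisecting hyperplane exchanges two points of the sphere, and fixes the points
equidistant from them. -/
lemma exists_sphereMap_eq {E : Type*} [NormedAddCommGroup E] [InnerProductSpace ℝ E]
    [FiniteDimensional ℝ E] (x y : Metric.sphere (0 : E) 1) :
    ∃ g : E ≃ₗᵢ[ℝ] E, sphereMap g x = y ∧ ∀ z : Metric.sphere (0 : E) 1,
      inner ℝ (z : E) x = inner ℝ (z : E) y → sphereMap g z = z := by
  refine ⟨(ℝ ∙ ((x : E) - y))ᗮ.reflection, ?_, fun z hz => ?_⟩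
  · exact Subtype.ext (Submodule.reflection_sub (by simp))
  · refine Subtype.ext (Submodule.reflection_mem_subspace_eq_self ?_)
    rw [Submodule.mem_orthogonal_singleton_iff_inner_right, inner_sub_left,
      real_inner_comm, hz, real_inner_comm, sub_self]

/-- The points of the sphere at distance less than `r` from `x` or from `-x`. -/
def doubleCap (x : S2) (r : ℝ) : Set S2 := {y | ‖(y : E3) - x‖ < r ∨ ‖(y : E3) + x‖ < r}

lemma measurableSet_doubleCap (x : S2) (r : ℝ) : MeasurableSet (doubleCap x r) :=
  ((isOpen_lt (f := fun y : S2 => ‖(y : E3) - x‖) (by fun_prop) continuous_const).union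
    (isOpen_lt (f := fun y : S2 => ‖(y : E3) + x‖) (by fun_prop) continuous_const)).measurableSet

lemma sphereMap_preimage_doubleCap (g : E3 ≃ₗᵢ[ℝ] E3) (x : S2) (r : ℝ) :
    sphereMap g ⁻¹' doubleCap (sphereMap g x) r = doubleCap x r := by
  ext y
  have e1 : ((sphereMap g y : S2) : E3) - (sphereMap g x : S2) = g ((y : E3) - x) := by
    simp [sphereMap]
  have e2 : ((sphereMap g y : S2) : E3) + (sphereMap g x : S2) = g ((y : E3) + x) := by
    simp [sphereMap]
  simp only [doubleCap, Set.mem_preimage, Set.mem_ofPred_eq, e1, e2, g.norm_map]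

/-- The north pole. -/
noncomputable def northPole : S2 := ⟨EuclideanSpace.single 2 1, by simp⟩

lemma abs_apply_le_of_mem_doubleCap {r : ℝ} {y : S2} (hy : y ∈ doubleCap northPole r) {i : Fin 3}
    (hi : i ≠ 2) : |(y : E3) i| ≤ r := by
  have h0 : ((northPole : S2) : E3) i = 0 := by simp [northPole, hi]
  rcases hy with hy | hy
  · have h := PiLp.norm_apply_le ((y : E3) - ((northPole : S2) : E3)) i
    rw [PiLp.sub_apply, h0, sub_zero] at h
    exact h.trans hy.le
  · have h := PiLp.norm_apply_le ((y : E3) + ((northPole : S2) : E3)) i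
    rw [PiLp.add_apply, h0, add_zero] at h
    exact h.trans hy.le

open scoped Pointwise in
lemma volume_cone_doubleCap_le {r : ℝ} (hr : 0 ≤ r) :
    volume (Set.Ioo (0 : ℝ) 1 • ((↑) '' doubleCap northPole r : Set E3)) ≤
      ENNReal.ofReal (8 * r ^ 2) := by
  have hsub : (Set.Ioo (0 : ℝ) 1 • ((↑) '' doubleCap northPole r : Set E3)) ⊆
      WithLp.ofLp ⁻¹' (Set.Icc ![-r, -r, -1] ![r, r, 1]) := by
    rintro X ⟨t, ht, _, ⟨y, hy, rfl⟩, rfl⟩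
    have h2 : |(y : E3) 2| ≤ 1 := by
      have := PiLp.norm_apply_le (y : E3) 2
      rwa [norm_eq_of_mem_sphere, Real.norm_eq_abs] at this
    have ht' : ∀ c B : ℝ, |c| ≤ B → -B ≤ t * c ∧ t * c ≤ B := by
      intro c B h
      rw [← abs_le, abs_mul, abs_of_pos ht.1]
      nlinarith [abs_nonneg c, ht.2]
    have h0 := ht' _ _ (abs_apply_le_of_mem_doubleCap hy (i := 0) (by decide))
    have h1 := ht' _ _ (abs_apply_le_of_mem_doubleCap hy (i := 1) (by decide))
    have h2 := ht' _ _ h2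
    refine ⟨fun i => ?_, fun i => ?_⟩
    · fin_cases i
      exacts [h0.1, h1.1, h2.1]
    · fin_cases i
      exacts [h0.2, h1.2, h2.2]
  refine (measure_mono hsub).trans ?_
  rw [(PiLp.volume_preserving_ofLp (Fin 3)).measure_preimage measurableSet_Icc.nullMeasurableSet,
    Real.volume_Icc_pi, Fin.prod_univ_three, ← ENNReal.ofReal_mul (by simp; linarith),
    ← ENNReal.ofReal_mul (by simp; positivity)]
  apply ENNReal.ofReal_le_ofReal
  simp
  nlinarith

/-- Spherical caps, together with the antipodal caps, of radius `r` have measure `O(r²)`: the cone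
over such a set lies in a box of volume `8 r²`. -/
lemma exists_sphereMeasure_doubleCap_le : ∃ C : ℝ, 0 ≤ C ∧ ∀ (x : S2) (r : ℝ), 0 ≤ r →
    sphereMeasure.real (doubleCap x r) ≤ C * r ^ 2 := by
  set A : ENNReal := ((volume : Measure E3).toSphere Set.univ)⁻¹ with hA
  have hAtop : A ≠ ⊤ := by
    rw [hA, Ne, ENNReal.inv_eq_top, Measure.measure_univ_eq_zero]
    exact Measure.toSphere_ne_zero _
  refine ⟨(A * 3).toReal * 8, by positivity, fun x r hr => ?_⟩
  obtain ⟨g, hg, -⟩ := exists_sphereMap_eq northPole x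
  have h1 : sphereMeasure (doubleCap x r) = sphereMeasure (doubleCap northPole r) := by
    rw [← hg, ← sphereMap_preimage_doubleCap g northPole r]
    exact ((measurePreserving_sphereMap g).measure_preimage
      (measurableSet_doubleCap _ r).nullMeasurableSet).symm
  have h3 : sphereMeasure (doubleCap northPole r) ≤ A * 3 * ENNReal.ofReal (8 * r ^ 2) := by
    rw [sphereMeasure, uniformSphere, Measure.smul_apply,
      Measure.toSphere_apply' _ (measurableSet_doubleCap _ r),
      smul_eq_mul, finrank_euclideanSpace, Fintype.card_fin, mul_assoc]
    gcongr
    · norm_num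
    · exact volume_cone_doubleCap_le hr
  rw [Measure.real, h1]
  calc _ ≤ (A * 3 * ENNReal.ofReal (8 * r ^ 2)).toReal :=
        ENNReal.toReal_mono (by finiteness) h3
    _ = _ := by rw [ENNReal.toReal_mul, ENNReal.toReal_ofReal (by positivity)]; ring

/-! ### The characteristic function of the circle -/

/-- Rotation of the plane. -/
noncomputable def planeRotation (φ : ℝ) : E2 ≃ₗᵢ[ℝ] E2 :=
  LinearIsometry.toLinearIsometryEquiv
    { toFun := fun s => !₂[s 0 * Real.cos φ - s 1 * Real.sin φ, s 0 * Real.sin φ + s 1 * Real.cos φ]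
      map_add' := fun s t => by
        ext i; fin_cases i <;> simp <;> ring
      map_smul' := fun c s => by
        ext i; fin_cases i <;> simp <;> ring
      norm_map' := fun s => by
        rw [← sq_eq_sq₀ (norm_nonneg _) (norm_nonneg _), EuclideanSpace.norm_sq_eq,
          EuclideanSpace.norm_sq_eq]
        simp
        linear_combination (s 0 ^ 2 + s 1 ^ 2) * Real.sin_sq_add_cos_sq φ } rfl

lemma planeRotation_apply (φ : ℝ) (s : E2) : planeRotation φ s =
    !₂[s 0 * Real.cos φ - s 1 * Real.sin φ, s 0 * Real.sin φ + s 1 * Real.cos φ] := rfl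

lemma charFun_circleMeasure_rotate (φ : ℝ) (w : E2) : charFun circleMeasure w =
    ∫ s, Complex.exp ((inner ℝ (planeRotation φ (s : E2)) w : ℝ) * Complex.I)
      ∂(uniformSphere E2) := by
  rw [charFun_apply, circleMeasure, integral_map (by fun_prop) (by fun_prop)]
  exact (integral_comp_sphereMap (planeRotation φ)
    fun s => Complex.exp ((inner ℝ (s : E2) w : ℝ) * Complex.I)).symm

/-- The characteristic function of the uniform measure on the circle is the Bessel function `J₀` of
the norm, in Bessel's integral form. -/
lemma charFun_circleMeasure (w : E2) : charFun circleMeasure w =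
    (2 * Real.pi : ℂ)⁻¹ * ∫ φ in (0 : ℝ)..2 * Real.pi,
      Complex.exp ((‖w‖ * Real.cos φ : ℝ) * Complex.I) := by
  have := isProbabilityMeasure_uniformSphere E2
  have hpi : (0 : ℝ) ≤ 2 * Real.pi := by positivity
  have hsph : ∀ s : S1, (s : E2) 0 ^ 2 + (s : E2) 1 ^ 2 = 1 := by
    intro s
    have h : ‖(s : E2)‖ ^ 2 = 1 := by simp
    rw [EuclideanSpace.norm_sq_eq] at h
    simpa using h
  have hcos : ∀ s : S1, ∃ c : ℝ, ∀ φ, inner ℝ (planeRotation φ (s : E2)) w =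
      ‖w‖ * Real.cos (φ + c) := by
    intro s
    let z : ℂ := ⟨(s : E2) 0 * w 0 + (s : E2) 1 * w 1, (s : E2) 1 * w 0 - (s : E2) 0 * w 1⟩
    have hz : ‖z‖ = ‖w‖ := by
      rw [← sq_eq_sq₀ (norm_nonneg _) (norm_nonneg _), Complex.sq_norm, Complex.normSq_apply,
        EuclideanSpace.norm_sq_eq]
      simp [z]
      linear_combination (w 0 ^ 2 + w 1 ^ 2) * hsph s
    refine ⟨Complex.arg z, fun φ => ?_⟩
    have h1 : ‖w‖ * Real.cos (Complex.arg z) = z.re := by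
      rw [← hz]; exact Complex.norm_mul_cos_arg z
    have h2 : ‖w‖ * Real.sin (Complex.arg z) = z.im := by
      rw [← hz]; exact Complex.norm_mul_sin_arg z
    rw [Real.cos_add, planeRotation_apply]
    simp only [PiLp.inner_apply, Fin.sum_univ_two]
    simp [z] at h1 h2 ⊢
    linear_combination -Real.cos φ * h1 + Real.sin φ * h2
  have hinner : ∀ s : S1, ∫ φ in (0 : ℝ)..2 * Real.pi,
      Complex.exp ((inner ℝ (planeRotation φ (s : E2)) w : ℝ) * Complex.I) =
      ∫ φ in (0 : ℝ)..2 * Real.pi, Complex.exp ((‖w‖ * Real.cos φ : ℝ) * Complex.I) := by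
    intro s
    obtain ⟨c, hc⟩ := hcos s
    simp_rw [hc]
    rw [intervalIntegral.integral_comp_add_right
      (fun φ => Complex.exp ((‖w‖ * Real.cos φ : ℝ) * Complex.I)) c]
    have hper : Function.Periodic
        (fun φ : ℝ => Complex.exp ((‖w‖ * Real.cos φ : ℝ) * Complex.I)) (2 * Real.pi) := by
      intro φ; simp
    have := hper.intervalIntegral_add_eq c 0
    rw [zero_add] at this
    rw [zero_add, add_comm]
    exact this
  have hI : Integrable (Function.uncurry fun (φ : ℝ) (s : S1) =>
      Complex.exp ((inner ℝ (planeRotation φ (s : E2)) w : ℝ) * Complex.I))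
      ((volume.restrict (Set.Ioc 0 (2 * Real.pi))).prod (uniformSphere E2)) := by
    refine Integrable.of_bound (C := 1) (Continuous.aestronglyMeasurable ?_)
      (.of_forall fun p => ?_)
    · simp only [Function.uncurry_def, planeRotation_apply, PiLp.inner_apply, Fin.sum_univ_two]
      simp
      fun_prop
    · simp only [Function.uncurry_def]
      rw [Complex.norm_exp_ofReal_mul_I]
  have h1 : ∫ _φ in (0 : ℝ)..2 * Real.pi, charFun circleMeasure w =
      ∫ φ in (0 : ℝ)..2 * Real.pi, Complex.exp ((‖w‖ * Real.cos φ : ℝ) * Complex.I) := by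
    calc ∫ _φ in (0 : ℝ)..2 * Real.pi, charFun circleMeasure w
        = ∫ φ in (0 : ℝ)..2 * Real.pi, (∫ s, Complex.exp
            ((inner ℝ (planeRotation φ (s : E2)) w : ℝ) * Complex.I) ∂(uniformSphere E2)) := by
          simp_rw [← charFun_circleMeasure_rotate]
      _ = ∫ s, (∫ φ in (0 : ℝ)..2 * Real.pi, Complex.exp
            ((inner ℝ (planeRotation φ (s : E2)) w : ℝ) * Complex.I)) ∂(uniformSphere E2) := by
          simp_rw [intervalIntegral.integral_of_le hpi]
          exact integral_integral_swap hI
      _ = _ := by simp_rw [hinner]; simp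
  rw [← h1, intervalIntegral.integral_const]
  have : (2 * Real.pi : ℂ) ≠ 0 := by simp [Real.pi_ne_zero]
  simp
  field_simp

/-! ### The reproducing kernel of the spherical harmonics -/

/-- The reproducing kernel `∑ Y_k(x) Y_k(y)` of an orthonormal family. -/
noncomputable def harmonicKernel (n : ℕ) (Y : ℤ → S2 → ℝ) (x y : S2) : ℝ :=
  ∑ k ∈ Finset.Icc (-(n : ℤ)) n, Y k x * Y k y

lemma integrable_of_continuous {f : S2 → ℝ} (hf : Continuous f) : Integrable f sphereMeasure :=
  hf.integrable_of_hasCompactSupport (HasCompactSupport.of_compactSpace f)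

namespace IsHarmonicBasis

variable {n : ℕ} {Y : ℤ → S2 → ℝ}

lemma continuous (hY : IsHarmonicBasis n Y) {k : ℤ} (hk : k ∈ Finset.Icc (-(n : ℤ)) n) :
    Continuous (Y k) := continuous_of_mem (hY.mem k hk)

lemma eq_sum (hY : IsHarmonicBasis n Y) {h : S2 → ℝ} (hh : h ∈ sphericalHarmonics n) (x : S2) :
    h x = ∑ k ∈ Finset.Icc (-(n : ℤ)) n, (∫ y, h y * Y k y ∂sphereMeasure) * Y k x := by
  obtain ⟨c, hc⟩ := (Submodule.mem_span_image_finset_iff_exists_fun' ℝ).1 (hY.span hh)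
  have hx : ∀ x, h x = ∑ k ∈ Finset.Icc (-(n : ℤ)) n, c k * Y k x := by
    intro x
    rw [← hc]
    simp [Finset.sum_apply]
  have hck : ∀ k ∈ Finset.Icc (-(n : ℤ)) n, ∫ y, h y * Y k y ∂sphereMeasure = c k := by
    intro k hk
    simp_rw [hx, Finset.sum_mul, mul_assoc]
    rw [integral_finsetSum]
    swap
    · exact fun l hl => integrable_of_continuous
        (continuous_const.mul ((hY.continuous hl).mul (hY.continuous hk)))
    simp_rw [integral_const_mul]
    rw [Finset.sum_congr rfl fun l hl => by rw [hY.orthonormal l hl k hk]]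
    simp [Finset.mem_Icc.1 hk]
  rw [hx x]
  exact Finset.sum_congr rfl fun k hk => by rw [hck k hk]

lemma integral_kernel_mul (hY : IsHarmonicBasis n Y) {h : S2 → ℝ}
    (hh : h ∈ sphericalHarmonics n) (x : S2) :
    ∫ y, harmonicKernel n Y x y * h y ∂sphereMeasure = h x := by
  rw [hY.eq_sum hh x]
  simp_rw [harmonicKernel, Finset.sum_mul]
  rw [integral_finsetSum]
  swap
  · exact fun l hl => integrable_of_continuous
      ((continuous_const.mul (hY.continuous hl)).mul (continuous_of_mem hh))
  refine Finset.sum_congr rfl fun k _ => ?_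
  rw [← integral_mul_const]
  exact integral_congr_ae (.of_forall fun y => by ring)

lemma kernel_mem (hY : IsHarmonicBasis n Y) (x : S2) :
    harmonicKernel n Y x ∈ sphericalHarmonics n := by
  have : harmonicKernel n Y x = ∑ k ∈ Finset.Icc (-(n : ℤ)) n, Y k x • Y k := by
    funext y; simp [harmonicKernel, Finset.sum_apply]
  rw [this]
  exact Submodule.sum_mem _ fun k hk => Submodule.smul_mem _ _ (hY.mem k hk)

/-- The reproducing kernel is invariant under rotations. -/
lemma kernel_sphereMap (hY : IsHarmonicBasis n Y) (g : E3 ≃ₗᵢ[ℝ] E3) (x y : S2) :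
    harmonicKernel n Y (sphereMap g x) (sphereMap g y) = harmonicKernel n Y x y := by
  set D : S2 → ℝ := (fun y => harmonicKernel n Y (sphereMap g x) (sphereMap g y)) -
    harmonicKernel n Y x with hD
  have hDmem : D ∈ sphericalHarmonics n :=
    Submodule.sub_mem _ (comp_sphereMap_mem (hY.kernel_mem _) g) (hY.kernel_mem x)
  have hzero : ∀ k ∈ Finset.Icc (-(n : ℤ)) n, ∫ y, D y * Y k y ∂sphereMeasure = 0 := by
    intro k hk
    have h1 : ∫ y, harmonicKernel n Y (sphereMap g x) (sphereMap g y) * Y k y ∂sphereMeasure =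
        Y k x := by
      have e := hY.integral_kernel_mul (comp_sphereMap_mem (hY.mem k hk) g.symm) (sphereMap g x)
      rw [sphereMap_symm_apply, sphereMeasure, ← integral_comp_sphereMap g] at e
      simp only [sphereMap_symm_apply] at e
      exact e
    have h2 := hY.integral_kernel_mul (hY.mem k hk) x
    simp only [hD, Pi.sub_apply, sub_mul]
    rw [integral_sub, h1, h2, sub_self]
    · exact integrable_of_continuous ((continuous_of_mem
        (comp_sphereMap_mem (hY.kernel_mem _) g)).mul (hY.continuous hk))
    · exact integrable_of_continuous ((continuous_of_mem (hY.kernel_mem x)).mul (hY.continuous hk))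
  have h := hY.eq_sum hDmem y
  rw [Finset.sum_eq_zero fun k hk => by rw [hzero k hk, zero_mul]] at h
  exact sub_eq_zero.1 h

/-- By rotation invariance the kernel is constant on the diagonal, so it equals its mean there, the
number of basis functions. -/
lemma kernel_self (hY : IsHarmonicBasis n Y) (x : S2) : harmonicKernel n Y x x = 2 * n + 1 := by
  have hconst : ∀ y, harmonicKernel n Y y y = harmonicKernel n Y x x := by
    intro y
    obtain ⟨g, hg, -⟩ := exists_sphereMap_eq x y
    rw [← hg, hY.kernel_sphereMap]
  have h1 : ∫ y, harmonicKernel n Y y y ∂sphereMeasure = 2 * n + 1 := by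
    simp_rw [harmonicKernel]
    rw [integral_finsetSum]
    swap
    · exact fun l hl => integrable_of_continuous ((hY.continuous hl).mul (hY.continuous hl))
    rw [Finset.sum_congr rfl fun l hl => by rw [hY.orthonormal l hl l hl]]
    simp
    norm_cast
    omega
  rw [← h1]
  simp_rw [hconst]
  simp

/-- The kernel depends on its arguments only through their inner product. -/
lemma kernel_congr (hY : IsHarmonicBasis n Y) {x y y' : S2}
    (h : inner ℝ (x : E3) (y : E3) = inner ℝ (x : E3) (y' : E3)) :
    harmonicKernel n Y x y = harmonicKernel n Y x y' := by
  obtain ⟨g, hg, hfix⟩ := exists_sphereMap_eq y y'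
  rw [← hY.kernel_sphereMap g x y, hg, hfix x h]

lemma kernel_neg (hY : IsHarmonicBasis n Y) (x : S2) {y y' : S2} (h : (y' : E3) = -(y : E3)) :
    |harmonicKernel n Y x y'| = |harmonicKernel n Y x y| := by
  obtain ⟨p, h1, -, h3⟩ := mem_sphericalHarmonics_iff.1 (hY.kernel_mem x)
  rw [h3, h3, h, ← neg_one_smul ℝ, ev_smul h1, abs_mul, abs_pow]
  simp

end IsHarmonicBasis

/-! ### The Legendre differential equation -/

/-- `u` is a solution, with derivatives `u₁` and `u₂`, of the Legendre equation in the angular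
variable, `sin θ u'' + cos θ u' + N sin θ u = 0`. -/
structure IsLegendreSolution (N : ℝ) (u u₁ u₂ : ℝ → ℝ) : Prop where
  deriv : ∀ θ, HasDerivAt u (u₁ θ) θ
  deriv₂ : ∀ θ, HasDerivAt u₁ (u₂ θ) θ
  eq : ∀ θ, Real.sin θ * u₂ θ + Real.cos θ * u₁ θ + N * Real.sin θ * u θ = 0

namespace IsLegendreSolution

variable {N : ℝ} {u u₁ u₂ : ℝ → ℝ}

lemma deriv_zero (h : IsLegendreSolution N u u₁ u₂) : u₁ 0 = 0 := by
  simpa using h.eq 0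

/-- The energy `u² + u'² / N` decreases on the northern hemisphere. -/
lemma antitoneOn_energy (h : IsLegendreSolution N u u₁ u₂) (hN : 0 < N) :
    AntitoneOn (fun θ => u θ ^ 2 + u₁ θ ^ 2 / N) (Set.Icc 0 (Real.pi / 2)) := by
  have hd : ∀ θ, HasDerivAt (fun θ => u θ ^ 2 + u₁ θ ^ 2 / N)
      (2 * u θ * u₁ θ + 2 * u₁ θ * u₂ θ / N) θ := fun θ => by
    refine (((h.deriv θ).pow 2).add (((h.deriv₂ θ).pow 2).div_const N)).congr_deriv ?_
    simp
  refine antitoneOn_of_deriv_nonpos (convex_Icc _ _)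
    (fun θ _ => (hd θ).continuousAt.continuousWithinAt)
    (fun θ _ => (hd θ).differentiableAt.differentiableWithinAt) fun θ hθ => ?_
  rw [interior_Icc] at hθ
  rw [(hd θ).deriv]
  have hs : 0 < Real.sin θ := Real.sin_pos_of_pos_of_lt_pi hθ.1 (by linarith [hθ.2, Real.pi_pos])
  have hc : 0 ≤ Real.cos θ := Real.cos_nonneg_of_mem_Icc ⟨by linarith [hθ.1, Real.pi_pos], hθ.2.le⟩
  have e : Real.sin θ * (2 * u θ * u₁ θ + 2 * u₁ θ * u₂ θ / N) =
      -(2 * Real.cos θ * u₁ θ ^ 2 / N) := by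
    field_simp
    linear_combination (u₁ θ) * h.eq θ
  have h2 : 0 ≤ 2 * Real.cos θ * u₁ θ ^ 2 / N := by positivity
  by_contra! hcon
  nlinarith [mul_pos hs hcon]

lemma add_smul_sub {v v₁ v₂ : ℝ → ℝ} (h : IsLegendreSolution N u u₁ u₂)
    (h' : IsLegendreSolution N v v₁ v₂) (c : ℝ) :
    IsLegendreSolution N (fun θ => u θ - c * v θ) (fun θ => u₁ θ - c * v₁ θ)
      (fun θ => u₂ θ - c * v₂ θ) where
  deriv θ := (h.deriv θ).sub ((h'.deriv θ).const_mul c)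
  deriv₂ θ := (h.deriv₂ θ).sub ((h'.deriv₂ θ).const_mul c)
  eq θ := by linear_combination h.eq θ - c * h'.eq θ

/-- A solution is determined by its value at the pole, although the equation is singular there. -/
lemma eq_mul {v v₁ v₂ : ℝ → ℝ} (h : IsLegendreSolution N u u₁ u₂)
    (h' : IsLegendreSolution N v v₁ v₂) (hN : 0 < N) (hv : v 0 = 1) {θ : ℝ}
    (hθ : θ ∈ Set.Icc 0 (Real.pi / 2)) : u θ = u 0 * v θ := by
  have hd := h.add_smul_sub h' (u 0)
  have h1 := hd.antitoneOn_energy hN ⟨le_rfl, hθ.1.trans hθ.2⟩ hθ hθ.1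
  have h2 := hd.deriv_zero
  simp only [h2, hv] at h1
  have h3 : 0 ≤ (u₁ θ - u 0 * v₁ θ) ^ 2 / N := by positivity
  have h4 : (u θ - u 0 * v θ) ^ 2 ≤ 0 := by
    ring_nf at h1 h3 ⊢
    linarith
  have h5 : u θ - u 0 * v θ = 0 := pow_eq_zero_iff two_ne_zero |>.1 (le_antisymm h4 (sq_nonneg _))
  linarith

/-- Decay of solutions away from the pole: `sin θ (u² + u'² / N)` changes, up to a small correction,
only at the rate `|u u'| / (N sin θ)`. -/
lemma energy_le (h : IsLegendreSolution N u u₁ u₂) (hN : 0 < N) (h0 : u 0 = 1) {α θ : ℝ}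
    (hα : 0 < α) (hαθ : α ≤ θ) (hθ : θ ≤ Real.pi / 2) :
    Real.sin θ * (u θ ^ 2 + u₁ θ ^ 2 / N) ≤
      Real.sin α + 1 / √N + (θ - α) / (2 * √N * Real.sin α) := by
  set S := √N with hS
  have hSpos : 0 < S := Real.sqrt_pos.2 hN
  have hSS : S ^ 2 = N := Real.sq_sqrt hN.le
  have hmem : ∀ t, α ≤ t → t ≤ θ → t ∈ Set.Icc 0 (Real.pi / 2) :=
    fun t h1 h2 => ⟨hα.le.trans h1, h2.trans hθ⟩
  have hE : ∀ t ∈ Set.Icc 0 (Real.pi / 2), u t ^ 2 + u₁ t ^ 2 / N ≤ 1 := by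
    intro t ht
    have := h.antitoneOn_energy hN ⟨le_rfl, ht.1.trans ht.2⟩ ht ht.1
    simpa [h0, h.deriv_zero] using this
  have huu : ∀ t ∈ Set.Icc 0 (Real.pi / 2), |u t * u₁ t| ≤ S / 2 := by
    intro t ht
    have h1 := hE t ht
    rw [← hSS] at h1
    have h2 : |u t * u₁ t| = S * (|u t| * (|u₁ t| / S)) := by
      rw [abs_mul]; field_simp
    have h3 : (u₁ t) ^ 2 / S ^ 2 = (|u₁ t| / S) ^ 2 := by rw [div_pow, sq_abs]
    have h4 : |u t| * (|u₁ t| / S) ≤ 1 / 2 := by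
      rw [h3, ← sq_abs (u t)] at h1
      nlinarith [sq_nonneg (|u t| - |u₁ t| / S)]
    rw [h2]
    nlinarith
  set W : ℝ → ℝ := fun t => Real.sin t * (u t ^ 2 + u₁ t ^ 2 / N) +
    Real.cos t * (u t * u₁ t) / N with hW
  set W' : ℝ → ℝ := fun t => Real.cos t * (u t ^ 2 + u₁ t ^ 2 / N) +
    Real.sin t * (2 * u t * u₁ t + 2 * u₁ t * u₂ t / N) +
    (-Real.sin t * (u t * u₁ t) + Real.cos t * (u₁ t * u₁ t + u t * u₂ t)) / N with hW'
  have hd : ∀ t, HasDerivAt W (W' t) t := fun t => by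
    refine (((Real.hasDerivAt_sin t).mul (((h.deriv t).pow 2).add
      (((h.deriv₂ t).pow 2).div_const N))).add (((Real.hasDerivAt_cos t).mul
      ((h.deriv t).mul (h.deriv₂ t))).div_const N)).congr_deriv ?_
    simp [hW']
  have hsin : ∀ t, α ≤ t → t ≤ θ → Real.sin α ≤ Real.sin t := fun t h1 h2 =>
    Real.sin_le_sin_of_le_of_le_pi_div_two (by linarith [Real.pi_pos]) (h2.trans hθ) h1
  have hsα : 0 < Real.sin α := Real.sin_pos_of_pos_of_lt_pi hα (by linarith [Real.pi_pos])
  have hW'le : ∀ t, α ≤ t → t ≤ θ → W' t ≤ 1 / (2 * S * Real.sin α) := by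
    intro t h1 h2
    have hst : 0 < Real.sin t := hsα.trans_le (hsin t h1 h2)
    have e : W' t = -(u t * u₁ t) / (N * Real.sin t) := by
      rw [eq_div_iff (by positivity)]
      simp only [hW']
      field_simp
      linear_combination (Real.cos t * u t + 2 * Real.sin t * u₁ t) * h.eq t -
        u t * u₁ t * Real.sin_sq_add_cos_sq t
    rw [e, div_le_div_iff₀ (by positivity) (by positivity)]
    have h3 := neg_le_of_abs_le (huu t (hmem t h1 h2))
    have h4 := hsin t h1 h2
    rw [← hSS]
    have h5 : -(u t * u₁ t) * (2 * S * Real.sin α) ≤ S / 2 * (2 * S * Real.sin α) := by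
      apply mul_le_mul_of_nonneg_right (by linarith) (by positivity)
    have h6 : S ^ 2 * Real.sin α ≤ S ^ 2 * Real.sin t := by gcongr
    nlinarith
  have hmv := (convex_Icc α θ).image_sub_le_mul_sub_of_deriv_le
    (fun t _ => (hd t).continuousAt.continuousWithinAt)
    (fun t _ => (hd t).differentiableAt.differentiableWithinAt)
    (C := 1 / (2 * S * Real.sin α)) (fun t ht => by
      rw [interior_Icc] at ht
      rw [(hd t).deriv]
      exact hW'le t ht.1.le ht.2.le) α ⟨le_rfl, hαθ⟩ θ ⟨hαθ, le_rfl⟩ hαθ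
  have hcorr : ∀ t, α ≤ t → t ≤ θ → |Real.cos t * (u t * u₁ t) / N| ≤ 1 / (2 * S) := by
    intro t h1 h2
    rw [abs_div, abs_mul, abs_of_pos hN, ← hSS, div_le_div_iff₀ (by positivity) (by positivity)]
    have h3 := huu t (hmem t h1 h2)
    have h4 : |Real.cos t| * |u t * u₁ t| ≤ 1 * (S / 2) :=
      mul_le_mul (Real.abs_cos_le_one t) h3 (abs_nonneg _) zero_le_one
    nlinarith
  have h1 := (abs_le.1 (hcorr θ hαθ le_rfl)).1
  have h2 := (abs_le.1 (hcorr α le_rfl hαθ)).2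
  have h3 : Real.sin α * (u α ^ 2 + u₁ α ^ 2 / N) ≤ Real.sin α :=
    mul_le_of_le_one_right hsα.le (hE α (hmem α le_rfl hαθ))
  have h4 : 1 / S = 1 / (2 * S) + 1 / (2 * S) := by field_simp; norm_num
  have h5 : 1 / (2 * S * Real.sin α) * (θ - α) = (θ - α) / (2 * S * Real.sin α) := by ring
  simp only [hW] at hmv
  linarith

/-- A quantitative form of the decay that is uniform beyond the angle `θ`. -/
lemma sq_le {n : ℕ} (hn : 1 ≤ n) (h : IsLegendreSolution (n * (n + 1)) u u₁ u₂) (h0 : u 0 = 1)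
    {α θ t : ℝ} (hα : 0 < α) (hαθ : α ≤ θ) (hθt : θ ≤ t) (ht : t ≤ Real.pi / 2) :
    u t ^ 2 ≤ 2 * (α / θ + 1 / (n * θ) + 1 / (n * α)) := by
  have hn0 : (1 : ℝ) ≤ n := by exact_mod_cast hn
  have hN : (0 : ℝ) < n * (n + 1) := by positivity
  have hθ : 0 < θ := hα.trans_le hαθ
  have hpi := Real.pi_pos
  have hθ2 : θ ≤ Real.pi / 2 := hθt.trans ht
  have hE := h.antitoneOn_energy hN ⟨hθ.le, hθ2⟩ ⟨hθ.le.trans hθt, ht⟩ hθt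
  have hb := h.energy_le hN h0 hα hαθ hθ2
  have hS : (n : ℝ) ≤ √(n * (n + 1)) := Real.le_sqrt_of_sq_le (by nlinarith)
  have hsθ : 2 / Real.pi * θ ≤ Real.sin θ := Real.mul_le_sin hθ.le hθ2
  have hsα : 2 / Real.pi * α ≤ Real.sin α := Real.mul_le_sin hα.le (hαθ.trans hθ2)
  have hsα' : Real.sin α ≤ α := Real.sin_le hα.le
  have hu : u t ^ 2 ≤ u θ ^ 2 + u₁ θ ^ 2 / (n * (n + 1)) := by
    have : 0 ≤ u₁ t ^ 2 / (n * (n + 1)) := by positivity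
    simp only at hE
    linarith
  have hE0 : 0 ≤ u θ ^ 2 + u₁ θ ^ 2 / (n * (n + 1)) := by positivity
  have h1 : 1 / √(n * (n + 1)) ≤ 1 / n := by gcongr
  have h2 : (θ - α) / (2 * √(n * (n + 1)) * Real.sin α) ≤ θ / (2 * n * (2 / Real.pi * α)) := by
    gcongr
    linarith
  have h3 : 2 / Real.pi * θ * u t ^ 2 ≤ α + 1 / n + θ / (2 * n * (2 / Real.pi * α)) := by
    have : 2 / Real.pi * θ * u t ^ 2 ≤ Real.sin θ * (u θ ^ 2 + u₁ θ ^ 2 / (n * (n + 1))) :=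
      mul_le_mul hsθ hu (sq_nonneg _) ((by positivity : (0 : ℝ) ≤ 2 / Real.pi * θ).trans hsθ)
    linarith
  have h4 : u t ^ 2 = Real.pi / (2 * θ) * (2 / Real.pi * θ * u t ^ 2) := by field_simp
  rw [h4]
  have h5 : Real.pi / (2 * θ) * (α + 1 / n + θ / (2 * n * (2 / Real.pi * α))) =
      Real.pi / 2 * (α / θ) + Real.pi / 2 * (1 / (n * θ)) + Real.pi ^ 2 / 8 * (1 / (n * α)) := by
    field_simp
    ring
  have hpi4 := Real.pi_le_four
  calc _ ≤ Real.pi / (2 * θ) * (α + 1 / n + θ / (2 * n * (2 / Real.pi * α))) := by gcongr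
    _ ≤ 2 * (α / θ) + 2 * (1 / (n * θ)) + 2 * (1 / (n * α)) := by
      rw [h5]
      gcongr
      · linarith
      · linarith
      · nlinarith
    _ = _ := by ring

end IsLegendreSolution

/-! ### Legendre polynomials as Laplace integrals -/

/-- The base `cos θ + i sin θ cos φ` of Laplace's integral. -/
noncomputable def laplaceBase (θ φ : ℝ) : ℂ :=
  Real.cos θ + Real.sin θ * Real.cos φ * Complex.I

/-- The derivative of `laplaceBase` in `θ`. -/
noncomputable def laplaceBase' (θ φ : ℝ) : ℂ :=
  -Real.sin θ + Real.cos θ * Real.cos φ * Complex.I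

lemma hasDerivAt_laplaceBase (θ φ : ℝ) :
    HasDerivAt (fun θ => laplaceBase θ φ) (laplaceBase' θ φ) θ := by
  have h1 := (Real.hasDerivAt_cos θ).ofReal_comp
  have h2 := (((Real.hasDerivAt_sin θ).ofReal_comp).mul_const (Real.cos φ : ℂ)).mul_const Complex.I
  refine (h1.add h2).congr_deriv ?_
  simp [laplaceBase']

lemma hasDerivAt_laplaceBase' (θ φ : ℝ) :
    HasDerivAt (fun θ => laplaceBase' θ φ) (-laplaceBase θ φ) θ := by
  have h1 := (Real.hasDerivAt_sin θ).ofReal_comp.neg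
  have h2 := (((Real.hasDerivAt_cos θ).ofReal_comp).mul_const (Real.cos φ : ℂ)).mul_const Complex.I
  refine (h1.add h2).congr_deriv ?_
  simp [laplaceBase]
  ring

lemma norm_add_mul_I_le {a b c : ℝ} (h : a ^ 2 + b ^ 2 = 1) (hc : |c| ≤ 1) :
    ‖(a + b * c * Complex.I : ℂ)‖ ≤ 1 := by
  rw [← sq_le_one_iff₀ (norm_nonneg _), Complex.sq_norm, Complex.normSq_apply]
  simp
  have : c ^ 2 ≤ 1 := by rw [← sq_abs]; exact pow_le_one₀ (abs_nonneg _) hc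
  nlinarith [sq_nonneg b, mul_nonneg (sq_nonneg b) (sub_nonneg.2 this)]

lemma norm_laplaceBase_le (θ φ : ℝ) : ‖laplaceBase θ φ‖ ≤ 1 :=
  norm_add_mul_I_le (Real.cos_sq_add_sin_sq θ) (Real.abs_cos_le_one φ)

lemma norm_laplaceBase'_le (θ φ : ℝ) : ‖laplaceBase' θ φ‖ ≤ 1 := by
  have := norm_add_mul_I_le (a := -Real.sin θ) (b := Real.cos θ) (by
    rw [neg_sq]; exact Real.sin_sq_add_cos_sq θ) (Real.abs_cos_le_one φ)
  simpa [laplaceBase'] using this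

lemma continuous_laplaceBase (θ : ℝ) : Continuous (laplaceBase θ) := by
  unfold laplaceBase; fun_prop

lemma continuous_laplaceBase' (θ : ℝ) : Continuous (laplaceBase' θ) := by
  unfold laplaceBase'; fun_prop

lemma hasDerivAt_intervalIntegral {f f' : ℝ → ℝ → ℂ} {C : ℝ}
    (hf : ∀ θ, Continuous (f θ)) (hf' : ∀ θ, Continuous (f' θ))
    (hd : ∀ θ φ, HasDerivAt (fun θ => f θ φ) (f' θ φ) θ) (hb : ∀ θ φ, ‖f' θ φ‖ ≤ C) (θ : ℝ) :
    HasDerivAt (fun θ => ∫ φ in (0 : ℝ)..2 * Real.pi, f θ φ)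
      (∫ φ in (0 : ℝ)..2 * Real.pi, f' θ φ) θ :=
  (intervalIntegral.hasDerivAt_integral_of_dominated_loc_of_deriv_le (bound := fun _ => C)
    (s := Set.univ) univ_mem (.of_forall fun θ => (hf θ).aestronglyMeasurable)
    ((hf θ).intervalIntegrable _ _) (hf' θ).aestronglyMeasurable
    (.of_forall fun φ _ θ _ => hb θ φ) intervalIntegrable_const
    (.of_forall fun φ _ θ _ => hd θ φ)).2

/-- The Legendre polynomial of degree `n` at `cos θ`, given by Laplace's integral. -/
noncomputable def legendre (n : ℕ) (θ : ℝ) : ℝ :=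
  (2 * Real.pi)⁻¹ * (∫ φ in (0 : ℝ)..2 * Real.pi, laplaceBase θ φ ^ n).re

lemma legendre_zero (n : ℕ) : legendre n 0 = 1 := by
  have : ∀ φ, laplaceBase 0 φ = 1 := fun φ => by simp [laplaceBase]
  simp only [legendre, this, one_pow, intervalIntegral.integral_const]
  simp
  field_simp

/-- The Laplace integrand satisfies the Legendre equation up to an exact derivative in `φ`. -/
lemma hasDerivAt_laplace_exact (m : ℕ) (θ φ : ℝ) :
    HasDerivAt (fun φ : ℝ => (m + 1 : ℂ) * Complex.I * (laplaceBase θ φ ^ m * Real.sin φ))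
      (Real.sin θ * ((m + 1 : ℂ) * (m * laplaceBase θ φ ^ (m - 1) * laplaceBase' θ φ ^ 2 -
        laplaceBase θ φ ^ (m + 1))) +
        Real.cos θ * ((m + 1 : ℂ) * (laplaceBase θ φ ^ m * laplaceBase' θ φ)) +
        (m + 1 : ℂ) * (m + 2) * Real.sin θ * laplaceBase θ φ ^ (m + 1)) φ := by
  have h1 : HasDerivAt (fun φ : ℝ => laplaceBase θ φ) (-Real.sin θ * Real.sin φ * Complex.I) φ := by
    refine ((((Real.hasDerivAt_cos φ).ofReal_comp).const_mul (Real.sin θ : ℂ)).mul_const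
      Complex.I).const_add (Real.cos θ : ℂ) |>.congr_deriv ?_
    push_cast
    ring
  have h2 := ((h1.pow m).mul (Real.hasDerivAt_sin φ).ofReal_comp).const_mul
    ((m + 1 : ℂ) * Complex.I)
  refine h2.congr_deriv ?_
  have e1 : (Real.sin θ : ℂ) ^ 2 + (Real.cos θ : ℂ) ^ 2 = 1 := by
    exact_mod_cast Real.sin_sq_add_cos_sq θ
  have e2 : (Real.sin φ : ℂ) ^ 2 + (Real.cos φ : ℂ) ^ 2 = 1 := by
    exact_mod_cast Real.sin_sq_add_cos_sq φ
  have e3 := Complex.I_sq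
  have key1 : laplaceBase θ φ ^ 2 + laplaceBase' θ φ ^ 2 = (Real.sin φ : ℂ) ^ 2 := by
    simp only [laplaceBase, laplaceBase']
    linear_combination (1 + (Real.cos φ : ℂ) ^ 2 * Complex.I ^ 2) * e1 - e2 +
      (Real.cos φ : ℂ) ^ 2 * e3
  have key2 : Real.sin θ * laplaceBase θ φ + Real.cos θ * laplaceBase' θ φ =
      Real.cos φ * Complex.I := by
    simp only [laplaceBase, laplaceBase']
    linear_combination (Real.cos φ : ℂ) * Complex.I * e1
  rcases m with _ | k
  · simp only [Pi.pow_apply, Nat.cast_zero]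
    linear_combination (-1 : ℂ) * key2
  · simp only [Pi.pow_apply, Nat.add_sub_cancel, Nat.cast_add, Nat.cast_one]
    generalize laplaceBase θ φ = z at *
    generalize laplaceBase' θ φ = z' at *
    linear_combination (-(k + 2 : ℂ) * (k + 1) * Real.sin θ * z ^ k) * key1 +
      (-(k + 2 : ℂ) * z ^ (k + 1)) * key2 -
      ((k + 2 : ℂ) * (k + 1) * Real.sin θ * z ^ k * Real.sin φ ^ 2) * e3

lemma isLegendreSolution_legendre {n : ℕ} (hn : 1 ≤ n) :
    ∃ v₁ v₂, IsLegendreSolution (n * (n + 1)) (legendre n) v₁ v₂ := by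
  obtain ⟨m, rfl⟩ : ∃ m, n = m + 1 := ⟨n - 1, by omega⟩
  set c : ℝ := (2 * Real.pi)⁻¹
  let f1 : ℝ → ℝ → ℂ := fun θ φ => (m + 1 : ℂ) * (laplaceBase θ φ ^ m * laplaceBase' θ φ)
  let f2 : ℝ → ℝ → ℂ := fun θ φ => (m + 1 : ℂ) *
    (m * laplaceBase θ φ ^ (m - 1) * laplaceBase' θ φ ^ 2 - laplaceBase θ φ ^ (m + 1))
  have c0 : ∀ k θ, Continuous fun φ => laplaceBase θ φ ^ k := fun k θ =>
    (continuous_laplaceBase θ).pow k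
  have c1 : ∀ θ, Continuous (f1 θ) := fun θ =>
    continuous_const.mul ((c0 m θ).mul (continuous_laplaceBase' θ))
  have c2 : ∀ θ, Continuous (f2 θ) := fun θ =>
    continuous_const.mul (((continuous_const.mul (c0 _ θ)).mul
      ((continuous_laplaceBase' θ).pow 2)).sub (c0 _ θ))
  have hp : ∀ k θ φ, ‖laplaceBase θ φ ^ k‖ ≤ 1 := fun k θ φ => by
    rw [norm_pow]; exact pow_le_one₀ (norm_nonneg _) (norm_laplaceBase_le θ φ)
  have hnm : ‖(m + 1 : ℂ)‖ = m + 1 := by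
    rw [show (m + 1 : ℂ) = ((m + 1 : ℝ) : ℂ) by push_cast; ring, Complex.norm_real,
      Real.norm_of_nonneg (by positivity)]
  have b1 : ∀ θ φ, ‖f1 θ φ‖ ≤ m + 1 := fun θ φ => by
    simp only [f1, norm_mul, hnm]
    have h1 := hp m θ φ
    have h2 := norm_laplaceBase'_le θ φ
    have : ‖laplaceBase θ φ ^ m‖ * ‖laplaceBase' θ φ‖ ≤ 1 := mul_le_one₀ h1 (norm_nonneg _) h2
    nlinarith [norm_nonneg (laplaceBase θ φ)]
  have b2 : ∀ θ φ, ‖f2 θ φ‖ ≤ (m + 1) * (m + 1) := fun θ φ => by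
    simp only [f2, norm_mul, hnm]
    have h1 := hp (m - 1) θ φ
    have h2 : ‖laplaceBase' θ φ ^ 2‖ ≤ 1 := by
      rw [norm_pow]; exact pow_le_one₀ (norm_nonneg _) (norm_laplaceBase'_le θ φ)
    have h3 := hp (m + 1) θ φ
    have h4 : ‖laplaceBase θ φ ^ (m - 1)‖ * ‖laplaceBase' θ φ ^ 2‖ ≤ 1 :=
      mul_le_one₀ h1 (norm_nonneg _) h2
    gcongr
    refine (norm_sub_le _ _).trans ?_
    rw [norm_mul, norm_mul, mul_assoc]
    have : ‖(m : ℂ)‖ = m := by simp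
    rw [this]
    have hm : (0 : ℝ) ≤ m := by positivity
    nlinarith
  have d1 : ∀ θ φ, HasDerivAt (fun θ => laplaceBase θ φ ^ (m + 1)) (f1 θ φ) θ := fun θ φ => by
    refine ((hasDerivAt_laplaceBase θ φ).pow (m + 1)).congr_deriv ?_
    simp [f1]; ring
  have d2 : ∀ θ φ, HasDerivAt (fun θ => f1 θ φ) (f2 θ φ) θ := fun θ φ => by
    refine ((((hasDerivAt_laplaceBase θ φ).pow m).mul
      (hasDerivAt_laplaceBase' θ φ)).const_mul (m + 1 : ℂ)).congr_deriv ?_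
    simp only [f2, Pi.pow_apply]
    ring
  have D1 := hasDerivAt_intervalIntegral (c0 (m + 1)) c1 d1 b1
  have D2 := hasDerivAt_intervalIntegral c1 c2 d2 b2
  have hre : ∀ {F : ℝ → ℂ} {F' : ℂ} {θ : ℝ}, HasDerivAt F F' θ →
      HasDerivAt (fun θ => c * (F θ).re) (c * F'.re) θ := fun h =>
    ((Complex.reCLM.hasFDerivAt.comp_hasDerivAt _ h).const_mul c)
  refine ⟨fun θ => c * (∫ φ in (0 : ℝ)..2 * Real.pi, f1 θ φ).re,
    fun θ => c * (∫ φ in (0 : ℝ)..2 * Real.pi, f2 θ φ).re, fun θ => hre (D1 θ),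
    fun θ => hre (D2 θ), fun θ => ?_⟩
  have hI : ∀ {f : ℝ → ℂ}, Continuous f → IntervalIntegrable f volume 0 (2 * Real.pi) :=
    fun h => h.intervalIntegrable _ _
  have hint : (Real.sin θ : ℂ) * (∫ φ in (0 : ℝ)..2 * Real.pi, f2 θ φ) +
      Real.cos θ * (∫ φ in (0 : ℝ)..2 * Real.pi, f1 θ φ) +
      (((m + 1) * (m + 2) * Real.sin θ : ℝ) : ℂ) *
        (∫ φ in (0 : ℝ)..2 * Real.pi, laplaceBase θ φ ^ (m + 1)) = 0 := by
    have i1 : IntervalIntegrable (fun φ => (Real.sin θ : ℂ) * f2 θ φ) volume 0 (2 * Real.pi) :=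
      hI (continuous_const.mul (c2 θ))
    have i2 : IntervalIntegrable (fun φ => (Real.cos θ : ℂ) * f1 θ φ) volume 0 (2 * Real.pi) :=
      hI (continuous_const.mul (c1 θ))
    have i3 : IntervalIntegrable (fun φ => (((m + 1) * (m + 2) * Real.sin θ : ℝ) : ℂ) *
        laplaceBase θ φ ^ (m + 1)) volume 0 (2 * Real.pi) :=
      hI (continuous_const.mul (c0 (m + 1) θ))
    have i12 : IntervalIntegrable (fun φ => (Real.sin θ : ℂ) * f2 θ φ + Real.cos θ * f1 θ φ)
        volume 0 (2 * Real.pi) := i1.add i2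
    have i123 : IntervalIntegrable (fun φ => (Real.sin θ : ℂ) * f2 θ φ + Real.cos θ * f1 θ φ +
        (((m + 1) * (m + 2) * Real.sin θ : ℝ) : ℂ) * laplaceBase θ φ ^ (m + 1))
        volume 0 (2 * Real.pi) := i12.add i3
    rw [← intervalIntegral.integral_const_mul, ← intervalIntegral.integral_const_mul,
      ← intervalIntegral.integral_const_mul, ← intervalIntegral.integral_add i1 i2,
      ← intervalIntegral.integral_add i12 i3,
      intervalIntegral.integral_eq_sub_of_hasDerivAt (fun φ _ =>
        (hasDerivAt_laplace_exact m θ φ).congr_deriv ?_) i123]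
    · simp
    · simp only [f1, f2]
      push_cast
      ring
  have h := congrArg Complex.re hint
  simp only [Complex.add_re, Complex.re_ofReal_mul, Complex.zero_re] at h
  simp only [legendre]
  push_cast
  linear_combination c * h

/-- The Mehler–Heine asymptotics: on the scale `1 / n`, Legendre polynomials converge to the Bessel
function `J₀`, the characteristic function of the circle. -/
lemma tendsto_legendre {θ : ℕ → ℝ} {w : E2}
    (hθ : Tendsto (fun n => n * θ n) atTop (𝓝 ‖w‖)) :
    Tendsto (fun n => legendre n (θ n)) atTop (𝓝 (charFun circleMeasure w).re) := by
  have hθ0 : Tendsto θ atTop (𝓝 0) := by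
    have h := hθ.mul (tendsto_inv_atTop_nhds_zero_nat (𝕜 := ℝ))
    rw [mul_zero] at h
    refine h.congr' ?_
    filter_upwards [eventually_ne_atTop 0] with n hn
    field_simp
  have hsin : Tendsto (fun n : ℕ => n * Real.sin (θ n)) atTop (𝓝 ‖w‖) := by
    have h := hθ.mul ((Real.continuous_sinc.tendsto 0).comp hθ0)
    rw [Real.sinc_zero, mul_one] at h
    refine h.congr fun n => ?_
    simp only [Function.comp]
    by_cases h0 : θ n = 0
    · simp [h0]
    · rw [Real.sinc_of_ne_zero h0]; field_simp
  have hcos : Tendsto (fun n : ℕ => n * (Real.cos (θ n) - 1)) atTop (𝓝 0) := by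
    have h := (hθ.mul hθ0).abs
    rw [mul_zero, abs_zero] at h
    refine squeeze_zero_norm (fun n => ?_) h
    rw [Real.norm_eq_abs, abs_mul, mul_assoc, abs_mul]
    refine mul_le_mul_of_nonneg_left ?_ (abs_nonneg _)
    rw [abs_of_nonpos (by linarith [Real.cos_le_one (θ n)]), abs_mul_self]
    nlinarith [Real.one_sub_sq_div_two_le_cos (x := θ n), mul_self_nonneg (θ n)]
  have hpt : ∀ φ : ℝ, Tendsto (fun n => laplaceBase (θ n) φ ^ n) atTop
      (𝓝 (Complex.exp ((‖w‖ * Real.cos φ : ℝ) * Complex.I))) := by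
    intro φ
    have h := Complex.tendsto_one_add_pow_exp_of_tendsto
      (g := fun n => laplaceBase (θ n) φ - 1) (t := (‖w‖ * Real.cos φ : ℝ) * Complex.I) ?_
    · simpa using h
    · have h1 := (Complex.continuous_ofReal.tendsto _).comp hcos
      have h2 := (((Complex.continuous_ofReal.tendsto _).comp hsin).mul_const
        (Real.cos φ : ℂ)).mul_const Complex.I
      have h3 := h1.add h2
      simp only [Complex.ofReal_zero, zero_add] at h3
      push_cast at h3 ⊢
      refine h3.congr fun n => ?_
      simp [laplaceBase]
      ring
  have hlim : Tendsto (fun n => ∫ φ in (0 : ℝ)..2 * Real.pi, laplaceBase (θ n) φ ^ n) atTop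
      (𝓝 (∫ φ in (0 : ℝ)..2 * Real.pi, Complex.exp ((‖w‖ * Real.cos φ : ℝ) * Complex.I))) := by
    refine intervalIntegral.tendsto_integral_filter_of_dominated_convergence (fun _ => 1)
      (.of_forall fun n => ((continuous_laplaceBase _).pow n).aestronglyMeasurable)
      (.of_forall fun n => .of_forall fun φ _ => ?_) intervalIntegrable_const
      (.of_forall fun φ _ => hpt φ)
    rw [norm_pow]
    exact pow_le_one₀ (norm_nonneg _) (norm_laplaceBase_le _ _)
  rw [charFun_circleMeasure]
  have hcast : (2 * Real.pi : ℂ)⁻¹ = (((2 * Real.pi)⁻¹ : ℝ) : ℂ) := by push_cast; ring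
  rw [hcast, Complex.re_ofReal_mul]
  exact ((Complex.continuous_re.tendsto _).comp hlim).const_mul _

/-! ### The kernel is a Legendre polynomial -/

lemma hasDerivAt_ev_comp₂ (p : MvPolynomial (Fin 3) ℝ) {γ γ' : ℝ → E3} {γ'' : E3} {t : ℝ}
    (h : HasDerivAt γ (γ' t) t) (h' : HasDerivAt γ' γ'' t) :
    HasDerivAt (fun t => ∑ i, ev (MvPolynomial.pderiv i p) (γ t) * γ' t i)
      (∑ i, ((∑ j, ev (MvPolynomial.pderiv j (MvPolynomial.pderiv i p)) (γ t) * γ' t j) * γ' t i +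
        ev (MvPolynomial.pderiv i p) (γ t) * γ'' i)) t := by
  refine HasDerivAt.fun_sum fun i _ => ?_
  have hi : HasDerivAt (fun t => γ' t i) (γ'' i) t :=
    (EuclideanSpace.proj i : E3 →L[ℝ] ℝ).hasFDerivAt.comp_hasDerivAt t h'
  exact (hasDerivAt_ev_comp _ h).mul hi

lemma sum_mul_ev_pderiv {p : MvPolynomial (Fin 3) ℝ} {n : ℕ} (hp : p.IsHomogeneous n) (X : E3) :
    ∑ i, X i * ev (MvPolynomial.pderiv i p) X = n * ev p X := by
  have h := congrArg (fun q => ev q X) hp.sum_X_mul_pderiv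
  simpa [ev_sum, ev_mul, ev_X, nsmul_eq_mul, ev] using h

/-- The unit vector with polar angle `θ` and longitude `φ`. -/
noncomputable def polarVector (θ φ : ℝ) : E3 :=
  (Real.sin θ * Real.cos φ) • EuclideanSpace.single 0 1 +
    (Real.sin θ * Real.sin φ) • EuclideanSpace.single 1 1 +
    Real.cos θ • EuclideanSpace.single 2 1

lemma polarVector_apply (θ φ : ℝ) : polarVector θ φ 0 = Real.sin θ * Real.cos φ ∧
    polarVector θ φ 1 = Real.sin θ * Real.sin φ ∧ polarVector θ φ 2 = Real.cos θ := by
  simp [polarVector]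

/-- A homogeneous harmonic polynomial that does not depend on the longitude solves the Legendre
equation along a meridian. -/
lemma isLegendreSolution_of_zonal {p : MvPolynomial (Fin 3) ℝ} {n : ℕ} (hn : 1 ≤ n)
    (hp : p.IsHomogeneous n) (hl : polyLaplacian p = 0)
    (hz : ∀ θ φ, ev p (polarVector θ φ) = ev p (polarVector θ 0)) :
    ∃ v₁ v₂, IsLegendreSolution (n * (n + 1)) (fun θ => ev p (polarVector θ 0)) v₁ v₂ := by
  set γ : ℝ → E3 := fun θ => polarVector θ 0 with hγ
  set γ' : ℝ → E3 := fun θ => Real.cos θ • EuclideanSpace.single 0 1 +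
    (-Real.sin θ) • EuclideanSpace.single 2 1 with hγ'
  set γ'' : ℝ → E3 := fun θ => (-Real.sin θ) • EuclideanSpace.single 0 1 +
    (-Real.cos θ) • EuclideanSpace.single 2 1 with hγ''
  have hγe : γ = fun θ => Real.sin θ • EuclideanSpace.single 0 1 +
      Real.cos θ • EuclideanSpace.single 2 1 := by
    funext θ; simp [hγ, polarVector]
  have d1 : ∀ θ, HasDerivAt γ (γ' θ) θ := fun θ => by
    rw [hγe]
    exact ((Real.hasDerivAt_sin θ).smul_const (EuclideanSpace.single 0 1 : E3)).add
      ((Real.hasDerivAt_cos θ).smul_const (EuclideanSpace.single 2 1 : E3))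
  have d2 : ∀ θ, HasDerivAt γ' (γ'' θ) θ := fun θ =>
    ((Real.hasDerivAt_cos θ).smul_const (EuclideanSpace.single 0 1 : E3)).add
      ((Real.hasDerivAt_sin θ).neg.smul_const (EuclideanSpace.single 2 1 : E3))
  have hφ : ∀ θ, Real.sin θ *
      (Real.sin θ * ev (MvPolynomial.pderiv 1 (MvPolynomial.pderiv 1 p)) (γ θ) -
        ev (MvPolynomial.pderiv 0 p) (γ θ)) = 0 := fun θ => by
    set δ' : ℝ → E3 := fun φ => (Real.sin θ * -Real.sin φ) • EuclideanSpace.single 0 1 +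
      (Real.sin θ * Real.cos φ) • EuclideanSpace.single 1 1
    set δ'' : ℝ → E3 := fun φ => (Real.sin θ * -Real.cos φ) • EuclideanSpace.single 0 1 +
      (Real.sin θ * -Real.sin φ) • EuclideanSpace.single 1 1
    have D1 : ∀ φ, HasDerivAt (polarVector θ) (δ' φ) φ := fun φ =>
      ((((Real.hasDerivAt_cos φ).const_mul (Real.sin θ)).smul_const
        (EuclideanSpace.single 0 1 : E3)).add
      (((Real.hasDerivAt_sin φ).const_mul (Real.sin θ)).smul_const
        (EuclideanSpace.single 1 1 : E3))).add_const _
    have D2 : ∀ φ, HasDerivAt δ' (δ'' φ) φ := fun φ =>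
      (((Real.hasDerivAt_sin φ).neg.const_mul (Real.sin θ)).smul_const
        (EuclideanSpace.single 0 1 : E3)).add
      (((Real.hasDerivAt_cos φ).const_mul (Real.sin θ)).smul_const
        (EuclideanSpace.single 1 1 : E3))
    have h1 : ∀ φ, ∑ i, ev (MvPolynomial.pderiv i p) (polarVector θ φ) * δ' φ i = 0 := fun φ => by
      refine (hasDerivAt_ev_comp p (D1 φ)).unique ?_
      simp_rw [hz θ]
      exact hasDerivAt_const _ _
    have h2 := hasDerivAt_ev_comp₂ p (D1 0) (D2 0)
    simp_rw [h1] at h2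
    have h3 := h2.unique (hasDerivAt_const _ _)
    simp [Fin.sum_univ_three, δ', δ''] at h3
    simp only [hγ]
    linear_combination h3
  have hp0 : (fun θ => Real.sin θ * ev (MvPolynomial.pderiv 1 (MvPolynomial.pderiv 1 p)) (γ θ)) =
        fun θ => ev (MvPolynomial.pderiv 0 p) (γ θ) := by
    have hγc : Continuous γ := continuous_iff_continuousAt.2 fun θ => (d1 θ).continuousAt
    have hcount : {θ : ℝ | Real.sin θ = 0}.Countable := by
      refine (Set.countable_range fun k : ℤ => (k : ℝ) * Real.pi).mono fun θ hθ => ?_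
      exact Real.sin_eq_zero_iff.1 hθ
    refine Continuous.ext_on (hcount.dense_compl ℝ)
      (Real.continuous_sin.mul ((continuous_ev _).comp hγc)) ((continuous_ev _).comp hγc) ?_
    intro θ hθ
    exact sub_eq_zero.1 ((mul_eq_zero.1 (hφ θ)).resolve_left hθ)
  refine ⟨_, _, fun θ => hasDerivAt_ev_comp p (d1 θ), fun θ => hasDerivAt_ev_comp₂ p (d1 θ) (d2 θ),
    fun θ => ?_⟩
  have hp0 := congrFun hp0 θ
  have e0 := sum_mul_ev_pderiv hp (γ θ)
  have e1 := sum_mul_ev_pderiv (hp.pderiv (i := 0)) (γ θ)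
  have e2 := sum_mul_ev_pderiv (hp.pderiv (i := 2)) (γ θ)
  have e3 := congrArg (fun q => ev q (γ θ)) hl
  have e4 := Real.sin_sq_add_cos_sq θ
  obtain ⟨g0, g1, g2⟩ := polarVector_apply θ 0
  have e5 : ev 0 (γ θ) = 0 := by simp [ev]
  simp only [polyLaplacian_apply, ev_add, Fin.sum_univ_three, e5] at e0 e1 e2 e3
  rw [Nat.cast_sub hn, Nat.cast_one] at e1 e2
  simp only [hγ, g0, g1, g2, Real.cos_zero, Real.sin_zero, mul_one, mul_zero, zero_mul,
    add_zero] at e0 e1 e2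
  have a0 : γ' θ 0 = Real.cos θ := by simp [hγ']
  have a1 : γ' θ 1 = 0 := by simp [hγ']
  have a2 : γ' θ 2 = -Real.sin θ := by simp [hγ']
  have b0 : γ'' θ 0 = -Real.sin θ := by simp [hγ'']
  have b1 : γ'' θ 1 = 0 := by simp [hγ'']
  have b2 : γ'' θ 2 = -Real.cos θ := by simp [hγ'']
  simp only [Fin.sum_univ_three, a0, a1, a2, b0, b1, b2]
  simp only [hγ] at *
  generalize ev (MvPolynomial.pderiv 0 p) (polarVector θ 0) = p0 at *
  generalize ev (MvPolynomial.pderiv 2 p) (polarVector θ 0) = p2 at *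
  generalize ev p (polarVector θ 0) = u at *
  generalize ev (MvPolynomial.pderiv 0 (MvPolynomial.pderiv 0 p)) (polarVector θ 0) = p00 at *
  generalize ev (MvPolynomial.pderiv 0 (MvPolynomial.pderiv 2 p)) (polarVector θ 0) = p02 at *
  generalize ev (MvPolynomial.pderiv 2 (MvPolynomial.pderiv 0 p)) (polarVector θ 0) = p20 at *
  generalize ev (MvPolynomial.pderiv 2 (MvPolynomial.pderiv 2 p)) (polarVector θ 0) = p22 at *
  generalize ev (MvPolynomial.pderiv 1 (MvPolynomial.pderiv 1 p)) (polarVector θ 0) = p11 at *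
  generalize Real.sin θ = s at *
  generalize Real.cos θ = c at *
  linear_combination (-s * s) * e1 - s * c * e2 + s * e3 - hp0 - ((n + 1) * s) * e0 +
    (s * p00 + s * p22 + p0) * e4

lemma inner_northPole (y : S2) : inner ℝ ((northPole : S2) : E3) (y : E3) = (y : E3) 2 := by
  simp [northPole, EuclideanSpace.inner_single_left]

lemma norm_polarVector (θ φ : ℝ) : ‖polarVector θ φ‖ = 1 := by
  obtain ⟨h0, h1, h2⟩ := polarVector_apply θ φ
  rw [EuclideanSpace.norm_eq, Fin.sum_univ_three, h0, h1, h2, Real.sqrt_eq_one]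
  simp only [Real.norm_eq_abs, sq_abs]
  linear_combination Real.sin θ ^ 2 * Real.sin_sq_add_cos_sq φ + Real.sin_sq_add_cos_sq θ

/-- The addition theorem for spherical harmonics. -/
lemma IsHarmonicBasis.kernel_eq_legendre {n : ℕ} {Y : ℤ → S2 → ℝ} (hY : IsHarmonicBasis n Y)
    (hn : 1 ≤ n) {x y : S2} {θ : ℝ} (hθ : θ ∈ Set.Icc 0 (Real.pi / 2))
    (hxy : inner ℝ (x : E3) (y : E3) = Real.cos θ) :
    harmonicKernel n Y x y = (2 * n + 1) * legendre n θ := by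
  obtain ⟨g, hg, -⟩ := exists_sphereMap_eq x northPole
  rw [← hY.kernel_sphereMap g x y, hg]
  obtain ⟨p, hp, hl, hev⟩ := mem_sphericalHarmonics_iff.1 (hY.kernel_mem northPole)
  let q : ℝ → ℝ → S2 := fun θ φ => ⟨polarVector θ φ, by simp [norm_polarVector]⟩
  have hq : ∀ θ φ, inner ℝ ((northPole : S2) : E3) (q θ φ : E3) = Real.cos θ := fun θ φ => by
    rw [inner_northPole]; exact (polarVector_apply θ φ).2.2
  have hz : ∀ θ φ, ev p (polarVector θ φ) = ev p (polarVector θ 0) := fun θ φ => by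
    have h := hY.kernel_congr ((hq θ φ).trans (hq θ 0).symm)
    rwa [hev, hev] at h
  obtain ⟨u₁, u₂, hu⟩ := isLegendreSolution_of_zonal hn hp hl hz
  obtain ⟨v₁, v₂, hv⟩ := isLegendreSolution_legendre hn
  have h := hu.eq_mul hv (by positivity) (legendre_zero n) hθ
  have h0 : q 0 0 = northPole := by
    ext1; simp [q, polarVector, northPole]
  have h1 : ev p (polarVector 0 0) = 2 * n + 1 := by
    rw [← hY.kernel_self northPole]
    conv_rhs => rw [hev, ← h0]
  rw [h1] at h
  rw [← h]
  have h2 : harmonicKernel n Y northPole (q θ 0) = ev p (polarVector θ 0) := hev _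
  rw [← h2]
  apply hY.kernel_congr
  rw [hq, ← hxy, ← hg]
  exact (g.inner_map_map _ _)

/-! ### Large values of spherical harmonics -/

namespace IsHarmonicBasis

variable {n : ℕ} {Y : ℤ → S2 → ℝ}

/-- The kernel is small compared to its value `2 n + 1` on the diagonal, unless the two points are
close to each other or almost antipodal. -/
lemma kernel_sq_le (hY : IsHarmonicBasis n Y) (hn : 1 ≤ n) {α θ : ℝ} (hα : 0 < α) (hαθ : α ≤ θ)
    {x y : S2} (hy : y ∉ doubleCap x θ) : harmonicKernel n Y x y ^ 2 ≤
      (2 * n + 1) ^ 2 * (2 * (α / θ + 1 / (n * θ) + 1 / (n * α))) := by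
  have hx1 : ‖(x : E3)‖ = 1 := by simp
  have hpos : ∀ z : S2, θ ≤ ‖(z : E3) - x‖ → 0 ≤ inner ℝ (x : E3) (z : E3) →
      harmonicKernel n Y x z ^ 2 ≤
      (2 * n + 1) ^ 2 * (2 * (α / θ + 1 / (n * θ) + 1 / (n * α))) := by
    intro z hz h0
    have hz1 : ‖(z : E3)‖ = 1 := by simp
    have hle : inner ℝ (x : E3) (z : E3) ≤ 1 := by
      simpa [hx1, hz1] using real_inner_le_norm (x : E3) (z : E3)
    set t := Real.arccos (inner ℝ (x : E3) (z : E3)) with ht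
    have hcos : Real.cos t = inner ℝ (x : E3) (z : E3) := Real.cos_arccos (by linarith) hle
    have ht0 : 0 ≤ t := Real.arccos_nonneg _
    have ht2 : t ≤ Real.pi / 2 := Real.arccos_le_pi_div_two.2 h0
    have hchord : ‖(z : E3) - x‖ ^ 2 = 2 - 2 * Real.cos t := by
      rw [norm_sub_sq_real, hx1, hz1, real_inner_comm, hcos]; ring
    have hθt : θ ≤ t := by
      refine hz.trans (abs_le_of_sq_le_sq' ?_ ht0).2
      rw [hchord]
      linarith [Real.one_sub_sq_div_two_le_cos (x := t)]
    rw [hY.kernel_eq_legendre hn ⟨ht0, ht2⟩ hcos.symm, mul_pow]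
    obtain ⟨v₁, v₂, hv⟩ := isLegendreSolution_legendre hn
    exact mul_le_mul_of_nonneg_left (hv.sq_le hn (legendre_zero n) hα hαθ hθt ht2) (sq_nonneg _)
  simp only [doubleCap, Set.mem_ofPred_eq, not_or, not_lt] at hy
  rcases le_total 0 (inner ℝ (x : E3) (y : E3)) with h | h
  · exact hpos y hy.1 h
  · have hyn : ((⟨-(y : E3), by simp⟩ : S2) : E3) = -(y : E3) := rfl
    rw [← sq_abs, ← hY.kernel_neg x hyn, sq_abs]
    refine hpos _ ?_ ?_
    · rw [hyn, ← neg_add', norm_neg]; exact hy.2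
    · rw [hyn, inner_neg_right]; linarith

lemma abs_kernel_le (hY : IsHarmonicBasis n Y) (x y : S2) :
    |harmonicKernel n Y x y| ≤ 2 * n + 1 := by
  have h := Finset.sum_mul_sq_le_sq_mul_sq (Finset.Icc (-(n : ℤ)) n) (fun k => Y k x)
    (fun k => Y k y)
  have e : ∀ z, ∑ k ∈ Finset.Icc (-(n : ℤ)) n, Y k z ^ 2 = 2 * n + 1 := fun z => by
    rw [← hY.kernel_self z]; simp [harmonicKernel, sq]
  rw [e, e, ← sq] at h
  exact abs_le_of_sq_le_sq h (by positivity)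

/-- A spherical harmonic of the basis is large only on a small set: otherwise the vector-valued map
`x ↦ (Y_l(ψ x))_l` would be correlated over large distances. -/
lemma measure_large_le (hY : IsHarmonicBasis n Y) {ψ : S2 → S2} (hψ : Measurable ψ) {δ θ M C : ℝ}
    (hδ : ∀ x, ‖(ψ x : E3) - x‖ ≤ δ) (hθ : 0 ≤ θ) (hM : 0 ≤ M)
    (hK : ∀ x y, y ∉ doubleCap x θ → |harmonicKernel n Y x y| ≤ (2 * n + 1) * M)
    (hC : ∀ (x : S2) (r : ℝ), 0 ≤ r → sphereMeasure.real (doubleCap x r) ≤ C * r ^ 2)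
    {k : ℤ} (hk : k ∈ Finset.Icc (-(n : ℤ)) n) {ε : ℝ} (hε : 0 < ε) :
    ε ^ 2 * sphereMeasure.real {x | ε * √(2 * n + 1) < |Y k (ψ x)|} ≤
      C * (θ + 2 * δ) ^ 2 + M * sphereMeasure.real {x | ε * √(2 * n + 1) < |Y k (ψ x)|} := by
  classical
  set B : Set S2 := {x | ε * √(2 * n + 1) < |Y k (ψ x)|} with hB
  have hδ0 : 0 ≤ δ := (norm_nonneg _).trans (hδ northPole)
  have hmY : ∀ l ∈ Finset.Icc (-(n : ℤ)) n, Measurable fun x => Y l (ψ x) := fun l hl =>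
    (hY.continuous hl).measurable.comp hψ
  have hBm : MeasurableSet B := measurableSet_lt measurable_const (hmY k hk).abs
  -- the sign of `Y_k(ψ x)`, restricted to `B`
  set s : S2 → ℝ := B.indicator fun x => if 0 ≤ Y k (ψ x) then 1 else -1 with hs
  have hsm : Measurable s := (Measurable.ite (measurableSet_le measurable_const (hmY k hk))
    measurable_const measurable_const).indicator hBm
  have hs1 : ∀ x, |s x| ≤ B.indicator 1 x := fun x => by
    by_cases hx : x ∈ B
    · simp only [hs, Set.indicator_of_mem hx, Pi.one_apply]
      split_ifs <;> simp
    · simp [hs, Set.indicator_of_notMem hx]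
  have hsabs : ∀ x, |s x| ≤ 1 := fun x => (hs1 x).trans (Set.indicator_le_self' (by simp) x)
  have hbdd : ∀ l ∈ Finset.Icc (-(n : ℤ)) n, ∃ c, ∀ x, |Y l x| ≤ c := fun l hl => by
    obtain ⟨c, hc⟩ := isCompact_univ.exists_bound_of_continuousOn (hY.continuous hl).continuousOn
    exact ⟨c, fun x => hc x trivial⟩
  have hint : ∀ l ∈ Finset.Icc (-(n : ℤ)) n,
      Integrable (fun x => s x * Y l (ψ x)) sphereMeasure := fun l hl => by
    obtain ⟨c, hc⟩ := hbdd l hl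
    refine Integrable.of_bound (hsm.mul (hmY l hl)).aestronglyMeasurable c (.of_forall fun x => ?_)
    rw [Real.norm_eq_abs, abs_mul]
    exact (mul_le_of_le_one_left (abs_nonneg _) (hsabs x)).trans (hc _)
  set b : ℤ → ℝ := fun l => ∫ x, s x * Y l (ψ x) ∂sphereMeasure with hb
  have hBint : Integrable (B.indicator (1 : S2 → ℝ)) sphereMeasure :=
    (integrable_const 1).indicator hBm
  -- lower bound for the coefficient of index `k`
  have hlow : ε * √(2 * n + 1) * sphereMeasure.real B ≤ b k := by
    have h1 : ∫ x, ε * √(2 * n + 1) * B.indicator 1 x ∂sphereMeasure =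
        ε * √(2 * n + 1) * sphereMeasure.real B := by
      rw [integral_const_mul, integral_indicator_one hBm]
    rw [← h1]
    refine integral_mono (hBint.const_mul _) (hint k hk) fun x => ?_
    by_cases hx : x ∈ B
    · simp only [hs, Set.indicator_of_mem hx, Pi.one_apply, mul_one]
      have h2 : ε * √(2 * n + 1) < |Y k (ψ x)| := hx
      split_ifs with h3
      · rw [abs_of_nonneg h3] at h2; linarith
      · rw [abs_of_neg (not_le.1 h3)] at h2; linarith
    · simp [hs, Set.indicator_of_notMem hx]
  have hsum : b k ^ 2 ≤ ∑ l ∈ Finset.Icc (-(n : ℤ)) n, b l ^ 2 :=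
    Finset.single_le_sum (f := fun l => b l ^ 2) (fun l _ => sq_nonneg (b l)) hk
  have hinner : ∀ x, ∑ l ∈ Finset.Icc (-(n : ℤ)) n, b l * Y l (ψ x) =
      ∫ x', s x' * harmonicKernel n Y (ψ x) (ψ x') ∂sphereMeasure := fun x => by
    simp only [hb, harmonicKernel, ← integral_mul_const, Finset.mul_sum]
    rw [integral_finsetSum]
    swap
    · exact fun l hl => ((hint l hl).mul_const (Y l (ψ x))).congr (.of_forall fun x' => by
        simp only; ring)
    exact Finset.sum_congr rfl fun l _ => integral_congr_ae (.of_forall fun x' => by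
      simp only; ring)
  have hup : ∀ x, |∑ l ∈ Finset.Icc (-(n : ℤ)) n, b l * Y l (ψ x)| ≤
      (2 * n + 1) * (C * (θ + 2 * δ) ^ 2 + M * sphereMeasure.real B) := fun x => by
    rw [hinner x, ← Real.norm_eq_abs]
    have hcap := hC x (θ + 2 * δ) (by linarith)
    have hcapm := measurableSet_doubleCap x (θ + 2 * δ)
    have hcapint : Integrable ((doubleCap x (θ + 2 * δ)).indicator (1 : S2 → ℝ)) sphereMeasure :=
      (integrable_const 1).indicator hcapm
    have h1 : ∫ x', (2 * n + 1) * ((doubleCap x (θ + 2 * δ)).indicator (1 : S2 → ℝ) x' +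
        M * B.indicator (1 : S2 → ℝ) x') ∂sphereMeasure =
        (2 * n + 1) * (sphereMeasure.real (doubleCap x (θ + 2 * δ)) +
          M * sphereMeasure.real B) := by
      rw [integral_const_mul, integral_add hcapint (hBint.const_mul M), integral_const_mul,
        integral_indicator_one hBm, integral_indicator_one hcapm]
    refine (norm_integral_le_of_norm_le ((hcapint.add (hBint.const_mul M)).const_mul (2 * n + 1))
      (.of_forall fun x' => ?_)).trans (h1.le.trans (by gcongr))
    simp only [Pi.add_apply]
    rw [Real.norm_eq_abs, abs_mul]
    by_cases hx' : x' ∈ doubleCap x (θ + 2 * δ)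
    · rw [Set.indicator_of_mem hx', Pi.one_apply]
      have h2 := hY.abs_kernel_le (ψ x) (ψ x')
      have h3 : 0 ≤ M * B.indicator (1 : S2 → ℝ) x' :=
        mul_nonneg hM (Set.indicator_nonneg (by simp) _)
      have h4 := mul_le_mul (hsabs x') h2 (abs_nonneg _) zero_le_one
      nlinarith
    · rw [Set.indicator_of_notMem hx', zero_add]
      have hfar : ψ x' ∉ doubleCap (ψ x) θ := by
        simp only [doubleCap, Set.mem_ofPred_eq, not_or, not_lt] at hx' ⊢
        have h1 := hδ x
        have h2 := hδ x'
        constructor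
        · have h3 : (x' : E3) - x = (ψ x' - ψ x) - (ψ x' - x') + (ψ x - x) := by abel
          have h4 := norm_add_le ((ψ x' - ψ x : E3) - (ψ x' - x')) (ψ x - x)
          have h5 := norm_sub_le (ψ x' - ψ x : E3) (ψ x' - x')
          rw [← h3] at h4
          linarith [hx'.1]
        · have h3 : (x' : E3) + x = (ψ x' + ψ x) - (ψ x' - x') - (ψ x - x) := by abel
          have h4 := norm_sub_le ((ψ x' + ψ x : E3) - (ψ x' - x')) (ψ x - x)
          have h5 := norm_sub_le (ψ x' + ψ x : E3) (ψ x' - x')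
          rw [← h3] at h4
          linarith [hx'.2]
      have h2 := hK _ _ hfar
      have h3 := hs1 x'
      calc |s x'| * |harmonicKernel n Y (ψ x) (ψ x')|
          ≤ B.indicator 1 x' * ((2 * n + 1) * M) := mul_le_mul h3 h2 (abs_nonneg _)
            (Set.indicator_nonneg (by simp) _)
        _ = _ := by ring
  have htot : ∑ l ∈ Finset.Icc (-(n : ℤ)) n, b l ^ 2 ≤ sphereMeasure.real B *
      ((2 * n + 1) * (C * (θ + 2 * δ) ^ 2 + M * sphereMeasure.real B)) := by
    have h1 : ∑ l ∈ Finset.Icc (-(n : ℤ)) n, b l ^ 2 =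
        ∫ x, s x * ∑ l ∈ Finset.Icc (-(n : ℤ)) n, b l * Y l (ψ x) ∂sphereMeasure := by
      simp only [Finset.mul_sum]
      rw [integral_finsetSum]
      swap
      · exact fun l hl => ((hint l hl).mul_const (b l)).congr (.of_forall fun x' => by
          simp only; ring)
      refine Finset.sum_congr rfl fun l _ => ?_
      rw [sq]
      nth_rw 2 [hb]
      rw [← integral_const_mul]
      exact integral_congr_ae (.of_forall fun x' => by simp only; ring)
    have h2 : ∫ x, B.indicator (1 : S2 → ℝ) x *
        ((2 * n + 1) * (C * (θ + 2 * δ) ^ 2 + M * sphereMeasure.real B)) ∂sphereMeasure =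
        sphereMeasure.real B *
        ((2 * n + 1) * (C * (θ + 2 * δ) ^ 2 + M * sphereMeasure.real B)) := by
      rw [integral_mul_const, integral_indicator_one hBm]
    rw [h1, ← h2]
    refine (le_abs_self _).trans ?_
    rw [← Real.norm_eq_abs]
    refine norm_integral_le_of_norm_le (hBint.mul_const _) (.of_forall fun x => ?_)
    rw [Real.norm_eq_abs, abs_mul]
    exact mul_le_mul (hs1 x) (hup x) (abs_nonneg _) (Set.indicator_nonneg (by simp) _)
  have hC0 : 0 ≤ C * (θ + 2 * δ) ^ 2 := measureReal_nonneg.trans (hC northPole _ (by linarith))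
  rcases (measureReal_nonneg (μ := sphereMeasure) (s := B)).eq_or_lt with h0 | h0
  · rw [← h0]; simpa using hC0
  · have hsq : (√(2 * n + 1 : ℝ)) ^ 2 = 2 * n + 1 := Real.sq_sqrt (by positivity)
    have h1 : (ε * √(2 * n + 1) * sphereMeasure.real B) ^ 2 ≤ b k ^ 2 :=
      pow_le_pow_left₀ (by positivity) hlow 2
    have h2 := (h1.trans hsum).trans htot
    rw [mul_pow, mul_pow, hsq] at h2
    have h3 : 0 < (2 * n + 1 : ℝ) * sphereMeasure.real B := by positivity
    refine le_of_mul_le_mul_left ?_ h3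
    linarith

end IsHarmonicBasis

/-- In a spherical harmonics basis, no function contributes substantially to `f_n` near a typical
point. -/
lemma tendsto_measure_exists_large {Y : ℕ → ℤ → S2 → ℝ}
    (hY : ∀ n, 1 ≤ n → IsHarmonicBasis n (Y n)) {R : ℝ} (hR : 0 ≤ R) {ψ : ℕ → S2 → S2}
    (hψ : ∀ n, Measurable (ψ n)) (hψR : ∀ n x, ‖(ψ n x : E3) - x‖ ≤ R / n) {ε : ℝ} (hε : 0 < ε) :
    Tendsto (fun n : ℕ => sphereMeasure.real {x | ∃ k ∈ Finset.Icc (-(n : ℤ)) n,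
      ε * √(2 * n + 1) < |Y n k (ψ n x)|}) atTop (𝓝 0) := by
  obtain ⟨C, hC0, hC⟩ := exists_sphereMeasure_doubleCap_le
  -- the angles are powers of `t = n ^ (-1 / 5)`: cap radius `t ^ 3`, auxiliary angle `t ^ 4`
  set t : ℕ → ℝ := fun n => (n : ℝ) ^ (-(1 / 5) : ℝ) with ht
  have ht0 : Tendsto t atTop (𝓝 0) :=
    (tendsto_rpow_neg_atTop (by norm_num)).comp tendsto_natCast_atTop_atTop
  set M : ℕ → ℝ := fun n => √(2 * (t n + t n ^ 2 + t n)) with hM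
  have hM0 : Tendsto M atTop (𝓝 0) := by
    have h : Tendsto (fun n => 2 * (t n + t n ^ 2 + t n)) atTop (𝓝 (2 * (0 + 0 ^ 2 + 0))) :=
      ((ht0.add (ht0.pow 2)).add ht0).const_mul 2
    have h2 := (Real.continuous_sqrt.tendsto _).comp h
    rwa [show (2 * (0 + 0 ^ 2 + 0) : ℝ) = 0 by ring, Real.sqrt_zero] at h2
  have hlim : Tendsto (fun n => 3 * (2 * C / ε ^ 2) * (t n * (1 + 2 * R * t n ^ 2) ^ 2)) atTop
      (𝓝 0) := by
    have h := (ht0.mul (((ht0.pow 2).const_mul (2 * R)).const_add 1 |>.pow 2)).const_mul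
      (3 * (2 * C / ε ^ 2))
    simpa using h
  refine squeeze_zero' (.of_forall fun _ => measureReal_nonneg) ?_ hlim
  have hMε : ∀ᶠ n in atTop, M n < ε ^ 2 / 2 := hM0.eventually_lt_const (by positivity)
  have ht1 : ∀ᶠ n in atTop, t n < 1 := ht0.eventually_lt_const one_pos
  filter_upwards [hMε, ht1, eventually_ge_atTop 1] with n hMn ht1 hn
  have hn0 : (0 : ℝ) < n := by exact_mod_cast hn
  have htp : 0 < t n := Real.rpow_pos_of_pos hn0 _
  have ht5 : t n ^ 5 = (n : ℝ)⁻¹ := by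
    rw [ht, ← Real.rpow_natCast, ← Real.rpow_mul hn0.le, ← Real.rpow_neg_one]
    norm_num
  have hnt : (n : ℝ) = (t n ^ 5)⁻¹ := by rw [ht5, inv_inv]
  have hone : ∀ k ∈ Finset.Icc (-(n : ℤ)) n, sphereMeasure.real
      {x | ε * √(2 * n + 1) < |Y n k (ψ n x)|} ≤
      2 * C / ε ^ 2 * (t n ^ 3 * (1 + 2 * R * t n ^ 2)) ^ 2 := by
    intro k hk
    have h := (hY n hn).measure_large_le (hψ n) (hψR n) (θ := t n ^ 3) (M := M n) (by positivity)
      (Real.sqrt_nonneg _) (fun x y hxy => ?_) hC hk hε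
    · have e : t n ^ 3 + 2 * (R / n) = t n ^ 3 * (1 + 2 * R * t n ^ 2) := by
        rw [div_eq_mul_inv, ← ht5]; ring
      rw [e] at h
      have h2 := mul_le_mul_of_nonneg_right hMn.le (measureReal_nonneg (μ := sphereMeasure)
        (s := {x | ε * √(2 * n + 1) < |Y n k (ψ n x)|}))
      rw [div_mul_eq_mul_div, le_div_iff₀ (by positivity)]
      linarith
    · have h := (hY n hn).kernel_sq_le hn (pow_pos htp 4) (θ := t n ^ 3)
        (pow_le_pow_of_le_one htp.le ht1.le (by norm_num)) hxy
      have e : 2 * (t n ^ 4 / t n ^ 3 + 1 / (n * t n ^ 3) + 1 / (n * t n ^ 4)) =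
          2 * (t n + t n ^ 2 + t n) := by
        rw [hnt]; field_simp
      rw [e] at h
      refine abs_le_of_sq_le_sq ?_ (by positivity)
      rw [mul_pow, hM, Real.sq_sqrt (by positivity)]
      exact h
  have hunion : {x | ∃ k ∈ Finset.Icc (-(n : ℤ)) n, ε * √(2 * n + 1) < |Y n k (ψ n x)|} =
      ⋃ k ∈ Finset.Icc (-(n : ℤ)) n, {x | ε * √(2 * n + 1) < |Y n k (ψ n x)|} := by
    ext x; simp
  rw [hunion]
  refine (measureReal_biUnion_finset_le _ _).trans ((Finset.sum_le_sum hone).trans ?_)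
  rw [Finset.sum_const, nsmul_eq_mul]
  have hcard : ((Finset.Icc (-(n : ℤ)) n).card : ℝ) ≤ 3 * n := by
    have : (Finset.Icc (-(n : ℤ)) n).card ≤ 3 * n := by simp; omega
    exact_mod_cast this
  calc _ ≤ 3 * n * (2 * C / ε ^ 2 * (t n ^ 3 * (1 + 2 * R * t n ^ 2)) ^ 2) := by gcongr
    _ = _ := by rw [hnt]; field_simp

/-! ### The exponential map in a moving frame -/

lemma contDiff_sinc : ContDiff ℝ 1 Real.sinc := by
  rw [contDiff_iff_contDiffAt]
  intro x
  by_cases hx : x = 0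
  · subst hx
    obtain ⟨p, hp⟩ := Real.analyticAt_sin (x := 0)
    have h : AnalyticAt ℝ Real.sinc 0 := by
      rw [Real.sinc_eq_dslope]
      exact ⟨_, hp.has_fpower_series_dslope_fslope⟩
    exact h.contDiffAt
  · refine (Real.contDiff_sin.contDiffAt.div contDiffAt_id hx).congr_of_eventuallyEq ?_
    filter_upwards [isOpen_ne.mem_nhds hx] with y hy
    exact Real.sinc_of_ne_zero hy

lemma deriv_sinc_zero : deriv Real.sinc 0 = 0 := by
  have h := deriv_comp_neg Real.sinc (0 : ℝ)
  simp only [Real.sinc_neg, neg_zero] at h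
  linarith

/-- An even `C¹` function of the norm is `C¹`. -/
lemma contDiff_comp_norm {E : Type*} [NormedAddCommGroup E] [InnerProductSpace ℝ E] {f : ℝ → ℝ}
    (hf : ContDiff ℝ 1 f) (h0 : deriv f 0 = 0) : ContDiff ℝ 1 fun V : E => f ‖V‖ := by
  have hd : ∀ r, HasDerivAt f (deriv f r) r := fun r =>
    (hf.differentiable one_ne_zero r).hasDerivAt
  have hc : Continuous (deriv f) := hf.continuous_deriv_one
  rw [contDiff_one_iff_hasFDerivAt]
  refine ⟨fun V => (deriv f ‖V‖ * ‖V‖⁻¹) • innerSL ℝ V, ?_, fun V => ?_⟩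
  · rw [continuous_iff_continuousAt]
    intro V
    by_cases hV : V = 0
    · subst hV
      have h1 : Tendsto (fun V : E => |deriv f ‖V‖|) (𝓝 0) (𝓝 0) := by
        have := (hc.comp continuous_norm).abs.tendsto (0 : E)
        simpa [h0] using this
      rw [ContinuousAt]
      simp only [norm_zero, inv_zero, mul_zero, zero_smul]
      refine squeeze_zero_norm (fun V => ?_) h1
      rw [norm_smul, innerSL_apply_norm, norm_mul, norm_inv, norm_norm, mul_assoc,
        Real.norm_eq_abs]
      exact mul_le_of_le_one_right (abs_nonneg _) (inv_mul_le_one)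
    · have : ‖V‖ ≠ 0 := norm_ne_zero_iff.2 hV
      have h2 : ContinuousAt (fun V : E => deriv f ‖V‖) V := by fun_prop
      have h3 : ContinuousAt (fun V : E => ‖V‖⁻¹) V := continuous_norm.continuousAt.inv₀ this
      exact (h2.mul h3).smul (innerSL ℝ (E := E)).continuous.continuousAt
  · by_cases hV : V = 0
    · subst hV
      simp only [map_zero, smul_zero]
      have h1 := hasDerivAt_iff_isLittleO.1 (hd 0)
      rw [hasFDerivAt_iff_isLittleO]
      have h2 := (h1.comp_tendsto (tendsto_norm_zero (E := E)))
      refine Asymptotics.isLittleO_norm_right.1 (h2.congr (fun x => ?_) fun x => ?_)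
      · simp [h0]
      · simp
    · have hV' : ‖V‖ ≠ 0 := norm_ne_zero_iff.2 hV
      have hn : HasFDerivAt (fun V : E => ‖V‖) (‖V‖⁻¹ • innerSL ℝ V) V := by
        have h := (hasStrictFDerivAt_norm_sq V).hasFDerivAt.sqrt (pow_ne_zero 2 hV')
        simp only [Real.sqrt_sq (norm_nonneg _)] at h
        refine h.congr_fderiv ?_
        ext W
        simp
        field_simp
      refine ((hd ‖V‖).comp_hasFDerivAt V hn).congr_fderiv ?_
      rw [smul_smul]

/-- The cardinal sine of the norm. -/
noncomputable def radialSinc (V : E2) : ℝ := Real.sinc ‖V‖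

lemma contDiff_radialSinc : ContDiff ℝ 1 radialSinc := contDiff_comp_norm contDiff_sinc deriv_sinc_zero

lemma radialSinc_mul_norm (V : E2) : radialSinc V * ‖V‖ = Real.sin ‖V‖ := by
  by_cases h : ‖V‖ = 0
  · simp [h]
  · rw [radialSinc, Real.sinc_of_ne_zero h, div_mul_cancel₀ _ h]

/-- The map `y ↦ (exp_x (t R y) - x) / t` in an orthonormal frame with first vector `x`, written so
as to be smooth up to `t = 0`. -/
noncomputable def chart (R : ℝ) (q : ℝ × E2) : E3 :=
  !₂[-(q.1 / 2) * (R ^ 2 * ‖q.2‖ ^ 2 * radialSinc ((q.1 * R / 2) • q.2) ^ 2),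
    radialSinc ((q.1 * R) • q.2) * (R * q.2 0), radialSinc ((q.1 * R) • q.2) * (R * q.2 1)]

lemma chart_apply_zero (R t : ℝ) (y : E2) : chart R (t, y) 0 =
    -(t / 2) * (R ^ 2 * ‖y‖ ^ 2 * radialSinc ((t * R / 2) • y) ^ 2) := rfl

lemma chart_apply_one (R t : ℝ) (y : E2) : chart R (t, y) 1 =
    radialSinc ((t * R) • y) * (R * y 0) := rfl

lemma chart_apply_two (R t : ℝ) (y : E2) : chart R (t, y) 2 =
    radialSinc ((t * R) • y) * (R * y 1) := rfl

lemma contDiff_chart (R : ℝ) : ContDiff ℝ 1 (chart R) := by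
  have h1 : ContDiff ℝ 1 fun q : ℝ × E2 => radialSinc ((q.1 * R / 2) • q.2) :=
    contDiff_radialSinc.comp (by fun_prop)
  have h2 : ContDiff ℝ 1 fun q : ℝ × E2 => radialSinc ((q.1 * R) • q.2) :=
    contDiff_radialSinc.comp (by fun_prop)
  have h3 : ContDiff ℝ 1 fun q : ℝ × E2 => ‖q.2‖ ^ 2 := contDiff_snd.norm_sq ℝ
  have h4 : ∀ i, ContDiff ℝ 1 fun q : ℝ × E2 => q.2 i := fun i =>
    (EuclideanSpace.proj i : E2 →L[ℝ] ℝ).contDiff.comp contDiff_snd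
  rw [contDiff_euclidean]
  intro i
  fin_cases i
  · exact (contDiff_fst.div_const 2).neg.mul ((contDiff_const.mul h3).mul (h1.pow 2))
  · exact h2.mul (contDiff_const.mul (h4 0))
  · exact h2.mul (contDiff_const.mul (h4 1))

/-- At `t = 0` the chart is the dilation of the plane by `R`. -/
lemma chart_zero (R : ℝ) (y : E2) : chart R (0, y) = !₂[0, R * y 0, R * y 1] := by
  simp [chart, radialSinc]

/-- The orthonormal frame of `ℝ³` with first vector `x` whose other vectors are given by an isometry
of the plane with the tangent plane at `x`. -/
noncomputable def frame (x : S2) (f : E2 ≃ₗᵢ[ℝ] TangentPlane x) : E3 ≃ₗᵢ[ℝ] E3 :=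
  LinearIsometry.toLinearIsometryEquiv (E₁ := E3) (F := E3)
    { toFun := fun W => W 0 • (x : E3) + (f !₂[W 1, W 2] : E3)
      map_add' := fun V W => by
        have h : (!₂[V 1 + W 1, V 2 + W 2] : E2) = !₂[V 1, V 2] + !₂[W 1, W 2] := by
          ext i; fin_cases i <;> rfl
        simp only [PiLp.add_apply, h, map_add, Submodule.coe_add, add_smul]
        abel
      map_smul' := fun c W => by
        have h : (!₂[c * W 1, c * W 2] : E2) = c • !₂[W 1, W 2] := by
          ext i; fin_cases i <;> rfl
        simp only [PiLp.smul_apply, smul_eq_mul, h, map_smul, Submodule.coe_smul, smul_add,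
          mul_smul, RingHom.id_apply]
      norm_map' := fun W => by
        have hx : ‖(x : E3)‖ = 1 := by simp
        have hv : inner ℝ (x : E3) (f !₂[W 1, W 2] : E3) = 0 :=
          Submodule.mem_orthogonal_singleton_iff_inner_right.1 (f !₂[W 1, W 2]).2
        have hn : ‖(f !₂[W 1, W 2] : E3)‖ = ‖(!₂[W 1, W 2] : E2)‖ := f.norm_map _
        have h : ‖W 0 • (x : E3) + (f !₂[W 1, W 2] : E3)‖ ^ 2 = ‖W‖ ^ 2 := by
          rw [norm_add_sq_real, inner_smul_left, hv, hn, norm_smul, hx, EuclideanSpace.norm_sq_eq,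
            EuclideanSpace.norm_sq_eq, Fin.sum_univ_two, Fin.sum_univ_three]
          simp
          ring
        exact (pow_left_inj₀ (norm_nonneg _) (norm_nonneg _) two_ne_zero).1 h } rfl

lemma frame_apply (x : S2) (f : E2 ≃ₗᵢ[ℝ] TangentPlane x) (W : E3) :
    frame x f W = W 0 • (x : E3) + (f !₂[W 1, W 2] : E3) := rfl

/-- The point `exp_x (R y / n)`. -/
noncomputable def expPoint (e : (x : S2) → E2 ≃ₗᵢ[ℝ] TangentPlane x) (R : ℝ) (n : ℕ) (y : E2)
    (x : S2) : S2 :=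
  sphereExp x (e x ((R / n) • y))

section expPoint

variable (e : (x : S2) → E2 ≃ₗᵢ[ℝ] TangentPlane x) (R : ℝ) (n : ℕ)

lemma coe_expPoint_eq (y : E2) (x : S2) : (expPoint e R n y x : E3) =
    Real.cos ‖(R / n) • y‖ • (x : E3) +
      Real.sinc ‖(R / n) • y‖ • (e x ((R / n) • y) : E3) := by
  simp only [expPoint, sphereExp, LinearIsometryEquiv.norm_map]

lemma coe_expPoint {n : ℕ} (hn : 1 ≤ n) (y : E2) (x : S2) : (expPoint e R n y x : E3) =
    x + (n : ℝ)⁻¹ • frame x (e x) (chart R ((n : ℝ)⁻¹, y)) := by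
  have hn0 : (n : ℝ) ≠ 0 := by positivity
  set t : ℝ := (n : ℝ)⁻¹ with ht
  have hRt : R / n = t * R := by rw [ht]; ring
  have h1 : (!₂[radialSinc ((t * R) • y) * (R * y 0), radialSinc ((t * R) • y) * (R * y 1)] : E2) =
      (radialSinc ((t * R) • y) * R) • y := by
    ext i; fin_cases i <;> simp <;> ring
  have h2 : Real.cos ‖(t * R) • y‖ = 1 + t *
      (-(t / 2) * (R ^ 2 * ‖y‖ ^ 2 * radialSinc ((t * R / 2) • y) ^ 2)) := by
    have h3 := radialSinc_mul_norm ((t * R / 2) • y)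
    have h4 : ‖(t * R) • y‖ = 2 * ‖(t * R / 2) • y‖ := by
      rw [norm_smul, norm_smul, Real.norm_eq_abs, Real.norm_eq_abs, abs_div, abs_two]; ring
    have h5 : ‖(t * R / 2) • y‖ ^ 2 = (t * R / 2) ^ 2 * ‖y‖ ^ 2 := by
      rw [norm_smul, mul_pow, Real.norm_eq_abs, sq_abs]
    rw [h4, Real.cos_two_mul, Real.cos_sq', ← h3, mul_pow, h5]
    ring
  rw [coe_expPoint_eq, hRt, h2, frame_apply]
  rw [chart_apply_zero, chart_apply_one, chart_apply_two, h1, map_smul, map_smul, Submodule.coe_smul, Submodule.coe_smul, add_smul,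
    one_smul, smul_add, smul_smul, smul_smul, smul_smul, add_assoc]
  congr 3
  simp only [radialSinc]
  ring

lemma norm_expPoint_sub_le (hR : 0 ≤ R) {y : E2} (hy : y ∈ unitBall) (x : S2) :
    ‖(expPoint e R n y x : E3) - x‖ ≤ R / n := by
  set V := (R / n) • y with hV
  have hx : ‖(x : E3)‖ = 1 := by simp
  have hz : ‖(expPoint e R n y x : E3)‖ = 1 := by simp
  have hv : inner ℝ (x : E3) (e x V : E3) = 0 :=
    Submodule.mem_orthogonal_singleton_iff_inner_right.1 (e x V).2
  have hin : inner ℝ (expPoint e R n y x : E3) (x : E3) = Real.cos ‖V‖ := by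
    rw [coe_expPoint_eq, real_inner_comm, inner_add_right, inner_smul_right, inner_smul_right, hv,
      real_inner_self_eq_norm_sq, hx]
    simp [hV]
  have h1 : ‖(expPoint e R n y x : E3) - x‖ ^ 2 ≤ ‖V‖ ^ 2 := by
    rw [norm_sub_sq_real, hin, hx, hz]
    linarith [Real.one_sub_sq_div_two_le_cos (x := ‖V‖)]
  refine (abs_le_of_sq_le_sq' h1 (norm_nonneg _)).2.trans ?_
  rw [hV, norm_smul, Real.norm_of_nonneg (by positivity)]
  exact mul_le_of_le_one_right (by positivity) (by simpa using hy)

lemma measurable_expPoint (he : ∀ y : E2, Measurable fun x : S2 => ((e x y : TangentPlane x) : E3))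
    (y : E2) : Measurable (expPoint e R n y) := by
  have h : Measurable fun x => (expPoint e R n y x : E3) := by
    simp only [coe_expPoint_eq]
    exact (measurable_subtype_coe.const_smul (Real.cos ‖(R / n) • y‖)).add
      ((he ((R / n) • y)).const_smul (Real.sinc ‖(R / n) • y‖))
  exact h.subtype_mk

lemma measurable_frame (he : ∀ y : E2, Measurable fun x : S2 => ((e x y : TangentPlane x) : E3))
    (W : E3) : Measurable fun x => frame x (e x) W := by
  simp only [frame_apply]
  exact (measurable_subtype_coe.const_smul (W 0)).add (he _)

/-- As the chart is a dilation at `t = 0`, the chord between two nearby points is at leading order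
`R / n` times the distance in the plane. -/
lemma norm_expPoint_sub {n : ℕ} (hn : 1 ≤ n) (y z : E2) (x : S2) :
    ‖(expPoint e R n y x : E3) - expPoint e R n z x‖ =
      (n : ℝ)⁻¹ * ‖chart R ((n : ℝ)⁻¹, y) - chart R ((n : ℝ)⁻¹, z)‖ := by
  rw [coe_expPoint e R hn, coe_expPoint e R hn, add_sub_add_left_eq_sub, ← smul_sub, ← map_sub,
    norm_smul, LinearIsometryEquiv.norm_map, Real.norm_of_nonneg (by positivity)]

end expPoint

/-! ### The local functions -/

section localField

variable {Ω : Type*} {a : ℤ → Ω → ℝ} {n : ℕ} {Y : ℤ → S2 → ℝ}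
  {e : (x : S2) → E2 ≃ₗᵢ[ℝ] TangentPlane x} {R : ℝ}

lemma localField_eq (p : Ω × S2) (y : E2) : localField a Y e R n p y =
    (√(2 * n + 1))⁻¹ * ∑ k ∈ Finset.Icc (-(n : ℤ)) n, a k p.1 * Y k (expPoint e R n y p.2) := rfl

lemma IsHarmonicBasis.exists_polynomial (hY : IsHarmonicBasis n Y) :
    ∃ q : ℤ → MvPolynomial (Fin 3) ℝ, ∀ k ∈ Finset.Icc (-(n : ℤ)) n, (q k).IsHomogeneous n ∧
      polyLaplacian (q k) = 0 ∧ ∀ x : S2, Y k x = ev (q k) x := by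
  have h : ∀ k, ∃ q : MvPolynomial (Fin 3) ℝ, k ∈ Finset.Icc (-(n : ℤ)) n →
      q.IsHomogeneous n ∧ polyLaplacian q = 0 ∧ ∀ x : S2, Y k x = ev q x := fun k => by
    by_cases hk : k ∈ Finset.Icc (-(n : ℤ)) n
    · obtain ⟨q, hq⟩ := mem_sphericalHarmonics_iff.1 (hY.mem k hk)
      exact ⟨q, fun _ => hq⟩
    · exact ⟨0, fun h => absurd h hk⟩
  choose q hq using h
  exact ⟨q, hq⟩

lemma contDiff_localField (hn : 1 ≤ n) (hY : IsHarmonicBasis n Y) (p : Ω × S2) :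
    ContDiff ℝ 1 (localField a Y e R n p) := by
  obtain ⟨q, hq⟩ := hY.exists_polynomial
  have h : localField a Y e R n p = fun y => (√(2 * n + 1))⁻¹ * ∑ k ∈ Finset.Icc (-(n : ℤ)) n,
      a k p.1 * ev (q k) ((p.2 : E3) + (n : ℝ)⁻¹ •
        frame p.2 (e p.2) (chart R ((n : ℝ)⁻¹, y))) := by
    funext y
    rw [localField_eq]
    congr 1
    refine Finset.sum_congr rfl fun k hk => ?_
    rw [(hq k hk).2.2, coe_expPoint e R hn]
  rw [h]
  have h1 : ContDiff ℝ 1 fun y : E2 => chart R ((n : ℝ)⁻¹, y) :=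
    (contDiff_chart R).comp (by fun_prop)
  have h2 : ContDiff ℝ 1 fun y : E2 => (p.2 : E3) + (n : ℝ)⁻¹ •
      frame p.2 (e p.2) (chart R ((n : ℝ)⁻¹, y)) :=
    contDiff_const.add (((frame p.2 (e p.2)).contDiff.comp h1).const_smul _)
  exact contDiff_const.mul (ContDiff.sum fun k _ => contDiff_const.mul ((contDiff_ev _).comp h2))

variable [MeasurableSpace Ω]

lemma measurable_localField (hY : IsHarmonicBasis n Y) (ha : ∀ k, Measurable (a k))
    (he : ∀ y : E2, Measurable fun x : S2 => ((e x y : TangentPlane x) : E3)) (y : E2) :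
    Measurable fun p : Ω × S2 => localField a Y e R n p y := by
  simp only [localField_eq]
  refine measurable_const.mul (Finset.measurable_fun_sum _ fun k hk => ?_)
  exact ((ha k).comp measurable_fst).mul ((hY.continuous hk).measurable.comp
    ((measurable_expPoint e R n he y).comp measurable_snd))

lemma measurable_toC1Ball_localField (hn : 1 ≤ n) (hY : IsHarmonicBasis n Y)
    (ha : ∀ k, Measurable (a k))
    (he : ∀ y : E2, Measurable fun x : S2 => ((e x y : TangentPlane x) : E3)) :
    Measurable fun p : Ω × S2 => toC1Ball (localField a Y e R n p) := by
  refine C1Ball.measurable_of_val fun y => ?_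
  simp only [toC1Ball_val (contDiff_localField hn hY _).contDiffOn]
  exact measurable_localField hY ha he y

end localField

/-! ### The central limit theorem for the finite-dimensional distributions -/

lemma norm_prod_sub_prod_le {ι : Type*} (s : Finset ι) {z w : ι → ℂ} (hz : ∀ i ∈ s, ‖z i‖ ≤ 1)
    (hw : ∀ i ∈ s, ‖w i‖ ≤ 1) : ‖∏ i ∈ s, z i - ∏ i ∈ s, w i‖ ≤ ∑ i ∈ s, ‖z i - w i‖ := by
  classical
  induction s using Finset.induction_on with
  | empty => simp
  | insert i s hi ih =>
    have hz' := fun j hj => hz j (Finset.mem_insert_of_mem hj)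
    have hw' := fun j hj => hw j (Finset.mem_insert_of_mem hj)
    rw [Finset.prod_insert hi, Finset.prod_insert hi, Finset.sum_insert hi]
    have e : z i * ∏ j ∈ s, z j - w i * ∏ j ∈ s, w j =
        (z i - w i) * ∏ j ∈ s, z j + w i * (∏ j ∈ s, z j - ∏ j ∈ s, w j) := by ring
    have h1 : ‖∏ j ∈ s, z j‖ ≤ 1 := by
      rw [norm_prod]; exact Finset.prod_le_one (fun _ _ => norm_nonneg _) hz'
    rw [e]
    refine (norm_add_le _ _).trans (add_le_add ?_ ?_)
    · rw [norm_mul]; exact mul_le_of_le_one_right (norm_nonneg _) h1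
    · rw [norm_mul]
      exact (mul_le_of_le_one_left (norm_nonneg _) (hw i (Finset.mem_insert_self i s))).trans
        (ih hz' hw')

section CentralLimit

variable {Ω : Type*} [MeasurableSpace Ω] {P : Measure Ω}

/-- The characteristic function of a weighted sum of independent copies of `a 0`. -/
lemma integral_exp_sum {a : ℤ → Ω → ℝ} (ha : ∀ k, Measurable (a k)) (hi : iIndepFun a P)
    (hid : ∀ k, IdentDistrib (a k) (a 0) P P) (s : Finset ℤ) (c : ℤ → ℝ) :
    ∫ ω, Complex.exp ((∑ k ∈ s, a k ω * c k : ℝ) * Complex.I) ∂P =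
      ∏ k ∈ s, charFun (P.map (a 0)) (c k) := by
  have hm : ∀ k, Measurable fun ω => c k * a k ω := fun k => (ha k).const_mul _
  have h := iIndepFun.charFun_map_fun_finsetSum_eq_prod (s := s) (X := fun k ω => c k * a k ω)
    (fun k _ => (hm k).aemeasurable)
    ((hi.comp (fun k x => c k * x) fun k => measurable_const_mul (c k)).restrict _)
  have h1 := congrFun h 1
  rw [charFun_apply_real, integral_map (Finset.measurable_fun_sum s fun k _ => hm k).aemeasurable
    (by fun_prop), Finset.prod_apply] at h1
  simp only [charFun_map_mul_comp (ha _).aemeasurable, mul_one, (hid _).map_eq] at h1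
  rw [← h1]
  refine integral_congr_ae (.of_forall fun ω => ?_)
  simp only [mul_comm (a _ ω)]
  simp

variable [IsProbabilityMeasure P]

/-- The second order expansion of the characteristic function, compared with the Gaussian one. -/
lemma exists_norm_charFun_sub_le {X : Ω → ℝ} (hX : Measurable X) (h0 : ∫ ω, X ω ∂P = 0)
    (h1 : ∫ ω, X ω ^ 2 ∂P = 1) {η : ℝ} (hη : 0 < η) : ∃ δ > 0, ∀ t : ℝ, |t| ≤ δ →
      ‖charFun (P.map X) t - Complex.exp (-(t ^ 2 / 2 : ℝ))‖ ≤ η * t ^ 2 := by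
  have h := (taylor_charFun_two (P := P) hX.aemeasurable h0 h1).def (half_pos hη)
  obtain ⟨δ, hδ, hb⟩ := Metric.eventually_nhds_iff.1 h
  refine ⟨min (δ / 2) (min 1 η), by positivity, fun t ht => ?_⟩
  have ht1 : |t| ≤ 1 := ht.trans ((min_le_right _ _).trans (min_le_left _ _))
  have htη : |t| ≤ η := ht.trans ((min_le_right _ _).trans (min_le_right _ _))
  have htδ : dist t 0 < δ := by
    rw [Real.dist_eq, sub_zero]
    exact (ht.trans (min_le_left _ _)).trans_lt (by linarith)
  have h2 := hb htδ
  have hsq : t ^ 2 = |t| ^ 2 := (sq_abs t).symm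
  have h01 : t ^ 2 ≤ 1 := by rw [hsq]; exact pow_le_one₀ (abs_nonneg _) ht1
  have hnorm : ‖((-(t ^ 2 / 2) : ℝ) : ℂ)‖ = t ^ 2 / 2 := by
    rw [Complex.norm_real, norm_neg, Real.norm_of_nonneg (by positivity)]
  have h3 := Complex.norm_exp_sub_one_sub_id_le (x := ((-(t ^ 2 / 2) : ℝ) : ℂ)) (by
    rw [hnorm]; linarith)
  rw [hnorm] at h3
  have h4 : (t ^ 2 / 2) ^ 2 ≤ η / 2 * t ^ 2 := by
    have : t ^ 2 ≤ η := by
      rw [hsq, sq]; nlinarith [abs_nonneg t]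
    nlinarith [sq_nonneg t]
  have h5 : ‖((t : ℂ) ^ 2)‖ = t ^ 2 := by
    rw [norm_pow, Complex.norm_real, Real.norm_eq_abs, sq_abs]
  have e : charFun (P.map X) t - Complex.exp (-(t ^ 2 / 2 : ℝ)) =
      (charFun (P.map X) t - (1 - (t : ℂ) ^ 2 / 2)) -
      (Complex.exp ((-(t ^ 2 / 2) : ℝ) : ℂ) - 1 - ((-(t ^ 2 / 2) : ℝ) : ℂ)) := by
    push_cast; ring
  rw [e]
  refine (norm_sub_le _ _).trans ?_
  rw [Real.norm_of_nonneg (sq_nonneg t)] at h2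
  linarith

/-- The Lindeberg comparison: with small coefficients, a product of characteristic functions is close to
the Gaussian one. -/
lemma norm_charFun_prod_sub_le {X : Ω → ℝ} {η δ : ℝ} (hδ : ∀ t : ℝ, |t| ≤ δ →
      ‖charFun (P.map X) t - Complex.exp (-(t ^ 2 / 2 : ℝ))‖ ≤ η * t ^ 2) (hX : Measurable X)
    (s : Finset ℤ) (c : ℤ → ℝ) (hc : ∀ k ∈ s, |c k| ≤ δ) :
    ‖∏ k ∈ s, charFun (P.map X) (c k) - Complex.exp (-((∑ k ∈ s, c k ^ 2) / 2 : ℝ))‖ ≤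
      η * ∑ k ∈ s, c k ^ 2 := by
  have := Measure.isProbabilityMeasure_map hX.aemeasurable (μ := P)
  have e : Complex.exp (-((∑ k ∈ s, c k ^ 2) / 2 : ℝ)) =
      ∏ k ∈ s, Complex.exp (-(c k ^ 2 / 2 : ℝ)) := by
    rw [← Complex.exp_sum]
    congr 1
    push_cast
    rw [Finset.sum_neg_distrib, Finset.sum_div]
  rw [e, Finset.mul_sum]
  refine (norm_prod_sub_prod_le s (fun k _ => norm_charFun_le_one _) fun k _ => ?_).trans
    (Finset.sum_le_sum fun k hk => hδ _ (hc k hk))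
  rw [Complex.norm_exp, Complex.neg_re, Complex.ofReal_re, Real.exp_le_one_iff, neg_nonpos]
  positivity

end CentralLimit

/-- The covariance of the rescaled plane wave. -/
noncomputable def waveCov (R : ℝ) (y z : E2) : ℝ := (charFun circleMeasure (R • y - R • z)).re

/-- The kernel at two points near `x` is a Legendre polynomial whose argument does not depend on `x`,
and by the Mehler–Heine asymptotics it converges to the covariance of the plane wave. -/
lemma exists_tendsto_kernel {Y : ℕ → ℤ → S2 → ℝ} (hY : ∀ n, 1 ≤ n → IsHarmonicBasis n (Y n))
    (e : (x : S2) → E2 ≃ₗᵢ[ℝ] TangentPlane x) (R : ℝ) (y z : E2) :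
    ∃ v : ℕ → ℝ, Tendsto v atTop (𝓝 (waveCov R y z)) ∧ ∀ᶠ n in atTop, ∀ x,
      harmonicKernel n (Y n) (expPoint e R n y x) (expPoint e R n z x) = (2 * n + 1) * v n := by
  -- `d n` is the rescaled chord and `θ n` the angle
  set d : ℕ → ℝ := fun n => ‖chart R ((n : ℝ)⁻¹, y) - chart R ((n : ℝ)⁻¹, z)‖ with hd
  set θ : ℕ → ℝ := fun n => 2 * Real.arcsin ((n : ℝ)⁻¹ * d n / 2) with hθ
  have hn0 : Tendsto (fun n : ℕ => (n : ℝ)⁻¹) atTop (𝓝 0) := tendsto_inv_atTop_nhds_zero_nat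
  have hchart : ∀ y, Tendsto (fun n : ℕ => chart R ((n : ℝ)⁻¹, y)) atTop (𝓝 (chart R (0, y))) :=
    fun y => ((contDiff_chart R).continuous.tendsto _).comp (hn0.prodMk_nhds tendsto_const_nhds)
  have hdlim : Tendsto d atTop (𝓝 ‖R • y - R • z‖) := by
    have h := ((hchart y).sub (hchart z)).norm
    have e1 : ‖chart R (0, y) - chart R (0, z)‖ = ‖R • y - R • z‖ := by
      rw [chart_zero, chart_zero, EuclideanSpace.norm_eq, EuclideanSpace.norm_eq,
        Fin.sum_univ_three, Fin.sum_univ_two]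
      simp
    rwa [e1] at h
  have hdn : Tendsto (fun n : ℕ => (n : ℝ)⁻¹ * d n / 2) atTop (𝓝 0) := by
    simpa using (hn0.mul hdlim).div_const 2
  have hθ0 : Tendsto θ atTop (𝓝 0) := by
    have h := ((Real.continuous_arcsin.tendsto 0).comp hdn).const_mul 2
    simpa using h
  have hsin : ∀ᶠ n in atTop, Real.sin (θ n / 2) = (n : ℝ)⁻¹ * d n / 2 := by
    filter_upwards [hdn.eventually_le_const one_pos] with n hn
    have h0 : 0 ≤ (n : ℝ)⁻¹ * d n / 2 := by positivity
    rw [hθ, mul_div_cancel_left₀ _ two_ne_zero, Real.sin_arcsin (by linarith) hn]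
  have hsinc : Tendsto (fun n => Real.sinc (θ n / 2)) atTop (𝓝 1) := by
    have h := (Real.continuous_sinc.tendsto 0).comp (by simpa using hθ0.div_const 2)
    rwa [Real.sinc_zero] at h
  have hnθ : Tendsto (fun n : ℕ => n * θ n) atTop (𝓝 ‖R • y - R • z‖) := by
    have h := hdlim.div hsinc one_ne_zero
    rw [div_one] at h
    refine h.congr' ?_
    filter_upwards [hsin, hsinc.eventually_ne one_ne_zero, eventually_ne_atTop 0] with n h1 h2 h3
    have h4 : Real.sinc (θ n / 2) * (θ n / 2) = Real.sin (θ n / 2) := by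
      by_cases h : θ n / 2 = 0
      · simp [h]
      · rw [Real.sinc_of_ne_zero h, div_mul_cancel₀ _ h]
    have hn : (n : ℝ) ≠ 0 := by exact_mod_cast h3
    rw [h1] at h4
    simp only [Pi.div_apply]
    rw [div_eq_iff h2]
    field_simp at h4
    linarith
  refine ⟨fun n => legendre n (θ n), tendsto_legendre hnθ, ?_⟩
  filter_upwards [hsin, hθ0.eventually_le_const (by positivity : 0 < Real.pi / 2),
    eventually_ge_atTop 1] with n h1 h2 hn x
  refine (hY n hn).kernel_eq_legendre hn ⟨?_, h2⟩ ?_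
  · have : 0 ≤ Real.arcsin ((n : ℝ)⁻¹ * d n / 2) := Real.arcsin_nonneg.2 (by positivity)
    simp only [hθ]
    positivity
  · have h3 := norm_expPoint_sub e R hn y z x
    have h4 : ‖(expPoint e R n y x : E3)‖ = 1 := by simp
    have h5 : ‖(expPoint e R n z x : E3)‖ = 1 := by simp
    have h6 := norm_sub_sq_real (expPoint e R n y x : E3) (expPoint e R n z x)
    have h7 : Real.cos (θ n) = 1 - 2 * Real.sin (θ n / 2) ^ 2 := by
      rw [Real.sin_sq, ← mul_div_cancel₀ (θ n) (two_ne_zero (α := ℝ)) , Real.cos_two_mul]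
      simp
      ring
    rw [h3, h4, h5] at h6
    rw [h7, h1]
    simp only [hd]
    linarith

/-- The finite-dimensional distributions of the local functions converge to those of the plane
wave. -/
lemma tendsto_integral_exp_localField {Ω : Type*} [MeasurableSpace Ω] (P : Measure Ω)
    [IsProbabilityMeasure P] {a : ℤ → Ω → ℝ} (ha : ∀ k, Measurable (a k)) (hi : iIndepFun a P)
    (hid : ∀ k, IdentDistrib (a k) (a 0) P P) (h0 : ∫ ω, a 0 ω ∂P = 0)
    (h1 : ∫ ω, a 0 ω ^ 2 ∂P = 1) {Y : ℕ → ℤ → S2 → ℝ}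
    (hY : ∀ n, 1 ≤ n → IsHarmonicBasis n (Y n)) {e : (x : S2) → E2 ≃ₗᵢ[ℝ] TangentPlane x}
    (he : ∀ y : E2, Measurable fun x : S2 => ((e x y : TangentPlane x) : E3)) {R : ℝ} (hR : 0 ≤ R)
    {ι : Type*} [Fintype ι] (t : ι → ℝ) (y : ι → unitBall) :
    Tendsto (fun n : ℕ => ∫ p, Complex.exp ((∑ i, t i * localField a (Y n) e R n p (y i) : ℝ) *
        Complex.I) ∂(P.prod sphereMeasure)) atTop
      (𝓝 (Complex.exp (-((∑ i, ∑ j, t i * t j * waveCov R (y i) (y j)) / 2 : ℝ)))) := by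
  choose v hv hvK using fun i j => exists_tendsto_kernel hY e R (y i) (y j)
  set V : ℕ → ℝ := fun n => ∑ i, ∑ j, t i * t j * v i j n with hV
  have hVlim : Tendsto V atTop (𝓝 (∑ i, ∑ j, t i * t j * waveCov R (y i) (y j))) :=
    tendsto_finsetSum _ fun i _ => tendsto_finsetSum _ fun j _ => (hv i j).const_mul _
  set c : ℕ → S2 → ℤ → ℝ := fun n x k => (√(2 * n + 1))⁻¹ *
    ∑ i, t i * Y n k (expPoint e R n (y i) x) with hc
  have hsqrt : ∀ n : ℕ, (√(2 * n + 1 : ℝ)) ^ 2 = 2 * n + 1 := fun n =>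
    Real.sq_sqrt (by positivity)
  have hsqrt0 : ∀ n : ℕ, 0 < √(2 * n + 1 : ℝ) := fun n => Real.sqrt_pos.2 (by positivity)
  -- the total variance of the coefficients does not depend on `x`
  have hcV : ∀ᶠ n : ℕ in atTop, ∀ x, ∑ k ∈ Finset.Icc (-(n : ℤ)) n, c n x k ^ 2 = V n := by
    have hall : ∀ᶠ n : ℕ in atTop, ∀ i j x, harmonicKernel n (Y n) (expPoint e R n (y i) x)
        (expPoint e R n (y j) x) = (2 * n + 1) * v i j n :=
      eventually_all.2 fun i => eventually_all.2 fun j => hvK i j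
    filter_upwards [hall] with n hn x
    have e1 : ∀ k, c n x k ^ 2 = (2 * n + 1 : ℝ)⁻¹ * ∑ i, ∑ j, t i * t j *
        (Y n k (expPoint e R n (y i) x) * Y n k (expPoint e R n (y j) x)) := fun k => by
      simp only [hc]
      rw [mul_pow, inv_pow, hsqrt, sq, Finset.sum_mul_sum]
      congr 1
      exact Finset.sum_congr rfl fun i _ => Finset.sum_congr rfl fun j _ => by ring
    simp only [e1]
    rw [← Finset.mul_sum, Finset.sum_comm]
    simp only [Finset.sum_comm (s := Finset.Icc (-(n : ℤ)) n), ← Finset.mul_sum]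
    have e2 : ∀ i j, ∑ k ∈ Finset.Icc (-(n : ℤ)) n,
        Y n k (expPoint e R n (y i) x) * Y n k (expPoint e R n (y j) x) =
        (2 * n + 1) * v i j n := fun i j => hn i j x
    simp only [e2, hV, Finset.mul_sum]
    refine Finset.sum_congr rfl fun i _ => Finset.sum_congr rfl fun j _ => ?_
    have : (2 * n + 1 : ℝ) ≠ 0 := by positivity
    field_simp
  -- integrating first over the probability space gives a product of characteristic functions
  have hprod : ∀ᶠ n : ℕ in atTop, ∫ p, Complex.exp ((∑ i, t i *
      localField a (Y n) e R n p (y i) : ℝ) * Complex.I) ∂(P.prod sphereMeasure) =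
      ∫ x, ∏ k ∈ Finset.Icc (-(n : ℤ)) n, charFun (P.map (a 0)) (c n x k) ∂sphereMeasure := by
    filter_upwards [eventually_ge_atTop 1] with n hn
    have hm : Measurable fun p : Ω × S2 => Complex.exp ((∑ i, t i *
        localField a (Y n) e R n p (y i) : ℝ) * Complex.I) :=
      Complex.measurable_exp.comp ((Complex.measurable_ofReal.comp
        (Finset.measurable_fun_sum _ fun i _ =>
          (measurable_localField (hY n hn) ha he (y i)).const_mul _)).mul_const _)
    rw [integral_prod_symm]
    swap
    · refine Integrable.of_bound hm.aestronglyMeasurable 1 (.of_forall fun p => ?_)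
      rw [Complex.norm_exp_ofReal_mul_I]
    refine integral_congr_ae (.of_forall fun x => ?_)
    simp only
    rw [← integral_exp_sum ha hi hid]
    refine integral_congr_ae (.of_forall fun ω => ?_)
    simp only [localField_eq, hc]
    congr 3
    simp only [Finset.mul_sum]
    rw [Finset.sum_comm]
    exact Finset.sum_congr rfl fun k _ => Finset.sum_congr rfl fun i _ => by ring
  set T : ℝ := ∑ i, |t i| with hT
  have hT0 : 0 ≤ T := Finset.sum_nonneg fun i _ => abs_nonneg _
  have hexp : Tendsto (fun n => Complex.exp (-((V n) / 2 : ℝ))) atTop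
      (𝓝 (Complex.exp (-((∑ i, ∑ j, t i * t j * waveCov R (y i) (y j)) / 2 : ℝ)))) := by
    refine (Complex.continuous_exp.tendsto _).comp (Tendsto.neg ?_)
    exact (Complex.continuous_ofReal.tendsto _).comp (hVlim.div_const 2)
  have hdiff : Tendsto (fun n : ℕ => ∫ x, ∏ k ∈ Finset.Icc (-(n : ℤ)) n,
      charFun (P.map (a 0)) (c n x k) ∂sphereMeasure - Complex.exp (-((V n) / 2 : ℝ))) atTop
      (𝓝 0) := by
    have hPa := Measure.isProbabilityMeasure_map (ha 0).aemeasurable (μ := P)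
    obtain ⟨Vb, hVb⟩ := hVlim.bddAbove_range
    have hVb0 : ∀ n, V n ≤ max Vb 0 + 1 := fun n => (hVb ⟨n, rfl⟩).trans
      ((le_max_left _ _).trans (le_add_of_nonneg_right zero_le_one))
    have hVpos : 0 < max Vb 0 + 1 := by positivity
    rw [Metric.tendsto_atTop']
    intro ξ hξ
    obtain ⟨δ, hδ, hδt⟩ := exists_norm_charFun_sub_le (ha 0) h0 h1
      (div_pos hξ (mul_pos three_pos hVpos))
    set ε : ℝ := δ / (T + 1) with hε
    have hε0 : 0 < ε := by positivity
    have hεT : ε * T ≤ δ := by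
      rw [hε, div_mul_eq_mul_div, div_le_iff₀ (by positivity)]
      nlinarith
    -- the exceptional points, where a single summand is not negligible
    set B : ι → ℕ → Set S2 := fun i n => {x | ∃ k ∈ Finset.Icc (-(n : ℤ)) n,
      ε * √(2 * n + 1) < |Y n k (expPoint e R n (y i) x)|} with hB
    have hBlim : Tendsto (fun n => 2 * ∑ i, sphereMeasure.real (B i n)) atTop (𝓝 0) := by
      have h := (tendsto_finsetSum Finset.univ fun i _ => tendsto_measure_exists_large hY hR
        (fun n => measurable_expPoint e R n he (y i))
        (fun n x => norm_expPoint_sub_le e R n hR (y i).2 x) hε0).const_mul 2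
      rwa [Finset.sum_const_zero, mul_zero] at h
    obtain ⟨N, hN⟩ := eventually_atTop.1 ((hBlim.eventually_lt_const
      (by positivity : 0 < ξ / 3)).and (hcV.and (eventually_ge_atTop 1)))
    refine ⟨N, fun n hn => ?_⟩
    obtain ⟨hBn, hcVn, hn1⟩ := hN n hn.le
    have hmY : ∀ i, ∀ k ∈ Finset.Icc (-(n : ℤ)) n,
        Measurable fun x => Y n k (expPoint e R n (y i) x) := fun i k hk =>
      ((hY n hn1).continuous hk).measurable.comp (measurable_expPoint e R n he (y i))
    have hBm : ∀ i, MeasurableSet (B i n) := fun i => by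
      have : B i n = ⋃ k ∈ Finset.Icc (-(n : ℤ)) n,
          {x | ε * √(2 * n + 1) < |Y n k (expPoint e R n (y i) x)|} := by
        ext x; simp [hB]
      rw [this]
      exact Finset.measurableSet_biUnion _ fun k hk =>
        measurableSet_lt measurable_const (hmY i k hk).abs
    have hBint : ∀ i, Integrable ((B i n).indicator (1 : S2 → ℝ)) sphereMeasure := fun i =>
      (integrable_const 1).indicator (hBm i)
    have hfm : Measurable fun x => ∏ k ∈ Finset.Icc (-(n : ℤ)) n,
        charFun (P.map (a 0)) (c n x k) :=
      Finset.measurable_fun_prod _ fun k hk => continuous_charFun.measurable.comp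
        (measurable_const.mul (Finset.measurable_fun_sum _ fun i _ =>
          (hmY i k hk).const_mul _))
    have hf1 : ∀ x, ‖∏ k ∈ Finset.Icc (-(n : ℤ)) n, charFun (P.map (a 0)) (c n x k)‖ ≤ 1 :=
      fun x => by
        rw [norm_prod]
        exact Finset.prod_le_one (fun _ _ => norm_nonneg _) fun _ _ => norm_charFun_le_one _
    have hfint : Integrable (fun x => ∏ k ∈ Finset.Icc (-(n : ℤ)) n,
        charFun (P.map (a 0)) (c n x k)) sphereMeasure :=
      Integrable.of_bound hfm.aestronglyMeasurable 1 (.of_forall hf1)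
    have hV0 : 0 ≤ V n := by
      rw [← hcVn northPole]
      exact Finset.sum_nonneg fun k _ => sq_nonneg _
    have hpt : ∀ x, ‖∏ k ∈ Finset.Icc (-(n : ℤ)) n, charFun (P.map (a 0)) (c n x k) -
        Complex.exp (-((V n) / 2 : ℝ))‖ ≤
        ξ / 3 + 2 * ∑ i, (B i n).indicator (1 : S2 → ℝ) x := fun x => by
      by_cases hx : ∃ i, x ∈ B i n
      · obtain ⟨i, hi⟩ := hx
        have h2 : (1 : ℝ) ≤ ∑ i, (B i n).indicator (1 : S2 → ℝ) x := by
          have h := Finset.single_le_sum (f := fun i => (B i n).indicator (1 : S2 → ℝ) x)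
            (fun j _ => Set.indicator_nonneg (by simp) x) (Finset.mem_univ i)
          simpa [Set.indicator_of_mem hi] using h
        have h3 : ‖Complex.exp (-((V n) / 2 : ℝ))‖ ≤ 1 := by
          rw [Complex.norm_exp, Complex.neg_re, Complex.ofReal_re, Real.exp_le_one_iff, neg_nonpos]
          positivity
        have h4 := norm_sub_le (∏ k ∈ Finset.Icc (-(n : ℤ)) n, charFun (P.map (a 0)) (c n x k))
          (Complex.exp (-((V n) / 2 : ℝ)))
        linarith [hf1 x]
      · push Not at hx
        have h2 : ∀ k ∈ Finset.Icc (-(n : ℤ)) n, |c n x k| ≤ δ := fun k hk => by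
          have h3 : ∀ i, |Y n k (expPoint e R n (y i) x)| ≤ ε * √(2 * n + 1) := fun i => by
            by_contra! hcon
            exact hx i ⟨k, hk, hcon⟩
          have h4 : |∑ i, t i * Y n k (expPoint e R n (y i) x)| ≤ T * (ε * √(2 * n + 1)) := by
            refine (Finset.abs_sum_le_sum_abs _ _).trans ?_
            rw [hT, Finset.sum_mul]
            refine Finset.sum_le_sum fun i _ => ?_
            rw [abs_mul]
            exact mul_le_mul_of_nonneg_left (h3 i) (abs_nonneg _)
          refine le_trans ?_ hεT
          simp only [hc]
          rw [abs_mul, abs_of_pos (inv_pos.2 (hsqrt0 n)), inv_mul_le_iff₀ (hsqrt0 n)]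
          linarith
        have h5 := norm_charFun_prod_sub_le hδt (ha 0) _ _ h2
        rw [hcVn x] at h5
        have h6 : ξ / (3 * (max Vb 0 + 1)) * V n ≤ ξ / 3 := by
          rw [div_mul_eq_mul_div, div_le_div_iff₀ (by positivity) (by positivity)]
          nlinarith [hVb0 n]
        have h7 : 0 ≤ ∑ i, (B i n).indicator (1 : S2 → ℝ) x :=
          Finset.sum_nonneg fun i _ => Set.indicator_nonneg (by simp) x
        linarith
    have hbint : Integrable (fun x => ξ / 3 + 2 * ∑ i, (B i n).indicator (1 : S2 → ℝ) x)
        sphereMeasure := (integrable_const _).add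
      ((integrable_finsetSum _ fun i _ => hBint i).const_mul 2)
    have hbval : ∫ x, (ξ / 3 + 2 * ∑ i, (B i n).indicator (1 : S2 → ℝ) x) ∂sphereMeasure =
        ξ / 3 + 2 * ∑ i, sphereMeasure.real (B i n) := by
      rw [integral_add (integrable_const _)
        ((integrable_finsetSum _ fun i _ => hBint i).const_mul 2), integral_const_mul,
        integral_finsetSum _ fun i _ => hBint i]
      simp only [integral_indicator_one (hBm _)]
      simp
    have e1 : ∫ x, ∏ k ∈ Finset.Icc (-(n : ℤ)) n, charFun (P.map (a 0)) (c n x k) ∂sphereMeasure -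
        Complex.exp (-((V n) / 2 : ℝ)) =
        ∫ x, (∏ k ∈ Finset.Icc (-(n : ℤ)) n, charFun (P.map (a 0)) (c n x k) -
          Complex.exp (-((V n) / 2 : ℝ))) ∂sphereMeasure := by
      rw [integral_sub hfint (integrable_const _)]
      simp
    rw [dist_zero_right, e1]
    refine (norm_integral_le_of_norm_le hbint (.of_forall hpt)).trans_lt ?_
    rw [hbval]
    linarith
  have h := hdiff.add hexp
  rw [zero_add] at h
  refine h.congr' ?_
  filter_upwards [hprod] with n hn
  rw [hn, sub_add_cancel]

-- needed to find the normed space structure of `C1Ball` under the binders of an integral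
set_option maxSynthPendingDepth 3

/-! ### Local functions as averages of Gaussian bumps -/

/-- The Gaussian bump `y ↦ gauss (W - chart R (t, y))`, as a function on the disc. -/
noncomputable def bump (R : ℝ) (q : ℝ × E3) : C1Ball :=
  toC1Ball fun y => gauss (q.2 - chart R (q.1, y))

lemma contDiff_bump_aux (R : ℝ) :
    ContDiff ℝ 1 fun r : (ℝ × E3) × E2 => gauss (r.1.2 - chart R (r.1.1, r.2)) :=
  contDiff_gauss.comp ((by fun_prop : ContDiff ℝ 1 fun r : (ℝ × E3) × E2 => r.1.2).sub
    ((contDiff_chart R).comp (by fun_prop)))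

lemma continuous_bump (R : ℝ) : Continuous (bump R) := continuous_toC1Ball (contDiff_bump_aux R)

lemma contDiff_bump_slice (R : ℝ) (q : ℝ × E3) :
    ContDiff ℝ 1 fun y => gauss (q.2 - chart R (q.1, y)) :=
  contDiff_gauss.comp (contDiff_const.sub
    ((contDiff_chart R).comp (contDiff_const.prodMk contDiff_id)))

lemma bump_val (R : ℝ) (q : ℝ × E3) (y : unitBall) :
    (bump R q).val y = gauss (q.2 - chart R (q.1, y)) :=
  toC1Ball_val (contDiff_bump_slice R q).contDiffOn y

lemma exists_norm_bump_le (R : ℝ) : ∃ C : ℝ, 0 ≤ C ∧ ∀ t ∈ Set.Icc (0 : ℝ) 1, ∀ W,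
    ‖bump R (t, W)‖ ≤ C * Real.exp (-3 * ‖W‖) := by
  have hK : IsCompact (Set.Icc (0 : ℝ) 1 ×ˢ unitBall) :=
    isCompact_Icc.prod (isCompact_closedBall _ _)
  obtain ⟨A, hA⟩ := hK.exists_bound_of_continuousOn (contDiff_chart R).continuous.continuousOn
  obtain ⟨A', hA'⟩ := hK.exists_bound_of_continuousOn
    ((contDiff_chart R).continuous_fderiv one_ne_zero).continuousOn
  obtain ⟨C, hC, hg⟩ := exists_gauss_le
  have hmem : ((0 : ℝ), (0 : E2)) ∈ Set.Icc (0 : ℝ) 1 ×ˢ unitBall := by simp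
  have hA'0 : 0 ≤ A' := (norm_nonneg _).trans (hA' _ hmem)
  refine ⟨C * Real.exp (3 * A) * (1 + A'), by positivity, fun t ht W => ?_⟩
  have key : ∀ y : unitBall, (1 + ‖W - chart R (t, y)‖) * gauss (W - chart R (t, y)) ≤
      C * Real.exp (3 * A) * Real.exp (-3 * ‖W‖) := fun y => by
    refine (hg _).trans ?_
    rw [mul_assoc, ← Real.exp_add]
    gcongr
    have h1 := hA (t, (y : E2)) ⟨ht, y.2⟩
    have h2 := norm_sub_norm_le W (chart R (t, y))
    linarith
  have hpos : 0 ≤ C * Real.exp (3 * A) * Real.exp (-3 * ‖W‖) := by positivity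
  refine C1Ball.norm_le (by positivity) (fun y => ?_) fun y => ?_
  · rw [bump_val, abs_of_nonneg (gauss_nonneg _)]
    have h1 := key y
    have h2 := mul_nonneg (norm_nonneg (W - chart R (t, y))) (gauss_nonneg (W - chart R (t, y)))
    nlinarith [mul_nonneg hpos hA'0]
  · have hd : HasFDerivAt (fun y => gauss (W - chart R (t, y)))
        ((-gauss (W - chart R (t, y)) • innerSL ℝ (W - chart R (t, y))).comp
          (-((fderiv ℝ (chart R) (t, y)).comp (ContinuousLinearMap.inr ℝ ℝ E2)))) y := by
      have h1 : HasFDerivAt (chart R) (fderiv ℝ (chart R) (t, (y : E2))) (t, (y : E2)) :=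
        ((contDiff_chart R).differentiable one_ne_zero _).hasFDerivAt
      exact (hasFDerivAt_gauss _).comp (y : E2)
        ((h1.comp (y : E2) (hasFDerivAt_prodMk_right t (y : E2))).const_sub W)
    have e1 : (bump R (t, W)).deriv y = _ :=
      (toC1Ball_deriv_of_contDiff (contDiff_bump_slice R (t, W)) y).trans hd.fderiv
    rw [e1]
    refine (ContinuousLinearMap.opNorm_comp_le _ _).trans ?_
    rw [norm_neg, norm_smul, norm_neg, innerSL_apply_norm, Real.norm_of_nonneg (gauss_nonneg _)]
    have h2 : ‖(fderiv ℝ (chart R) (t, (y : E2))).comp (ContinuousLinearMap.inr ℝ ℝ E2)‖ ≤ A' := by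
      refine (ContinuousLinearMap.opNorm_comp_le _ _).trans ?_
      refine (mul_le_of_le_one_right (norm_nonneg _)
        (ContinuousLinearMap.norm_inr_le_one ℝ ℝ E2)).trans (hA' (t, (y : E2)) ⟨ht, y.2⟩)
    have h3 : gauss (W - chart R (t, y)) * ‖W - chart R (t, y)‖ ≤
        C * Real.exp (3 * A) * Real.exp (-3 * ‖W‖) := by
      have h1 := key y
      nlinarith [gauss_nonneg (W - chart R (t, y))]
    calc _ ≤ C * Real.exp (3 * A) * Real.exp (-3 * ‖W‖) * A' :=
          mul_le_mul h3 h2 (norm_nonneg _) hpos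
      _ ≤ _ := by nlinarith

/-- The random harmonic, extended to space as a polynomial, in the coordinates of a frame at `x`
rescaled by `n`. -/
noncomputable def ambientField {Ω : Type*} (a : ℤ → Ω → ℝ) (q : ℤ → MvPolynomial (Fin 3) ℝ)
    (e : (x : S2) → E2 ≃ₗᵢ[ℝ] TangentPlane x) (n : ℕ) (p : Ω × S2) (W : E3) : ℝ :=
  (√(2 * n + 1))⁻¹ * ∑ k ∈ Finset.Icc (-(n : ℤ)) n,
    a k p.1 * ev (q k) ((p.2 : E3) + (n : ℝ)⁻¹ • frame p.2 (e p.2) W)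

section ambientField

variable {Ω : Type*} {a : ℤ → Ω → ℝ} {q : ℤ → MvPolynomial (Fin 3) ℝ}
  {e : (x : S2) → E2 ≃ₗᵢ[ℝ] TangentPlane x} {n : ℕ} {Y : ℤ → S2 → ℝ} {R : ℝ}

lemma continuous_ambientField (p : Ω × S2) : Continuous (ambientField a q e n p) := by
  unfold ambientField
  refine continuous_const.mul (continuous_finsetSum _ fun k _ => continuous_const.mul
    ((continuous_ev _).comp (continuous_const.add ?_)))
  exact ((frame p.2 (e p.2)).continuous).const_smul ((n : ℝ)⁻¹)

lemma exists_abs_ambientField_le (p : Ω × S2) :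
    ∃ C : ℝ, 0 ≤ C ∧ ∀ W, |ambientField a q e n p W| ≤ C * Real.exp ‖W‖ := by
  choose C hC h using fun k => exists_abs_ev_line_le (q k) (p.2 : E3) |(n : ℝ)⁻¹|
  refine ⟨(√(2 * n + 1))⁻¹ * ∑ k ∈ Finset.Icc (-(n : ℤ)) n, |a k p.1| * C k,
    mul_nonneg (by positivity) (Finset.sum_nonneg fun k _ => mul_nonneg (abs_nonneg _) (hC k)),
    fun W => ?_⟩
  rw [ambientField, abs_mul, abs_of_nonneg (by positivity : 0 ≤ (√(2 * n + 1 : ℝ))⁻¹), mul_assoc,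
    Finset.sum_mul]
  gcongr
  refine (Finset.abs_sum_le_sum_abs _ _).trans (Finset.sum_le_sum fun k _ => ?_)
  rw [abs_mul, mul_assoc]
  have h1 := h k _ le_rfl (frame p.2 (e p.2) W)
  rw [LinearIsometryEquiv.norm_map] at h1
  gcongr

/-- A harmonic polynomial equals its Gaussian averages. -/
lemma integral_ambientField_mul_gauss
    (hq : ∀ k ∈ Finset.Icc (-(n : ℤ)) n, polyLaplacian (q k) = 0) (p : Ω × S2) (Z : E3) :
    ∫ W, ambientField a q e n p W * gauss (W - Z) = ambientField a q e n p Z := by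
  set g := frame p.2 (e p.2) with hg
  rw [← integral_add_right_eq_self _ Z]
  simp only [add_sub_cancel_right, ambientField, mul_assoc, Finset.sum_mul]
  have harg : ∀ V : E3, (p.2 : E3) + (n : ℝ)⁻¹ • g V =
      g (g.symm (p.2 : E3) + (n : ℝ)⁻¹ • V) := fun V => by
    rw [map_add, map_smul, LinearIsometryEquiv.apply_symm_apply]
  have hharg : ∀ V : E3, g.symm (p.2 : E3) + (n : ℝ)⁻¹ • (V + Z) =
      (g.symm (p.2 : E3) + (n : ℝ)⁻¹ • Z) + (n : ℝ)⁻¹ • V := fun V => by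
    rw [smul_add]; abel
  simp only [← hg, harg, ← ev_rotate, hharg]
  rw [integral_const_mul, integral_finsetSum]
  swap
  · exact fun k _ => (integrable_ev_mul_gauss _ _ _).const_mul _
  congr 1
  refine Finset.sum_congr rfl fun k hk => ?_
  rw [integral_const_mul, integral_ev_mul_gauss]
  rw [polyLaplacian_rotate, hq k hk]
  simp [rotate]

lemma localField_eq_ambientField (hn : 1 ≤ n)
    (hq : ∀ k ∈ Finset.Icc (-(n : ℤ)) n, ∀ x : S2, Y k x = ev (q k) x) (p : Ω × S2) (y : E2) :
    localField a Y e R n p y = ambientField a q e n p (chart R ((n : ℝ)⁻¹, y)) := by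
  rw [localField_eq, ambientField]
  congr 1
  refine Finset.sum_congr rfl fun k hk => ?_
  rw [hq k hk, coe_expPoint e R hn]

lemma integrable_ambientField_smul_bump (hn : 1 ≤ n) (p : Ω × S2) :
    Integrable fun W => ambientField a q e n p W • bump R ((n : ℝ)⁻¹, W) := by
  obtain ⟨C, hC, h⟩ := exists_abs_ambientField_le (a := a) (q := q) (e := e) (n := n) p
  obtain ⟨D, hD, h'⟩ := exists_norm_bump_le R
  refine (integrable_exp_neg_norm.const_mul (C * D)).mono' ?_ (.of_forall fun W => ?_)
  · exact ((continuous_ambientField p).smul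
      ((continuous_bump R).comp (by fun_prop))).aestronglyMeasurable
  · rw [norm_smul, Real.norm_eq_abs]
    have hn1 : ((n : ℝ)⁻¹) ∈ Set.Icc (0 : ℝ) 1 :=
      ⟨by positivity, inv_le_one_of_one_le₀ (by exact_mod_cast hn)⟩
    calc _ ≤ C * Real.exp ‖W‖ * (D * Real.exp (-3 * ‖W‖)) :=
          mul_le_mul (h W) (h' _ hn1 W) (norm_nonneg _) (by positivity)
      _ = C * D * Real.exp (‖W‖ + -3 * ‖W‖) := by rw [Real.exp_add]; ring
      _ ≤ _ := by gcongr; linarith [norm_nonneg W]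

/-- The local function is an average of Gaussian bumps, with the values of the random harmonic near
`x` as weights. -/
lemma toC1Ball_localField_eq_integral (hn : 1 ≤ n) (hY : IsHarmonicBasis n Y)
    (hq : ∀ k ∈ Finset.Icc (-(n : ℤ)) n, polyLaplacian (q k) = 0 ∧ ∀ x : S2, Y k x = ev (q k) x)
    (p : Ω × S2) : toC1Ball (localField a Y e R n p) =
      ∫ W, ambientField a q e n p W • bump R ((n : ℝ)⁻¹, W) := by
  refine C1Ball.ext_val fun y => ?_
  rw [toC1Ball_val (contDiff_localField hn hY p).contDiffOn, ← C1Ball.evalCLM_apply y (∫ _, _),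
    ← ContinuousLinearMap.integral_comp_comm _ (integrable_ambientField_smul_bump hn p),
    localField_eq_ambientField hn fun k hk => (hq k hk).2,
    ← integral_ambientField_mul_gauss fun k hk => (hq k hk).1]
  refine integral_congr_ae (.of_forall fun W => ?_)
  simp only [map_smul, C1Ball.evalCLM_apply, bump_val, smul_eq_mul]

end ambientField

/-! ### A compact set of averages -/

/-- The Gaussian bump, weighted so that it still tends to `0` at infinity. -/
noncomputable def weightedBump (R : ℝ) (q : ℝ × E3) : C1Ball := Real.exp (2 * ‖q.2‖) • bump R q

lemma continuous_weightedBump (R : ℝ) : Continuous (weightedBump R) :=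
  (by fun_prop : Continuous fun q : ℝ × E3 => Real.exp (2 * ‖q.2‖)).smul (continuous_bump R)

/-- The weighted bumps form a continuous family that tends to `0` at infinity, uniformly in `t`. -/
lemma totallyBounded_weightedBump (R : ℝ) :
    TotallyBounded (weightedBump R '' (Set.Icc (0 : ℝ) 1 ×ˢ Set.univ)) := by
  obtain ⟨C, hC, h⟩ := exists_norm_bump_le R
  have hw : ∀ t ∈ Set.Icc (0 : ℝ) 1, ∀ W, ‖weightedBump R (t, W)‖ ≤ C * Real.exp (-‖W‖) := by
    intro t ht W
    rw [weightedBump, norm_smul, Real.norm_of_nonneg (Real.exp_pos _).le]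
    calc _ ≤ Real.exp (2 * ‖W‖) * (C * Real.exp (-3 * ‖W‖)) := by gcongr; exact h t ht W
      _ = C * Real.exp (2 * ‖W‖ + -3 * ‖W‖) := by rw [Real.exp_add]; ring
      _ = _ := by congr 2; ring
  rw [Metric.totallyBounded_iff]
  intro ε hε
  -- beyond the radius `r` the weighted bumps are `ε`-close to `0`
  obtain ⟨r, hr⟩ : ∃ r : ℝ, C * Real.exp (-r) < ε := by
    have ht : Tendsto (fun r : ℝ => C * Real.exp (-r)) atTop (𝓝 (C * 0)) :=
      (Real.tendsto_exp_neg_atTop_nhds_zero).const_mul C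
    rw [mul_zero] at ht
    exact (ht.eventually_lt_const hε).exists
  have hcomp : IsCompact (weightedBump R '' (Set.Icc (0 : ℝ) 1 ×ˢ Metric.closedBall (0 : E3) r)) :=
    (isCompact_Icc.prod (isCompact_closedBall _ _)).image (continuous_weightedBump R)
  obtain ⟨F, hF, hFc⟩ := Metric.totallyBounded_iff.1 hcomp.totallyBounded ε hε
  refine ⟨insert 0 F, hF.insert 0, ?_⟩
  rintro _ ⟨⟨t, W⟩, ⟨ht, -⟩, rfl⟩
  by_cases hW : ‖W‖ ≤ r
  · obtain ⟨g, hg, hg'⟩ := Set.mem_iUnion₂.1 (hFc ⟨(t, W), ⟨ht, by simpa using hW⟩, rfl⟩)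
    exact Set.mem_iUnion₂.2 ⟨g, Set.mem_insert_of_mem _ hg, hg'⟩
  · refine Set.mem_iUnion₂.2 ⟨0, Set.mem_insert _ _, ?_⟩
    rw [mem_ball_zero_iff]
    refine (hw t ht W).trans_lt (lt_of_le_of_lt ?_ hr)
    gcongr
    exact (not_le.1 hW).le

/-- The closed convex hull of the weighted bumps and their negatives. -/
noncomputable def bumpHull (R : ℝ) : Set C1Ball :=
  closure (convexHull ℝ ((weightedBump R '' (Set.Icc (0 : ℝ) 1 ×ˢ Set.univ)) ∪
    Neg.neg '' (weightedBump R '' (Set.Icc (0 : ℝ) 1 ×ˢ Set.univ))))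

lemma convex_bumpHull (R : ℝ) : Convex ℝ (bumpHull R) := (convex_convexHull ℝ _).closure

lemma isCompact_bumpHull (R : ℝ) : IsCompact (bumpHull R) := by
  have h := totallyBounded_weightedBump R
  have h' := h.image uniformContinuous_neg
  exact isCompact_iff_totallyBounded_isComplete.2 ⟨(h.union h').convexHull.closure,
    isClosed_closure.isComplete⟩

lemma weightedBump_mem (R : ℝ) {t : ℝ} (ht : t ∈ Set.Icc (0 : ℝ) 1) (W : E3) :
    weightedBump R (t, W) ∈ bumpHull R ∧ -weightedBump R (t, W) ∈ bumpHull R := by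
  have h : weightedBump R (t, W) ∈ weightedBump R '' (Set.Icc (0 : ℝ) 1 ×ˢ Set.univ) :=
    ⟨_, ⟨ht, trivial⟩, rfl⟩
  refine ⟨subset_closure (subset_convexHull ℝ _ (Or.inl h)),
    subset_closure (subset_convexHull ℝ _ (Or.inr ⟨_, h, rfl⟩))⟩

/-- An average of bumps whose weights are not too large in the mean lies in a fixed compact set. -/
lemma integral_smul_bump_mem (R : ℝ) {t : ℝ} (ht : t ∈ Set.Icc (0 : ℝ) 1) {w : E3 → ℝ} {M : ℝ}
    (hM : 0 < M) (hw : Integrable fun W => w W • bump R (t, W))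
    (hw' : Integrable fun W => |w W| * Real.exp (-2 * ‖W‖))
    (hwM : ∫ W, |w W| * Real.exp (-2 * ‖W‖) ≤ M) :
    ∫ W, w W • bump R (t, W) ∈ (fun g : C1Ball => M • g) '' bumpHull R := by
  by_contra hcon
  have hclosed : IsClosed ((fun g : C1Ball => M • g) '' bumpHull R) :=
    ((isCompact_bumpHull R).image (continuous_const_smul M)).isClosed
  obtain ⟨f, u, hfu, huf⟩ := geometric_hahn_banach_closed_point
    ((convex_bumpHull R).smul M) hclosed hcon
  have hb : ∀ W, |f (weightedBump R (t, W))| ≤ u / M := fun W => by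
    obtain ⟨h1, h2⟩ := weightedBump_mem R ht W
    have h3 := hfu _ ⟨_, h1, rfl⟩
    have h4 := hfu _ ⟨_, h2, rfl⟩
    simp only [map_smul, map_neg, smul_eq_mul] at h3 h4
    rw [abs_le, le_div_iff₀ hM, neg_le, le_div_iff₀ hM]
    constructor <;> linarith
  have hu : 0 ≤ u / M := (abs_nonneg _).trans (hb 0)
  rw [← ContinuousLinearMap.integral_comp_comm f hw] at huf
  have hle : ∫ W, f (w W • bump R (t, W)) ≤ ∫ W, |w W| * Real.exp (-2 * ‖W‖) * (u / M) := by
    refine integral_mono (f.integrable_comp hw) (hw'.mul_const _) fun W => ?_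
    have e : bump R (t, W) = Real.exp (-2 * ‖W‖) • weightedBump R (t, W) := by
      rw [weightedBump, smul_smul, ← Real.exp_add]
      simp
    rw [e, map_smul, map_smul, smul_eq_mul, smul_eq_mul]
    calc w W * (Real.exp (-2 * ‖W‖) * f (weightedBump R (t, W)))
        ≤ |w W * (Real.exp (-2 * ‖W‖) * f (weightedBump R (t, W)))| := le_abs_self _
      _ = |w W| * Real.exp (-2 * ‖W‖) * |f (weightedBump R (t, W))| := by
        rw [abs_mul, abs_mul, Real.abs_exp, mul_assoc]
      _ ≤ _ := by gcongr; exact hb W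
  rw [integral_mul_const] at hle
  have h5 := mul_le_mul_of_nonneg_right hwM hu
  rw [mul_div_cancel₀ u hM.ne'] at h5
  linarith

/-! ### Tightness -/

section Tightness

variable {Ω : Type*} [MeasurableSpace Ω] {P : Measure Ω} [IsProbabilityMeasure P] {a : ℤ → Ω → ℝ}

lemma lintegral_abs_sum_le (ha : ∀ k, Measurable (a k)) (hi : iIndepFun a P)
    (hid : ∀ k, IdentDistrib (a k) (a 0) P P) (h0 : ∫ ω, a 0 ω ∂P = 0)
    (h1 : ∫ ω, a 0 ω ^ 2 ∂P = 1) (s : Finset ℤ) (b : ℤ → ℝ) {S : ℝ} (hS : 0 < S)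
    (hb : ∑ k ∈ s, b k ^ 2 ≤ S ^ 2) :
    ∫⁻ ω, ENNReal.ofReal |∑ k ∈ s, a k ω * b k| ∂P ≤ ENNReal.ofReal S := by
  have hL0 : MemLp (a 0) 2 P := (memLp_two_iff_integrable_sq (ha 0).aestronglyMeasurable).2
    (.of_integral_ne_zero (by rw [h1]; exact one_ne_zero))
  have hL : ∀ k, MemLp (a k) 2 P := fun k => (hid k).symm.memLp_snd hL0
  have hE : ∀ k, ∫ ω, a k ω ∂P = 0 := fun k => (hid k).integral_eq.trans h0
  have hE2 : ∀ k, ∫ ω, a k ω * a k ω ∂P = 1 := fun k => by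
    have h := ((hid k).comp (u := fun x : ℝ => x ^ 2) (by fun_prop)).integral_eq
    simp only [Function.comp_def, h1] at h
    rw [← h]
    exact integral_congr_ae (.of_forall fun ω => by simp [sq])
  have hint : ∀ k l, Integrable (fun ω => a k ω * a l ω) P := fun k l =>
    (hL k).integrable_mul (hL l)
  have hEE : ∀ k l, ∫ ω, a k ω * a l ω ∂P = if k = l then 1 else 0 := fun k l => by
    split_ifs with h
    · rw [h, hE2]
    · rw [(hi.indepFun h).integral_fun_mul_eq_mul_integral (ha k).aestronglyMeasurable
        (ha l).aestronglyMeasurable, hE, zero_mul]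
  set f : Ω → ℝ := fun ω => ∑ k ∈ s, a k ω * b k with hf
  have hsq : ∀ ω, f ω ^ 2 = ∑ k ∈ s, ∑ l ∈ s, a k ω * a l ω * (b k * b l) := fun ω => by
    rw [hf, sq, Finset.sum_mul_sum]
    exact Finset.sum_congr rfl fun k _ => Finset.sum_congr rfl fun l _ => by ring
  have hfint : Integrable (fun ω => f ω ^ 2) P := by
    simp only [hsq]
    exact integrable_finsetSum _ fun k _ => integrable_finsetSum _ fun l _ =>
      (hint k l).mul_const _
  have hfval : ∫ ω, f ω ^ 2 ∂P = ∑ k ∈ s, b k ^ 2 := by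
    simp only [hsq]
    rw [integral_finsetSum _ fun k _ => integrable_finsetSum _ fun l _ => (hint k l).mul_const _]
    refine Finset.sum_congr rfl fun k hk => ?_
    rw [integral_finsetSum _ fun l _ => (hint k l).mul_const _]
    simp only [integral_mul_const, hEE]
    simp [hk, sq]
  -- the elementary inequality `|f| ≤ (S + f² / S) / 2`
  have hpt : ∀ ω, |f ω| ≤ (S + f ω ^ 2 / S) / 2 := fun ω => by
    rw [le_div_iff₀ two_pos, ← sq_abs (f ω)]
    have h2 : S + |f ω| ^ 2 / S - |f ω| * 2 = (S - |f ω|) ^ 2 / S := by field_simp; ring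
    have h3 : 0 ≤ (S - |f ω|) ^ 2 / S := by positivity
    linarith
  have hgint : Integrable (fun ω => (S + f ω ^ 2 / S) / 2) P :=
    ((integrable_const _).add (hfint.div_const S)).div_const 2
  refine (lintegral_mono fun ω => ENNReal.ofReal_le_ofReal (hpt ω)).trans ?_
  rw [← ofReal_integral_eq_lintegral_ofReal hgint (.of_forall fun ω => (abs_nonneg _).trans (hpt ω))]
  refine ENNReal.ofReal_le_ofReal ?_
  rw [integral_div, integral_add (integrable_const _) (hfint.div_const S), integral_div, hfval]
  simp only [integral_const, probReal_univ, one_smul]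
  have h4 : (∑ k ∈ s, b k ^ 2) / S ≤ S := by
    rw [div_le_iff₀ hS, ← sq]; exact hb
  linarith

variable {n : ℕ} {Y : ℤ → S2 → ℝ} {q : ℤ → MvPolynomial (Fin 3) ℝ}
  {e : (x : S2) → E2 ≃ₗᵢ[ℝ] TangentPlane x}

/-- By homogeneity the constant value of the kernel on the diagonal controls the basis polynomials
everywhere in space. -/
lemma IsHarmonicBasis.sum_ev_sq_le (hY : IsHarmonicBasis n Y)
    (hq : ∀ k ∈ Finset.Icc (-(n : ℤ)) n, (q k).IsHomogeneous n ∧ ∀ x : S2, Y k x = ev (q k) x)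
    (X : E3) : ∑ k ∈ Finset.Icc (-(n : ℤ)) n, ev (q k) X ^ 2 ≤ (2 * n + 1) * (‖X‖ ^ n) ^ 2 := by
  have hunit : ∀ x : S2, ∑ k ∈ Finset.Icc (-(n : ℤ)) n, ev (q k) x ^ 2 = 2 * n + 1 := fun x => by
    rw [← hY.kernel_self x, harmonicKernel]
    exact Finset.sum_congr rfl fun k hk => by rw [(hq k hk).2, sq]
  have key : ∃ x : S2, X = ‖X‖ • (x : E3) := by
    by_cases hX : X = 0
    · exact ⟨northPole, by simp [hX]⟩
    · exact ⟨⟨‖X‖⁻¹ • X, by simp [norm_smul, hX]⟩, by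
        rw [smul_inv_smul₀ (norm_ne_zero_iff.2 hX)]⟩
  obtain ⟨x, hx⟩ := key
  have h : ∀ k ∈ Finset.Icc (-(n : ℤ)) n, ev (q k) X ^ 2 = ev (q k) x ^ 2 * (‖X‖ ^ n) ^ 2 :=
    fun k hk => by
      conv_lhs => rw [hx, ev_smul (hq k hk).1]
      ring
  rw [Finset.sum_congr rfl h, ← Finset.sum_mul, hunit]

lemma norm_add_inv_smul_pow_le (hn : 1 ≤ n) {x W : E3} (hx : ‖x‖ = 1) :
    ‖x + (n : ℝ)⁻¹ • W‖ ^ n ≤ Real.exp ‖W‖ := by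
  have hn0 : (n : ℝ) ≠ 0 := by positivity
  have h1 : ‖x + (n : ℝ)⁻¹ • W‖ ≤ Real.exp ((n : ℝ)⁻¹ * ‖W‖) := by
    refine (norm_add_le _ _).trans ?_
    rw [hx, norm_smul, Real.norm_of_nonneg (by positivity), add_comm]
    exact Real.add_one_le_exp _
  refine (pow_le_pow_left₀ (norm_nonneg _) h1 n).trans (le_of_eq ?_)
  rw [← Real.exp_nat_mul, mul_inv_cancel_left₀ hn0]

/-- The second moment of the rescaled field at `W` is at most `‖x + W / n‖ ^ (2 n)`, with `W` read in
the frame at `x`, and so it is bounded uniformly in `n` and `x`. -/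
lemma lintegral_abs_ambientField_le (ha : ∀ k, Measurable (a k)) (hi : iIndepFun a P)
    (hid : ∀ k, IdentDistrib (a k) (a 0) P P) (h0 : ∫ ω, a 0 ω ∂P = 0)
    (h1 : ∫ ω, a 0 ω ^ 2 ∂P = 1) (hn : 1 ≤ n) (hY : IsHarmonicBasis n Y)
    (hq : ∀ k ∈ Finset.Icc (-(n : ℤ)) n, (q k).IsHomogeneous n ∧ ∀ x : S2, Y k x = ev (q k) x)
    (x : S2) (W : E3) : ∫⁻ ω, ENNReal.ofReal |ambientField a q e n (ω, x) W| ∂P ≤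
      ENNReal.ofReal (Real.exp ‖W‖) := by
  set u : E3 := (x : E3) + (n : ℝ)⁻¹ • frame x (e x) W with hu
  have hrep : ∀ ω, ambientField a q e n (ω, x) W = ∑ k ∈ Finset.Icc (-(n : ℤ)) n,
      a k ω * ((√(2 * n + 1))⁻¹ * ev (q k) u) := fun ω => by
    rw [ambientField, Finset.mul_sum]
    exact Finset.sum_congr rfl fun k _ => by ring
  simp only [hrep]
  refine lintegral_abs_sum_le ha hi hid h0 h1 _ _ (Real.exp_pos _) ?_
  simp only [mul_pow]
  rw [← Finset.mul_sum, inv_pow, Real.sq_sqrt (by positivity), inv_mul_le_iff₀ (by positivity)]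
  refine (hY.sum_ev_sq_le hq u).trans ?_
  gcongr
  rw [← (frame x (e x)).norm_map W]
  exact norm_add_inv_smul_pow_le hn (by simp)

lemma measurable_ambientField (ha : ∀ k, Measurable (a k))
    (he : ∀ y : E2, Measurable fun x : S2 => ((e x y : TangentPlane x) : E3)) :
    Measurable fun r : (Ω × S2) × E3 => ambientField a q e n r.1 r.2 := by
  have hframe : Measurable fun r : (Ω × S2) × E3 => frame r.1.2 (e r.1.2) r.2 := by
    have h : ∀ r : (Ω × S2) × E3, frame r.1.2 (e r.1.2) r.2 =
        ∑ i, r.2 i • frame r.1.2 (e r.1.2) (EuclideanSpace.single i 1) := fun r => by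
      have h2 : r.2 = ∑ j, r.2 j • EuclideanSpace.single j (1 : ℝ) := by
        ext i; simp [Pi.single_apply]
      conv_lhs => rw [h2]
      simp
    simp only [h]
    refine Finset.measurable_fun_sum _ fun i _ => ?_
    have h2 : Measurable fun r : (Ω × S2) × E3 => r.2 i :=
      (EuclideanSpace.proj i : E3 →L[ℝ] ℝ).measurable.comp measurable_snd
    have h3 : Measurable fun r : (Ω × S2) × E3 =>
        frame r.1.2 (e r.1.2) (EuclideanSpace.single i 1) :=
      (measurable_frame e he _).comp (measurable_snd.comp measurable_fst)
    exact h2.smul h3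
  unfold ambientField
  refine measurable_const.mul (Finset.measurable_fun_sum _ fun k _ => ?_)
  have h2 : Measurable fun r : (Ω × S2) × E3 => (r.1.2 : E3) :=
    measurable_subtype_coe.comp (measurable_snd.comp measurable_fst)
  exact ((ha k).comp (measurable_fst.comp measurable_fst)).mul
    ((continuous_ev _).measurable.comp (h2.add (hframe.const_smul ((n : ℝ)⁻¹))))

/-- The laws of the local functions are tight: the functions are averages of Gaussian bumps with
weights that are bounded in the mean, and by Markov's inequality they lie with high probability in a
multiple of a compact set. -/
lemma isTightMeasureSet_localField (ha : ∀ k, Measurable (a k)) (hi : iIndepFun a P)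
    (hid : ∀ k, IdentDistrib (a k) (a 0) P P) (h0 : ∫ ω, a 0 ω ∂P = 0)
    (h1 : ∫ ω, a 0 ω ^ 2 ∂P = 1) {Y : ℕ → ℤ → S2 → ℝ}
    (hY : ∀ n, 1 ≤ n → IsHarmonicBasis n (Y n))
    (he : ∀ y : E2, Measurable fun x : S2 => ((e x y : TangentPlane x) : E3)) (R : ℝ) :
    IsTightMeasureSet {ν : Measure C1Ball | ∃ n, 1 ≤ n ∧
      ν = (P.prod sphereMeasure).map fun p => toC1Ball (localField a (Y n) e R n p)} := by
  rw [isTightMeasureSet_iff_exists_isCompact_measure_compl_le]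
  intro ε hε
  set A : ℝ := ∫ W : E3, Real.exp (-‖W‖) with hA
  have hA0 : 0 ≤ A := integral_nonneg fun W => (Real.exp_pos _).le
  obtain ⟨M, hM, hMε⟩ : ∃ M : ℝ, 0 < M ∧ ENNReal.ofReal A / ENNReal.ofReal M ≤ ε := by
    by_cases htop : ε = ⊤
    · exact ⟨1, one_pos, by simp [htop]⟩
    · have hε' : 0 < ε.toReal := ENNReal.toReal_pos hε.ne' htop
      refine ⟨A / ε.toReal + 1, by positivity, ?_⟩
      rw [← ENNReal.ofReal_div_of_pos (by positivity)]
      refine ENNReal.ofReal_le_of_le_toReal ?_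
      rw [div_le_iff₀ (by positivity)]
      have : ε.toReal * (A / ε.toReal + 1) = A + ε.toReal := by field_simp
      linarith
  have hKc : IsCompact ((fun g : C1Ball => M • g) '' bumpHull R) :=
    (isCompact_bumpHull R).image (continuous_const_smul M)
  refine ⟨_, hKc, ?_⟩
  rintro _ ⟨n, hn, rfl⟩
  obtain ⟨q, hq⟩ := (hY n hn).exists_polynomial
  have hm := measurable_toC1Ball_localField (R := R) hn (hY n hn) ha he
  rw [Measure.map_apply hm hKc.isClosed.measurableSet.compl]
  set J : Ω × S2 → ENNReal := fun p =>
    ∫⁻ W, ENNReal.ofReal (|ambientField a q e n p W| * Real.exp (-2 * ‖W‖)) with hJ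
  have hmeas : Measurable fun r : (Ω × S2) × E3 =>
      ENNReal.ofReal (|ambientField a q e n r.1 r.2| * Real.exp (-2 * ‖r.2‖)) := by
    have h2 := (measurable_ambientField (q := q) (n := n) ha he).abs
    exact ((h2.mul (by fun_prop)).ennreal_ofReal)
  have hJm : Measurable J := hmeas.lintegral_prod_right'
  have hJint : ∫⁻ p, J p ∂(P.prod sphereMeasure) ≤ ENNReal.ofReal A := by
    rw [hJ, lintegral_lintegral_swap hmeas.aemeasurable, hA,
      ofReal_integral_eq_lintegral_ofReal integrable_exp_neg_norm
        (.of_forall fun W => (Real.exp_pos _).le)]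
    refine lintegral_mono fun W => ?_
    have hmW : Measurable fun p : Ω × S2 => ENNReal.ofReal |ambientField a q e n p W| :=
      ((measurable_ambientField (q := q) (n := n) ha he).comp
        (measurable_id.prodMk measurable_const)).abs.ennreal_ofReal
    simp only [ENNReal.ofReal_mul (abs_nonneg _)]
    rw [lintegral_mul_const _ hmW, lintegral_prod_symm' _ hmW]
    have hle : ∫⁻ x, ∫⁻ ω, ENNReal.ofReal |ambientField a q e n (ω, x) W| ∂P ∂sphereMeasure ≤
        ENNReal.ofReal (Real.exp ‖W‖) := by
      refine (lintegral_mono fun x => lintegral_abs_ambientField_le ha hi hid h0 h1 hn (hY n hn)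
        (fun k hk => ⟨(hq k hk).1, (hq k hk).2.2⟩) x W).trans ?_
      simp
    refine (mul_le_mul_left hle _).trans (le_of_eq ?_)
    rw [← ENNReal.ofReal_mul (Real.exp_pos _).le, ← Real.exp_add]
    congr 2
    ring
  have hsub : (fun p => toC1Ball (localField a (Y n) e R n p)) ⁻¹'
      ((fun g : C1Ball => M • g) '' bumpHull R)ᶜ ⊆ {p | ENNReal.ofReal M ≤ J p} := by
    intro p hp
    by_contra hcon
    have hJp : J p < ENNReal.ofReal M := not_le.1 hcon
    refine hp ?_
    have hn1 : ((n : ℝ)⁻¹) ∈ Set.Icc (0 : ℝ) 1 :=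
      ⟨by positivity, inv_le_one_of_one_le₀ (by exact_mod_cast hn)⟩
    simp only
    rw [toC1Ball_localField_eq_integral hn (hY n hn)
      (fun k hk => ⟨(hq k hk).2.1, (hq k hk).2.2⟩) p]
    have hc : Continuous fun W => |ambientField a q e n p W| * Real.exp (-2 * ‖W‖) :=
      (continuous_ambientField p).abs.mul (by fun_prop)
    refine integral_smul_bump_mem R hn1 hM (integrable_ambientField_smul_bump hn p) ?_ ?_
    · obtain ⟨C, hC, h⟩ := exists_abs_ambientField_le (a := a) (q := q) (e := e) (n := n) p
      refine (integrable_exp_neg_norm.const_mul C).mono' hc.aestronglyMeasurable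
        (.of_forall fun W => ?_)
      rw [Real.norm_of_nonneg (by positivity)]
      calc _ ≤ C * Real.exp ‖W‖ * Real.exp (-2 * ‖W‖) := by gcongr; exact h W
        _ = C * Real.exp (-‖W‖) := by rw [mul_assoc, ← Real.exp_add]; congr 2; ring
    · rw [integral_eq_lintegral_of_nonneg_ae (.of_forall fun W => by positivity)
        hc.aestronglyMeasurable]
      exact ENNReal.toReal_le_of_le_ofReal hM.le hJp.le
  refine (measure_mono hsub).trans ((meas_ge_le_lintegral_div hJm.aemeasurable
    (by simpa using hM) ENNReal.ofReal_ne_top).trans (le_trans ?_ hMε))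
  gcongr

end Tightness

/-! ### Finite-dimensional distributions of the plane wave -/

lemma charFun_circleMeasure_eq_re (w : E2) :
    charFun circleMeasure w = ((charFun circleMeasure w).re : ℂ) := by
  have h1 : charFun circleMeasure (-w) = charFun circleMeasure w := by
    rw [charFun_circleMeasure, charFun_circleMeasure, norm_neg]
  rw [charFun_neg] at h1
  exact (Complex.conj_eq_iff_re.1 h1).symm

lemma waveCov_eq (R : ℝ) (y z : E2) :
    charFun circleMeasure (R • y - R • z) = (waveCov R y z : ℂ) := charFun_circleMeasure_eq_re _

lemma waveCov_comm (R : ℝ) (y z : E2) : waveCov R y z = waveCov R z y := by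
  rw [waveCov, waveCov, charFun_circleMeasure, charFun_circleMeasure, norm_sub_rev]

lemma dual_apply_eq_sum {ι : Type*} [Fintype ι] [DecidableEq ι] (L : (ι → ℝ) →L[ℝ] ℝ) (f : ι → ℝ) :
    L f = ∑ i, L (Pi.single i 1) * f i := by
  have h := LinearMap.pi_apply_eq_sum_univ (L : (ι → ℝ) →ₗ[ℝ] ℝ) f
  simp only [ContinuousLinearMap.coe_coe, smul_eq_mul] at h
  rw [h]
  refine Finset.sum_congr rfl fun i _ => ?_
  rw [mul_comm]
  congr 2
  funext j
  simp [Pi.single_apply, eq_comm]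

/-- The finite-dimensional distributions of the process `X` are those of the rescaled plane wave. This
is expressed by their characteristic functions, which is the form that survives weak limits. -/
def HasWaveFDD {Ω : Type*} [MeasurableSpace Ω] (R : ℝ) (X : unitBall → Ω → ℝ) (P : Measure Ω) :
    Prop :=
  ∀ (ι : Type) [Fintype ι] (t : ι → ℝ) (y : ι → unitBall),
    ∫ ω, Complex.exp ((∑ i, t i * X (y i) ω : ℝ) * Complex.I) ∂P =
      Complex.exp (-((∑ i, ∑ j, t i * t j * waveCov R (y i) (y j)) / 2 : ℝ))

namespace HasWaveFDD

variable {Ω : Type*} [MeasurableSpace Ω] {P : Measure Ω} [IsProbabilityMeasure P] {R : ℝ}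
  {X : unitBall → Ω → ℝ}

lemma sum_nonneg (h : HasWaveFDD R X P) {ι : Type} [Fintype ι] (t : ι → ℝ) (y : ι → unitBall) :
    0 ≤ ∑ i, ∑ j, t i * t j * waveCov R (y i) (y j) := by
  have h1 : ‖∫ ω, Complex.exp ((∑ i, t i * X (y i) ω : ℝ) * Complex.I) ∂P‖ ≤ 1 := by
    refine (norm_integral_le_of_norm_le_const (C := 1) (.of_forall fun ω => ?_)).trans (by simp)
    rw [Complex.norm_exp_ofReal_mul_I]
  rw [h ι t y, Complex.norm_exp, Complex.neg_re, Complex.ofReal_re, Real.exp_le_one_iff,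
    neg_nonpos] at h1
  linarith

lemma map_sum_eq (h : HasWaveFDD R X P) (hX : ∀ y, AEMeasurable (X y) P) {ι : Type} [Fintype ι]
    (t : ι → ℝ) (y : ι → unitBall) : P.map (fun ω => ∑ i, t i * X (y i) ω) =
      gaussianReal 0 (∑ i, ∑ j, t i * t j * waveCov R (y i) (y j)).toNNReal := by
  have hm : AEMeasurable (fun ω => ∑ i, t i * X (y i) ω) P :=
    Finset.aemeasurable_fun_sum _ fun i _ => (hX _).const_mul _
  have := Measure.isProbabilityMeasure_map hm
  refine Measure.ext_of_charFun (funext fun s => ?_)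
  rw [charFun_apply_real, integral_map hm (by fun_prop), charFun_gaussianReal,
    Real.coe_toNNReal _ (h.sum_nonneg t y)]
  have h1 := h ι (fun i => s * t i) y
  have e1 : ∀ ω, ((∑ i, s * t i * X (y i) ω : ℝ) : ℂ) = s * ((∑ i, t i * X (y i) ω : ℝ) : ℂ) :=
    fun ω => by
      rw [← Complex.ofReal_mul, Finset.mul_sum]
      simp only [mul_assoc]
  simp only [e1] at h1
  rw [h1]
  have e2 : ∑ i, ∑ j, s * t i * (s * t j) * waveCov R (y i) (y j) =
      s ^ 2 * ∑ i, ∑ j, t i * t j * waveCov R (y i) (y j) := by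
    simp only [Finset.mul_sum]
    exact Finset.sum_congr rfl fun i _ => Finset.sum_congr rfl fun j _ => by ring
  rw [e2]
  congr 1
  push_cast
  ring

lemma map_eq (h : HasWaveFDD R X P) (hX : ∀ y, AEMeasurable (X y) P) (y : unitBall) :
    P.map (X y) = gaussianReal 0 (waveCov R y y).toNNReal := by
  simpa using h.map_sum_eq hX (fun _ : Unit => 1) fun _ => y

lemma gaussian (h : HasWaveFDD R X P) (hX : ∀ y, AEMeasurable (X y) P) :
    IsGaussianProcess X P := by
  refine ⟨fun I => ⟨isGaussian_of_map_eq_gaussianReal fun L => ?_⟩⟩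
  have hm : AEMeasurable (fun ω => I.restrict (X · ω)) P :=
    aemeasurable_pi_lambda _ fun i => hX i
  rw [AEMeasurable.map_map_of_aemeasurable L.continuous.measurable.aemeasurable hm]
  have e : (L ∘ fun ω => I.restrict (X · ω)) =
      fun ω => ∑ i : I, L (Pi.single i 1) * X i ω := by
    funext ω
    exact dual_apply_eq_sum L _
  exact ⟨_, _, by rw [e]; exact h.map_sum_eq hX _ _⟩

lemma memLp (h : HasWaveFDD R X P) (hX : ∀ y, AEMeasurable (X y) P) (y : unitBall) :
    MemLp (X y) 2 P := ((h.gaussian hX).hasGaussianLaw_eval y).memLp_two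

lemma integral_eq_zero (h : HasWaveFDD R X P) (hX : ∀ y, AEMeasurable (X y) P) (y : unitBall) :
    ∫ ω, X y ω ∂P = 0 := by
  rw [← integral_map (f := fun x => x) (hX y) (by fun_prop), h.map_eq hX y, integral_id_gaussianReal]

lemma integral_sum_sq (h : HasWaveFDD R X P) (hX : ∀ y, AEMeasurable (X y) P) {ι : Type}
    [Fintype ι] (t : ι → ℝ) (y : ι → unitBall) : ∫ ω, (∑ i, t i * X (y i) ω) ^ 2 ∂P =
      ∑ i, ∑ j, t i * t j * waveCov R (y i) (y j) := by
  have hm : AEMeasurable (fun ω => ∑ i, t i * X (y i) ω) P :=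
    Finset.aemeasurable_fun_sum _ fun i _ => (hX _).const_mul _
  rw [← integral_map (f := fun x => x ^ 2) hm (by fun_prop), h.map_sum_eq hX t y]
  have h1 := variance_fun_id_gaussianReal (μ := 0)
    (v := (∑ i, ∑ j, t i * t j * waveCov R (y i) (y j)).toNNReal)
  rw [variance_of_integral_eq_zero (by fun_prop) (by simp), Real.coe_toNNReal _
    (h.sum_nonneg t y)] at h1
  exact h1

lemma integral_mul (h : HasWaveFDD R X P) (hX : ∀ y, AEMeasurable (X y) P) (y z : unitBall) :
    ∫ ω, X y ω * X z ω ∂P = waveCov R y z := by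
  have h1 := h.integral_sum_sq hX (fun _ : Fin 2 => 1) ![y, z]
  have h2 := h.integral_sum_sq hX (fun _ : Unit => 1) fun _ => y
  have h3 := h.integral_sum_sq hX (fun _ : Unit => 1) fun _ => z
  simp [Fin.sum_univ_two] at h1 h2 h3
  have hyy := (h.memLp hX y).integrable_sq
  have hzz := (h.memLp hX z).integrable_sq
  have hyz : Integrable (fun ω => X y ω * X z ω) P := (h.memLp hX y).integrable_mul (h.memLp hX z)
  have e : ∫ ω, (X y ω + X z ω) ^ 2 ∂P =
      ∫ ω, X y ω ^ 2 ∂P + 2 * ∫ ω, X y ω * X z ω ∂P + ∫ ω, X z ω ^ 2 ∂P := by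
    have hsum : Integrable (fun ω => X y ω ^ 2 + 2 * (X y ω * X z ω)) P := hyy.add (hyz.const_mul 2)
    rw [← integral_const_mul, ← integral_add hyy (hyz.const_mul 2), ← integral_add hsum hzz]
    exact integral_congr_ae (.of_forall fun ω => by ring)
  rw [e, h2, h3, waveCov_comm R z y] at h1
  linarith

/-- The finite-dimensional distributions determine the law along a sequence of points, as a measure on
the sequence space. -/
lemma map_seq_eq {Ω' : Type*} [MeasurableSpace Ω'] {P' : Measure Ω'} [IsProbabilityMeasure P']
    {X' : unitBall → Ω' → ℝ} (h : HasWaveFDD R X P) (h' : HasWaveFDD R X' P')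
    (hX : ∀ y, AEMeasurable (X y) P) (hX' : ∀ y, AEMeasurable (X' y) P') (D : ℕ → unitBall) :
    P.map (fun ω i => X (D i) ω) = P'.map (fun ω i => X' (D i) ω) := by
  have hm : AEMeasurable (fun ω i => X (D i) ω) P := aemeasurable_pi_lambda _ fun i => hX _
  have hm' : AEMeasurable (fun ω i => X' (D i) ω) P' := aemeasurable_pi_lambda _ fun i => hX' _
  have := Measure.isProbabilityMeasure_map hm
  have := Measure.isProbabilityMeasure_map hm'
  have hI : ∀ I : Finset ℕ, (P.map (fun ω i => X (D i) ω)).map I.restrict =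
      (P'.map (fun ω i => X' (D i) ω)).map I.restrict := by
    intro I
    have hr : Measurable (I.restrict : (ℕ → ℝ) → I → ℝ) := by fun_prop
    have := Measure.isProbabilityMeasure_map (μ := P.map (fun ω i => X (D i) ω)) hr.aemeasurable
    have := Measure.isProbabilityMeasure_map (μ := P'.map (fun ω i => X' (D i) ω)) hr.aemeasurable
    refine Measure.ext_of_charFunDual (funext fun L => ?_)
    have e1 : ∫ ω, Complex.exp (L (I.restrict fun i => X (D i) ω) * Complex.I) ∂P =
        ∫ ω, Complex.exp (L (I.restrict fun i => X' (D i) ω) * Complex.I) ∂P' := by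
      rw [integral_congr_ae (.of_forall fun ω => congrArg (fun r : ℝ => Complex.exp (r * Complex.I))
          (dual_apply_eq_sum L (I.restrict fun i => X (D i) ω))),
        integral_congr_ae (.of_forall fun ω => congrArg (fun r : ℝ => Complex.exp (r * Complex.I))
          (dual_apply_eq_sum L (I.restrict fun i => X' (D i) ω)))]
      exact (h I _ fun i => D i).trans (h' I _ fun i => D i).symm
    rw [charFunDual_apply, charFunDual_apply, integral_map hr.aemeasurable (by fun_prop),
      integral_map hr.aemeasurable (by fun_prop), integral_map hm (by fun_prop),
      integral_map hm' (by fun_prop)]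
    exact e1
  have : ∀ I : Finset ℕ, IsFiniteMeasure ((P'.map (fun ω i => X' (D i) ω)).map
    (I.restrict : (ℕ → ℝ) → I → ℝ)) := fun I => inferInstance
  exact IsProjectiveLimit.unique hI fun I => rfl

end HasWaveFDD

/-- A centred Gaussian process with the covariance of the plane wave has its finite-dimensional
distributions. -/
lemma hasWaveFDD_of_isGaussianProcess {Ω : Type*} [MeasurableSpace Ω] {P : Measure Ω}
    {R : ℝ} {X : unitBall → Ω → ℝ} (hX : IsGaussianProcess X P)
    (h0 : ∀ y, ∫ ω, X y ω ∂P = 0) (hcov : ∀ y z : unitBall, ∫ ω, X y ω * X z ω ∂P = waveCov R y z) :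
    HasWaveFDD R X P := by
  intro ι _ t y
  have := hX.isProbabilityMeasure
  have hg : HasGaussianLaw (fun ω => ∑ i, t i * X (y i) ω) P := by
    have h1 := ((hX.comp_right y).comp_left fun i => t i • ContinuousLinearMap.id ℝ ℝ)
    simpa using h1.hasGaussianLaw_fun_sum (I := Finset.univ)
  have hL : ∀ y, MemLp (X y) 2 P := fun y => (hX.hasGaussianLaw_eval y).memLp_two
  have hint : ∀ i j, Integrable (fun ω => t i * t j * (X (y i) ω * X (y j) ω)) P := fun i j =>
    ((hL (y i)).integrable_mul (hL (y j))).const_mul _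
  have hmean : ∫ ω, ∑ i, t i * X (y i) ω ∂P = 0 := by
    rw [integral_finsetSum _ fun i _ => ((hL (y i)).integrable one_le_two).const_mul _]
    simp [integral_const_mul, h0]
  have hvar : Var[fun ω => ∑ i, t i * X (y i) ω; P] =
      ∑ i, ∑ j, t i * t j * waveCov R (y i) (y j) := by
    rw [variance_of_integral_eq_zero hg.aemeasurable hmean]
    have e : ∀ ω, (∑ i, t i * X (y i) ω) ^ 2 = ∑ i, ∑ j, t i * t j * (X (y i) ω * X (y j) ω) :=
      fun ω => by
        rw [sq, Finset.sum_mul_sum]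
        exact Finset.sum_congr rfl fun i _ => Finset.sum_congr rfl fun j _ => by ring
    simp only [e]
    rw [integral_finsetSum _ fun i _ => integrable_finsetSum _ fun j _ => hint i j]
    refine Finset.sum_congr rfl fun i _ => ?_
    rw [integral_finsetSum _ fun j _ => hint i j]
    exact Finset.sum_congr rfl fun j _ => by rw [integral_const_mul, hcov]
  have h1 := congrFun (congrArg charFun hg.map_eq_gaussianReal) 1
  rw [charFun_apply_real, integral_map hg.aemeasurable (by fun_prop), charFun_gaussianReal, hmean,
    hvar, Real.coe_toNNReal _ (hvar ▸ variance_nonneg _ _)] at h1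
  simp only [Complex.ofReal_one, one_mul] at h1
  rw [h1]
  congr 1
  push_cast
  ring

/-! ### The plane wave on the space of continuously differentiable functions -/

/-- The law of a `C¹` function is determined by its finite-dimensional distributions. -/
lemma eq_of_hasWaveFDD {R : ℝ} {γ γ' : Measure C1Ball} [IsProbabilityMeasure γ]
    [IsProbabilityMeasure γ'] (h : HasWaveFDD R (fun y g => g.val y) γ)
    (h' : HasWaveFDD R (fun y g => g.val y) γ') : γ = γ' := by
  have hm : ∀ y : unitBall, Measurable fun g : C1Ball => g.val y :=
    fun y => (C1Ball.continuous_val y).measurable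
  have h1 : γ.map C1Ball.denseVal = γ'.map C1Ball.denseVal :=
    h.map_seq_eq h' (fun y => (hm y).aemeasurable) (fun y => (hm y).aemeasurable)
      (TopologicalSpace.denseSeq unitBall)
  rw [← C1Ball.measurableEmbedding_denseVal.comap_map γ, h1,
    C1Ball.measurableEmbedding_denseVal.comap_map]

/-- The Gaussian property and the covariance are read off from the characteristic functions. -/
lemma isPlaneWaveLaw_of_hasWaveFDD {R : ℝ} {γ : Measure C1Ball} [IsProbabilityMeasure γ]
    (h : HasWaveFDD R (fun y g => g.val y) γ) : IsPlaneWaveLaw R γ := by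
  have hm : ∀ y : unitBall, AEMeasurable (fun g : C1Ball => g.val y) γ :=
    fun y => (C1Ball.continuous_val y).measurable.aemeasurable
  refine ⟨inferInstance, h.gaussian hm, h.integral_eq_zero hm, fun y z => ?_⟩
  rw [h.integral_mul hm, waveCov_eq]

lemma IsGaussianField.hasWaveFDD {Ω : Type*} [MeasurableSpace Ω] {P : Measure Ω}
    {F : E2 → Ω → ℝ} (hF : IsGaussianField F P circleMeasure) (R : ℝ) :
    HasWaveFDD R (fun y ω => F (R • (y : E2)) ω) P := by
  refine hasWaveFDD_of_isGaussianProcess (hF.gaussian.comp_right fun y : unitBall => R • (y : E2))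
    (fun y => hF.centered _) fun y z => ?_
  have := hF.covariance (R • (y : E2)) (R • (z : E2))
  rw [waveCov_eq] at this
  exact_mod_cast this

/-- A continuous function that takes the values of a `C¹` function at the points of the dense sequence
coincides with it on the disc. -/
lemma contDiffOn_of_denseVal {f : E2 → ℝ} (hf : Continuous f) {g : C1Ball}
    (h : C1Ball.denseVal g = fun i => f (TopologicalSpace.denseSeq unitBall i)) :
    ContDiffOn ℝ 1 f unitBall := by
  have h1 : g.val = fun y : unitBall => f y :=
    C1Ball.eqOn_of_denseVal g.continuous_val_right (by fun_prop) fun i => congrFun h i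
  refine g.contDiffOn_extendZero.congr fun y hy => ?_
  rw [h1]
  exact (extendZero_apply (fun y : unitBall => f y) ⟨y, hy⟩).symm

/-- Every continuous realisation of the plane wave is almost surely `C¹`, and has the law `γ` on
`C¹(B(1))`: its values on a dense sequence are distributed as those of a `γ`-random `C¹` function,
and so they almost surely come from such a function. -/
lemma IsGaussianField.map_toC1Ball {Ω : Type*} [MeasurableSpace Ω] {P : Measure Ω}
    [IsProbabilityMeasure P] {F : E2 → Ω → ℝ} (hF : IsGaussianField F P circleMeasure) {R : ℝ}
    {γ : Measure C1Ball} [IsProbabilityMeasure γ] (hγ : HasWaveFDD R (fun y g => g.val y) γ) :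
    (∀ᵐ ω ∂P, ContDiffOn ℝ 1 (fun y => F (R • y) ω) unitBall) ∧
      AEMeasurable (fun ω => toC1Ball fun y => F (R • y) ω) P ∧
      P.map (fun ω => toC1Ball fun y => F (R • y) ω) = γ := by
  set V : Ω → ℕ → ℝ := fun ω i => F (R • (TopologicalSpace.denseSeq unitBall i : E2)) ω with hV
  have hFm : ∀ y : unitBall, AEMeasurable (fun ω => F (R • (y : E2)) ω) P :=
    fun y => (hF.gaussian.hasGaussianLaw_eval _).aemeasurable
  have hVm : AEMeasurable V P := aemeasurable_pi_lambda _ fun i => hFm _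
  have hemb := C1Ball.measurableEmbedding_denseVal
  have hlaw : P.map V = γ.map C1Ball.denseVal :=
    (hF.hasWaveFDD R).map_seq_eq hγ hFm
      (fun y => (C1Ball.continuous_val y).measurable.aemeasurable)
      (TopologicalSpace.denseSeq unitBall)
  have hrange : ∀ᵐ ω ∂P, V ω ∈ Set.range C1Ball.denseVal := by
    refine ae_of_ae_map hVm (p := fun v => v ∈ Set.range C1Ball.denseVal) ?_
    rw [hlaw]
    exact (ae_map_iff hemb.measurable.aemeasurable hemb.measurableSet_range).2
      (.of_forall fun g => Set.mem_range_self g)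
  have hcont : ∀ ω, Continuous fun y : E2 => F (R • y) ω :=
    fun ω => (hF.continuous ω).comp (by fun_prop)
  have hC1 : ∀ᵐ ω ∂P, ContDiffOn ℝ 1 (fun y => F (R • y) ω) unitBall := by
    filter_upwards [hrange] with ω ⟨g, hg⟩
    exact contDiffOn_of_denseVal (hcont ω) hg
  have hcomp : C1Ball.denseVal ∘ (fun ω => toC1Ball fun y => F (R • y) ω) =ᵐ[P] V := by
    filter_upwards [hC1] with ω hω
    funext i
    exact toC1Ball_val hω _
  have hm : AEMeasurable (fun ω => toC1Ball fun y => F (R • y) ω) P :=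
    hemb.aemeasurable_comp_iff.1 (hVm.congr hcomp.symm)
  refine ⟨hC1, hm, ?_⟩
  rw [← hemb.comap_map (P.map _), AEMeasurable.map_map_of_aemeasurable
    hemb.measurable.aemeasurable hm, Measure.map_congr hcomp, hlaw, hemb.comap_map]

/-! ### Convergence of the local laws -/

/-- The bounded continuous function `g ↦ exp (i ∑ t_j g(y_j))` on `C¹(B(1))`. -/
noncomputable def waveChar {ι : Type*} [Fintype ι] (t : ι → ℝ) (y : ι → unitBall) :
    BoundedContinuousFunction C1Ball ℂ :=
  BoundedContinuousFunction.ofNormedAddCommGroup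
    (fun g => Complex.exp ((∑ i, t i * g.val (y i) : ℝ) * Complex.I))
    (by
      have := fun i => C1Ball.continuous_val (y i)
      fun_prop) 1
    fun g => (Complex.norm_exp_ofReal_mul_I _).le

/-- A tight sequence of laws on `C¹(B(1))` with finite-dimensional distributions converging to those
of the plane wave converges: each limit along an ultrafilter has the finite-dimensional distributions
of the plane wave, and these determine it. -/
lemma exists_tendsto_of_isTight {R : ℝ} (ν : ℕ → ProbabilityMeasure C1Ball)
    (hν : IsTightMeasureSet {((μ : ProbabilityMeasure C1Ball) : Measure C1Ball) |
      μ ∈ Set.range ν})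
    (hlim : ∀ (ι : Type) [Fintype ι] (t : ι → ℝ) (y : ι → unitBall),
      Tendsto (fun n => ∫ g, Complex.exp ((∑ i, t i * g.val (y i) : ℝ) * Complex.I)
        ∂(ν n : Measure C1Ball)) atTop
        (𝓝 (Complex.exp (-((∑ i, ∑ j, t i * t j * waveCov R (y i) (y j)) / 2 : ℝ))))) :
    ∃ γ : ProbabilityMeasure C1Ball, HasWaveFDD R (fun y g => g.val y) (γ : Measure C1Ball) ∧
      Tendsto ν atTop (𝓝 γ) := by
  have hcpt : IsCompact (closure (Set.range ν)) := isCompact_closure_of_isTightMeasureSet hν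
  have key : ∀ U : Ultrafilter ℕ, (U : Filter ℕ) ≤ atTop → ∃ γ : ProbabilityMeasure C1Ball,
      HasWaveFDD R (fun y g => g.val y) (γ : Measure C1Ball) ∧ Tendsto ν U (𝓝 γ) := by
    intro U hU
    obtain ⟨γ, -, hγ⟩ := hcpt.ultrafilter_le_nhds (U.map ν)
      (.trans (by simp) (monotone_principal subset_closure))
    have hγ' : Tendsto ν U (𝓝 γ) := hγ
    refine ⟨γ, fun ι _ t y => ?_, hγ'⟩
    have h1 := (ProbabilityMeasure.tendsto_iff_forall_integral_rclike_tendsto ℂ).1 hγ'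
      (waveChar t y)
    exact tendsto_nhds_unique h1 ((hlim ι t y).mono_left hU)
  obtain ⟨γ, hγ, -⟩ := key (Ultrafilter.of atTop) (Ultrafilter.of_le _)
  refine ⟨γ, hγ, (tendsto_iff_ultrafilter _ _ _).2 fun U hU => ?_⟩
  obtain ⟨γ', hγ', ht⟩ := key U hU
  have := γ.2
  have := γ'.2
  rwa [show γ = γ' from Subtype.ext (eq_of_hasWaveFDD hγ hγ')]

/-- The Lévy–Prokhorov distance metrises weak convergence, since `C¹(B(1))` is separable. -/
lemma tendsto_levyProkhorovEDist {ν : ℕ → ProbabilityMeasure C1Ball}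
    {γ : ProbabilityMeasure C1Ball} (h : Tendsto ν atTop (𝓝 γ)) :
    Tendsto (fun n => levyProkhorovEDist (ν n : Measure C1Ball) (γ : Measure C1Ball)) atTop
      (𝓝 0) := by
  have h1 := (LevyProkhorov.continuous_ofMeasure_probabilityMeasure.tendsto γ).comp h
  exact tendsto_iff_edist_tendsto_0.1 h1

/-- The local laws of the random spherical harmonics converge, in the Lévy–Prokhorov distance, to a
law with the finite-dimensional distributions of the plane wave. -/
lemma exists_tendsto_levyProkhorovEDist_localField {Ω : Type*} [MeasurableSpace Ω] {P : Measure Ω}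
    [IsProbabilityMeasure P] {a : ℤ → Ω → ℝ} (ha : ∀ k, Measurable (a k)) (hi : iIndepFun a P)
    (hid : ∀ k, IdentDistrib (a k) (a 0) P P) (h0 : ∫ ω, a 0 ω ∂P = 0)
    (h1 : ∫ ω, a 0 ω ^ 2 ∂P = 1) {Y : ℕ → ℤ → S2 → ℝ}
    (hY : ∀ n, 1 ≤ n → IsHarmonicBasis n (Y n)) {e : (x : S2) → E2 ≃ₗᵢ[ℝ] TangentPlane x}
    (he : ∀ y : E2, Measurable fun x : S2 => ((e x y : TangentPlane x) : E3)) {R : ℝ} (hR : 0 ≤ R) :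
    ∃ γ : ProbabilityMeasure C1Ball, HasWaveFDD R (fun y g => g.val y) (γ : Measure C1Ball) ∧
      Tendsto (fun n : ℕ => levyProkhorovEDist
        ((P.prod sphereMeasure).map fun p => toC1Ball (localField a (Y n) e R n p))
        (γ : Measure C1Ball)) atTop (𝓝 0) := by
  have hm : ∀ n : ℕ, Measurable fun p : Ω × S2 =>
      toC1Ball (localField a (Y (n + 1)) e R (n + 1) p) :=
    fun n => measurable_toC1Ball_localField n.succ_pos (hY _ n.succ_pos) ha he
  -- shifted by one, since nothing is known at degree zero
  obtain ⟨ν, hν⟩ : ∃ ν : ℕ → ProbabilityMeasure C1Ball, ∀ n, (ν n : Measure C1Ball) =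
      (P.prod sphereMeasure).map fun p => toC1Ball (localField a (Y (n + 1)) e R (n + 1) p) :=
    ⟨fun n => ⟨_, Measure.isProbabilityMeasure_map (hm n).aemeasurable⟩, fun n => rfl⟩
  have htight : IsTightMeasureSet {((μ : ProbabilityMeasure C1Ball) : Measure C1Ball) |
      μ ∈ Set.range ν} := by
    refine (isTightMeasureSet_localField ha hi hid h0 h1 hY he R).subset ?_
    rintro _ ⟨_, ⟨n, rfl⟩, rfl⟩
    exact ⟨n + 1, n.succ_pos, hν n⟩
  obtain ⟨γ, hγ, hlim⟩ := exists_tendsto_of_isTight (R := R) ν htight fun ι _ t y => by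
    refine ((tendsto_add_atTop_iff_nat 1).2 (tendsto_integral_exp_localField P ha hi hid h0 h1 hY
      he hR t y)).congr fun n => ?_
    have hv : AEStronglyMeasurable (fun g : C1Ball =>
        Complex.exp ((∑ i, t i * g.val (y i) : ℝ) * Complex.I))
        ((P.prod sphereMeasure).map fun p => toC1Ball (localField a (Y (n + 1)) e R (n + 1) p)) :=
      (waveChar t y).continuous.aestronglyMeasurable
    rw [hν n, integral_map (hm n).aemeasurable hv]
    refine integral_congr_ae (.of_forall fun p => ?_)
    refine congrArg (fun r : ℝ => Complex.exp (r * Complex.I)) (Finset.sum_congr rfl fun i _ => ?_)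
    rw [toC1Ball_val (contDiff_localField n.succ_pos (hY _ n.succ_pos) p).contDiffOn]
  have hLP := tendsto_levyProkhorovEDist hlim
  simp only [hν] at hLP
  exact ⟨γ, hγ, (tendsto_add_atTop_iff_nat (f := fun n : ℕ => levyProkhorovEDist
    ((P.prod sphereMeasure).map fun p => toC1Ball (localField a (Y n) e R n p))
    (γ : Measure C1Ball)) 1).1 hLP⟩

end RandomWave

open RandomWave

theorem mainTheorem3 {Ω : Type*} [MeasurableSpace Ω] (P : Measure Ω) [IsProbabilityMeasure P]
    (a : ℤ → Ω → ℝ) (ha_meas : ∀ k, Measurable (a k)) (ha_indep : iIndepFun a P)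
    (ha_ident : ∀ k, IdentDistrib (a k) (a 0) P P)
    (ha_mean : ∫ ω, a 0 ω ∂P = 0) (ha_var : ∫ ω, a 0 ω ^ 2 ∂P = 1)
    (Y : ℕ → ℤ → S2 → ℝ) (hY : ∀ n, 1 ≤ n → IsHarmonicBasis n (Y n))
    (e : (x : S2) → E2 ≃ₗᵢ[ℝ] TangentPlane x)
    (he : ∀ y : E2, Measurable fun x : S2 => ((e x y : TangentPlane x) : E3))
    (R : ℝ) (hR : 0 < R) :
    -- the local functions are `C¹`, and their law is a probability measure on `C¹(B(1))`
    (∀ n : ℕ, 1 ≤ n →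
      (∀ p : Ω × S2, ContDiffOn ℝ 1 (localField a (Y n) e R n p) unitBall) ∧
      Measurable (fun p : Ω × S2 => toC1Ball (localField a (Y n) e R n p)) ∧
      IsProbabilityMeasure
        ((P.prod sphereMeasure).map fun p => toC1Ball (localField a (Y n) e R n p))) ∧
    -- the law of the rescaled plane wave exists on `C¹(B(1))`, and the former laws converge to it
    ∃ γ : Measure C1Ball, IsPlaneWaveLaw R γ ∧
      (∀ (Ω' : Type*) [MeasurableSpace Ω'] (P' : Measure Ω') [IsProbabilityMeasure P']
        (F : E2 → Ω' → ℝ), IsGaussianField F P' circleMeasure →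
        (∀ᵐ ω ∂P', ContDiffOn ℝ 1 (fun y => F (R • y) ω) unitBall) ∧
        AEMeasurable (fun ω => toC1Ball fun y => F (R • y) ω) P' ∧
        P'.map (fun ω => toC1Ball fun y => F (R • y) ω) = γ) ∧
      Tendsto (fun n : ℕ => levyProkhorovEDist
        ((P.prod sphereMeasure).map fun p => toC1Ball (localField a (Y n) e R n p)) γ)
        atTop (𝓝 0) := by
  have hm : ∀ n, 1 ≤ n → Measurable fun p : Ω × S2 => toC1Ball (localField a (Y n) e R n p) :=
    fun n hn => measurable_toC1Ball_localField hn (hY n hn) ha_meas he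
  obtain ⟨γ, hγ, hlim⟩ := exists_tendsto_levyProkhorovEDist_localField ha_meas ha_indep ha_ident
    ha_mean ha_var hY he hR.le
  have := γ.2
  exact ⟨fun n hn => ⟨fun p => (contDiff_localField hn (hY n hn) p).contDiffOn, hm n hn,
      Measure.isProbabilityMeasure_map (hm n hn).aemeasurable⟩,
    γ, isPlaneWaveLaw_of_hasWaveFDD hγ, fun Ω' _ P' _ F hF => hF.map_toC1Ball hγ, hlim⟩
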